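/- **Setting.** Let $0<\alpha\le 2$, $|\theta|\le\min\{\alpha,2-\alpha\}$, $\beta>0$ and $0<\beta/\alpha\le 1$. Put $\psi_\alpha^\theta(\kappa)=|\kappa|^\alpha e^{i\,\mathrm{sign}(\kappa)\theta\pi/2}$. The Green function $G_{\alpha,\beta}^\theta$ of the space-time fractional diffusion equation ${}_xD_\theta^\alpha u={}_tD_*^\beta u$ (Riesz–Feller derivative in space, Caputo derivative in time) is the family of finite measures $G_{\alpha,\beta}^\theta(dx;t)$, $t>0$, on $\mathbb R$, weakly continuous in $t$ (in the sense that $t\mapsto\int e^{i\kappa x}G(dx;t)$ is continuous on $(0,\infty)$ for all $\kappa$), with $$\int_0^\infty e^{-st}\int_{\mathbb R}e^{i\kappa x}\,G_{\alpha,\beta}^\theta(dx;t)\,dt=\frac{s^{\beta-1}}{s^\beta+\psi_\alpha^\theta(\kappa)}\qquad(\kappa\in\mathbb R,\ s>0).$$ For $x,t>0$, $K_{\alpha,\beta}^\theta(x;t)=G_{\alpha,\beta}^\theta(x;t)$ denotes its non-negative density on $(0,\infty)$ that is continuous in $x$, when it has one. For $x,\tau>0$ let $$N_\alpha^\theta(x)=\frac1\pi\,\frac{x^{\alpha-1}\sin[\frac\pi2(\alpha-\theta)]}{1+2x^\alpha\cos[\frac\pi2(\alpha-\theta)]+x^{2\alpha}},\qquad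 N_\alpha^\theta(x;\tau)=\tau^{-1}N_\alpha^\theta(x/\tau),$$ and, for $0<\nu<1$, $$M_\nu(z)=\sum_{n\ge0}\frac{(-z)^n}{n!\,\Gamma(-\nu n+1-\nu)},\qquad M_\nu(x;t)=t^{-\nu}M_\nu(x/t^\nu),$$ while $M_1(x;t)=\delta(x-t)$. **Claim.** 1. The Green function exists and is unique. It has no mass at $0$, and $G_{\alpha,\beta}^{-\theta}(\cdot\,;t)$ is the reflection of $G_{\alpha,\beta}^{\theta}(\cdot\,;t)$ in the origin (so the statements below for $x>0$ also describe $x<0$). 2. On $(0,\infty)$: $M_{\beta/\alpha}=2\,G_{2,2\beta/\alpha}^0$ (as densities for $\beta<\alpha$, as the point mass at $t$ for $\beta=\alpha$); and $N_\alpha^\theta(x;\tau)$ is the density of $G_{\alpha,\alpha}^\theta(\cdot\,;\tau)$ if $\theta>\alpha-2$. 3. The density $K_{\alpha,\beta}^\theta$ on $(0,\infty)$ exists if $\beta<\alpha$ or $\theta>\alpha-2$. Whenever it exists, $K_{\alpha,\beta}^\theta(x;t)=t^{-\beta/\alpha}K_{\alpha,\beta}^\theta(x/t^{\beta/\alpha};1)$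 for all $x,t>0$. 4. If $\theta>\alpha-2$, then for all $x,t>0$ $$K_{\alpha,\beta}^\theta(x;t)=\int_0^\infty N_\alpha^\theta(x;\tau)\,M_{\beta/\alpha}(\tau;t)\,d\tau ,$$ with an absolutely convergent integral when $\beta<\alpha$; for $\beta=\alpha$ this reads $K_{\alpha,\alpha}^\theta(x;t)=N_\alpha^\theta(x;t)$. 5. For all admissible parameters, as an identity of measures in $x$, $$G_{\alpha,\beta}^\theta(\cdot\,;t)=2\int_{(0,\infty)} G_{\alpha,\alpha}^\theta(\cdot\,;\tau)\;G_{2,2\beta/\alpha}^0(d\tau;t)\qquad(t>0).$$ If $\beta<\alpha$ and the continuous densities on $(0,\infty)$ exist, then also pointwise, with an absolutely convergent integral, $G_{\alpha,\beta}^\theta(x;t)=2\int_0^\infty G_{\alpha,\alpha}^\theta(x;\tau)\,G_{2,2\beta/\alpha}^0(\tau;t)\,d\tau$ for $x,t>0$. -/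

import Mathlib

open MeasureTheory Set

/-- The symbol `ψ_α^θ(κ) = |κ|^α exp(i sign(κ) θ π / 2)`; the Riesz-Feller derivative `D_θ^α` of order
`α` and skewness `θ` is the operator with Fourier multiplier `-ψ_α^θ(κ)`. -/
noncomputable def rieszFellerSymbol (α θ κ : ℝ) : ℂ :=
  ((|κ| ^ α : ℝ) : ℂ) * Complex.exp (Complex.I * ((SignType.sign κ : ℝ) * θ * Real.pi / 2 : ℝ))

/-- `G t` (`t > 0`) is the law at time `t` of the Green function of the space-time fractional diffusion
equation `D_θ^α u = D_*^β u` (Riesz-Feller derivative in space, Caputo derivative in time) with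
initial datum `δ` (and zero initial velocity if `β > 1`): it is weakly continuous in `t`, and its
transform, Fourier in space (`charFun μ κ = ∫ exp (i κ x) dμ(x)`) and Laplace in time, is
`s^(β-1) / (s^β + ψ_α^θ(κ))`. -/
structure IsGreenFunction (α β θ : ℝ) (G : ℝ → Measure ℝ) : Prop where
  finite : ∀ t : ℝ, 0 < t → IsFiniteMeasure (G t)
  continuousOn : ∀ κ : ℝ, ContinuousOn (fun t : ℝ => charFun (G t) κ) (Ioi 0)
  integrableOn : ∀ κ s : ℝ, 0 < s →
    IntegrableOn (fun t : ℝ => (Real.exp (-(s * t)) : ℂ) * charFun (G t) κ) (Ioi 0)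
  fourier_laplace : ∀ κ s : ℝ, 0 < s →
    ∫ t in Ioi (0 : ℝ), (Real.exp (-(s * t)) : ℂ) * charFun (G t) κ =
      ((s ^ (β - 1) : ℝ) : ℂ) / (((s ^ β : ℝ) : ℂ) + rieszFellerSymbol α θ κ)

/-- `g x t` is, for `x > 0` and `t > 0`, the pointwise Green function `G_{α,β}^θ(x, t)` (also written
`K_{α,β}^θ(x; t)`): the continuous density of the Green function on the open half-line. -/
def IsGreenDensity (α β θ : ℝ) (g : ℝ → ℝ → ℝ) : Prop :=
  ∃ G : ℝ → Measure ℝ, IsGreenFunction α β θ G ∧ ∀ t : ℝ, 0 < t →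
    ContinuousOn (fun x : ℝ => g x t) (Ioi 0) ∧ (∀ x : ℝ, 0 < x → 0 ≤ g x t) ∧
    (G t).restrict (Ioi 0) =
      (volume.restrict (Ioi 0)).withDensity (fun x : ℝ => ENNReal.ofReal (g x t))

/-- The elementary neutral-diffusion density `N_α^θ(x)`, `x > 0`. -/
noncomputable def neutralDensity (α θ x : ℝ) : ℝ :=
  1 / Real.pi * (x ^ (α - 1) * Real.sin (Real.pi / 2 * (α - θ)) /
    (1 + 2 * x ^ α * Real.cos (Real.pi / 2 * (α - θ)) + x ^ (2 * α)))

/-- `N_α^θ(x; τ) = τ⁻¹ N_α^θ(x / τ)`. -/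
noncomputable def neutralDensityAt (α θ x τ : ℝ) : ℝ :=
  τ⁻¹ * neutralDensity α θ (x / τ)

/-- The M-Wright function `M_ν(z) = ∑ (-z)^n / (n! Γ(-ν n + (1 - ν)))`, `0 < ν < 1`. At the poles of
`Γ` Mathlib has `Real.Gamma = 0`, so that the term is `0`, as `1 / Γ = 0` requires. -/
noncomputable def mWright (ν z : ℝ) : ℝ :=
  ∑' n : ℕ, (-z) ^ n / ((n.factorial : ℝ) * Real.Gamma (-ν * n + (1 - ν)))

/-- `M_ν(x; t) = t^(-ν) M_ν(x / t^ν)`. -/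
noncomputable def mWrightAt (ν x t : ℝ) : ℝ :=
  t ^ (-ν) * mWright ν (x / t ^ ν)

/-! Put `ν = β / α`. The Green function at time `t` is the law of `t^ν Z Y`, with `Z > 0` and `Y`
independent. Here `Z` has density `M_ν` (`Z = 1` if `ν = 1`) and is the inverse `ν`-stable
subordinator at time 1; `Y` has the neutral law, that of `G_{α,α}^θ` at time 1. This is
`greenMeasure`.

The transforms compose. The neutral law `h` is characterised by `∫ h(dy) / (s - iy) = s^(α-1) / (s^α
+ e^(iθπ/2))`. After scaling, the Laplace transform in `τ` of its characteristic function at `τκ` is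
`s^(α-1) / (s^α + ψ(κ))`. For `Z`, the Laplace transform in `t` of `E φ(t^ν Z)` is `s^(ν-1) ∫
e^(-s^ν τ) φ(τ) dτ`. Inserting one into the other gives `s^(ν-1) (s^ν)^(α-1) / (s^β + ψ(κ)) =
s^(β-1) / (s^β + ψ(κ))`, which is `isGreenFunction_greenMeasure`. Uniqueness is injectivity of the
Laplace transform on continuous functions, followed by that of the characteristic function.

The claims are then read off from the product. Conditioning on `Z` gives the subordination law for
measures; conditioning on `Y` gives the density. Dilating gives self-similarity. For `α = 2` the
factor `Y` is a fair sign, so on the half-line `2 G_{2,2ν}^0` is the law of `t^ν Z`.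

Two analytic inputs remain. The first is the existence of `h` (`exists_isNeutralLaw`). A function
holomorphic and decaying on the right half-plane is recovered from the real parts of its boundary
values (`HalfPlaneDecay.stieltjes_formula`). For `s^(α-1) / (s^α + e^(iθπ/2))` these are `π N_α^{±θ}
≥ 0`, and `s → ∞` shows that the total mass is 1. If `|θ| = 2 - α`, poles appear at `±i` on the
boundary and become atoms at `±1`.

The second input concerns `M_ν`. The series is turned into an integral along a ray, then along the
imaginary axis; Cauchy's formula yields the Laplace transform `s^(ν-1) exp(-x s^ν)` in time
(`laplace_mWrightAt`). Positivity is not visible from the series. It follows because this transform,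
sampled at the positive integers, is a positive moment sequence on `[0,1]`
(`momentPos_rpow_mul_exp`, `nonneg_of_momentPos_laplace`). The contour integral also bounds
`M_ν(x;t)` by a constant times `1 / x`, which gives a continuous density for every `β < α`, even
when `Y` has atoms. -/

open Filter Topology

/-! ### Cauchy's theorem on strips and sectors -/

/-- Change of variables `y = exp u` between the line and the open half-line. -/
lemma integral_exp_smul_comp_exp {E : Type*} [NormedAddCommGroup E] [NormedSpace ℝ E]
    (g : ℝ → E) :
    ∫ u : ℝ, Real.exp u • g (Real.exp u) = ∫ y in Ioi (0 : ℝ), g y := by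
  have h := integral_image_eq_integral_abs_deriv_smul (s := univ) (f := Real.exp)
    (f' := Real.exp) MeasurableSet.univ
    (fun x _ => (Real.hasDerivAt_exp x).hasDerivWithinAt) Real.exp_injective.injOn g
  rw [image_univ, Real.range_exp] at h
  simp only [h, Measure.restrict_univ, abs_of_pos (Real.exp_pos _)]

lemma integrable_exp_smul_comp_exp {E : Type*} [NormedAddCommGroup E] [NormedSpace ℝ E]
    (g : ℝ → E) :
    Integrable (fun u : ℝ => Real.exp u • g (Real.exp u)) ↔ IntegrableOn g (Ioi 0) := by
  have h := integrableOn_image_iff_integrableOn_abs_deriv_smul (s := univ) (f := Real.exp)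
    (f' := Real.exp) MeasurableSet.univ
    (fun x _ => (Real.hasDerivAt_exp x).hasDerivWithinAt) Real.exp_injective.injOn g
  rw [image_univ, Real.range_exp] at h
  simp only [h, integrableOn_univ, abs_of_pos (Real.exp_pos _)]

/-- Cauchy's theorem on a strip: the horizontal integrals agree. -/
lemma integral_line_eq_of_strip {K : ℂ → ℂ} {a b : ℝ} (hab : a ≤ b) {B : ℝ → ℝ}
    (hd : ∀ u v : ℝ, v ∈ Icc a b → DifferentiableAt ℂ K (u + v * Complex.I))
    (hB : ∀ u v : ℝ, v ∈ Icc a b → ‖K (u + v * Complex.I)‖ ≤ B u)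
    (hi : Integrable B) (htop : Tendsto B atTop (𝓝 0)) (hbot : Tendsto B atBot (𝓝 0)) :
    ∫ u : ℝ, K (u + a * Complex.I) = ∫ u : ℝ, K (u + b * Complex.I) := by
  have hint : ∀ v ∈ Icc a b, Integrable (fun u : ℝ => K (u + v * Complex.I)) := by
    intro v hv
    refine hi.mono' (Continuous.aestronglyMeasurable ?_) (ae_of_all _ fun u => hB u v hv)
    refine continuous_iff_continuousAt.2 fun u => ?_
    have : ContinuousAt (fun u : ℝ => (u : ℂ) + v * Complex.I) u := by fun_prop
    exact ContinuousAt.comp (f := fun u : ℝ => (u : ℂ) + v * Complex.I) (g := K)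
      (hd u v hv).continuousAt this
  have hlim : ∀ v ∈ Icc a b, Tendsto (fun R : ℝ => ∫ u in (-R)..R, K (u + v * Complex.I)) atTop
      (𝓝 (∫ u : ℝ, K (u + v * Complex.I))) := fun v hv =>
    intervalIntegral_tendsto_integral (hint v hv) tendsto_neg_atTop_atBot tendsto_id
  have hside : ∀ f : ℝ → ℝ, Tendsto (fun R => B (f R)) atTop (𝓝 0) →
      Tendsto (fun R : ℝ => ∫ v in a..b, K (f R + v * Complex.I)) atTop (𝓝 0) := by
    intro f hf
    refine squeeze_zero_norm (a := fun R => B (f R) * |b - a|) (fun R => ?_) (by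
      simpa using hf.mul_const |b - a|)
    refine intervalIntegral.norm_integral_le_of_norm_le_const fun v hv => hB _ _ ?_
    rw [uIoc_of_le hab] at hv
    exact Ioc_subset_Icc_self hv
  have h1 := hside (fun R => R) htop
  have h2 := hside (fun R => -R) (hbot.comp tendsto_neg_atTop_atBot)
  have key : ∀ R : ℝ, (((∫ x in (-R)..R, K (x + a * Complex.I)) -
      ∫ x in (-R)..R, K (x + b * Complex.I)) +
      Complex.I • ∫ y in a..b, K (R + y * Complex.I)) -
      Complex.I • ∫ y in a..b, K ((-R : ℝ) + y * Complex.I) = 0 := by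
    intro R
    have := Complex.integral_boundary_rect_eq_zero_of_differentiableOn K ⟨-R, a⟩ ⟨R, b⟩ (by
      intro z hz
      rw [Complex.mem_reProdIm, uIcc_of_le hab] at hz
      have h := hd z.re z.im hz.2
      rw [Complex.re_add_im] at h
      exact h.differentiableWithinAt)
    exact this
  have hl := (((hlim a ⟨le_rfl, hab⟩).sub (hlim b ⟨hab, le_rfl⟩)).add (h1.const_smul Complex.I)).sub
    (h2.const_smul Complex.I)
  have h0 := tendsto_nhds_unique hl (by simp only [key]; exact tendsto_const_nhds)
  simpa [sub_eq_zero] using h0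

/-- Cauchy's theorem on a sector: the integrals along two rays agree. -/
lemma integral_ray_eq_of_sector {G : ℂ → ℂ} {a b : ℝ} (hab : a ≤ b) {B : ℝ → ℝ}
    (hd : ∀ r v : ℝ, 0 < r → v ∈ Icc a b → DifferentiableAt ℂ G (r * Complex.exp (v * Complex.I)))
    (hB : ∀ r v : ℝ, 0 < r → v ∈ Icc a b → ‖G (r * Complex.exp (v * Complex.I))‖ ≤ B r)
    (hi : IntegrableOn B (Ioi 0)) (htop : Tendsto (fun r => r * B r) atTop (𝓝 0))
    (hbot : Tendsto (fun r => r * B r) (𝓝[>] 0) (𝓝 0)) :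
    Complex.exp (a * Complex.I) * ∫ r in Ioi (0 : ℝ), G (r * Complex.exp (a * Complex.I)) =
      Complex.exp (b * Complex.I) * ∫ r in Ioi (0 : ℝ), G (r * Complex.exp (b * Complex.I)) := by
  have hexp : ∀ u v : ℝ, Complex.exp (u + v * Complex.I) =
      ((Real.exp u : ℝ) : ℂ) * Complex.exp (v * Complex.I) := fun u v => by
    rw [Complex.exp_add, Complex.ofReal_exp]
  -- The exponential maps the strip onto the sector; the factor `exp w` is its derivative.
  have key := integral_line_eq_of_strip (K := fun w => Complex.exp w * G (Complex.exp w))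
    (B := fun u => Real.exp u * B (Real.exp u)) hab ?_ ?_ ?_ ?_ ?_
  · have hv : ∀ v : ℝ, ∫ u : ℝ, Complex.exp (u + v * Complex.I) * G (Complex.exp (u + v * Complex.I))
        = Complex.exp (v * Complex.I) * ∫ r in Ioi (0 : ℝ), G (r * Complex.exp (v * Complex.I)) := by
      intro v
      rw [← integral_exp_smul_comp_exp, ← integral_const_mul]
      refine integral_congr_ae (ae_of_all _ fun u => ?_)
      simp only [hexp, Complex.real_smul]
      ring
    rw [hv, hv] at key
    exact key
  · intro u v hv
    refine DifferentiableAt.mul (by fun_prop) ?_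
    refine DifferentiableAt.comp (g := G) (f := Complex.exp) _ ?_ (by fun_prop)
    rw [hexp]
    exact hd _ _ (Real.exp_pos u) hv
  · intro u v hv
    rw [norm_mul, Complex.norm_exp, hexp]
    simp only [Complex.add_re, Complex.ofReal_re, Complex.mul_re, Complex.I_re, mul_zero,
      Complex.ofReal_im, Complex.I_im, mul_one, sub_self, add_zero]
    exact mul_le_mul_of_nonneg_left (hB _ _ (Real.exp_pos u) hv) (Real.exp_pos u).le
  · exact (integrable_exp_smul_comp_exp B).2 hi
  · exact htop.comp Real.tendsto_exp_atTop
  · exact hbot.comp Real.tendsto_exp_atBot_nhdsGT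

/-! ### Holomorphic functions with power decay on the right half-plane -/

lemma integrableOn_min_rpow {p q : ℝ} (hp : p < 1) (hq : 1 < q) :
    IntegrableOn (fun r : ℝ => min (r ^ (-p)) (r ^ (-q))) (Ioi 0) := by
  have hm : Measurable (fun r : ℝ => min (r ^ (-p)) (r ^ (-q))) := by fun_prop
  rw [← Ioc_union_Ioi_eq_Ioi zero_le_one]
  refine IntegrableOn.union ?_ ?_
  · have h : IntegrableOn (fun r : ℝ => r ^ (-p)) (Ioc 0 1) :=
      (intervalIntegrable_iff_integrableOn_Ioc_of_le zero_le_one).1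
        (intervalIntegral.intervalIntegrable_rpow' (by linarith))
    refine h.mono' hm.aestronglyMeasurable ?_
    refine (ae_restrict_iff' measurableSet_Ioc).2 (ae_of_all _ fun r hr => ?_)
    rw [Real.norm_of_nonneg (le_min (Real.rpow_nonneg hr.1.le _) (Real.rpow_nonneg hr.1.le _))]
    exact min_le_left _ _
  · have h : IntegrableOn (fun r : ℝ => r ^ (-q)) (Ioi 1) :=
      integrableOn_Ioi_rpow_of_lt (by linarith) one_pos
    refine h.mono' hm.aestronglyMeasurable ?_
    refine (ae_restrict_iff' measurableSet_Ioi).2 (ae_of_all _ fun r hr => ?_)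
    have hr' : (0 : ℝ) ≤ r := (zero_lt_one.trans hr).le
    rw [Real.norm_of_nonneg (le_min (Real.rpow_nonneg hr' _) (Real.rpow_nonneg hr' _))]
    exact min_le_right _ _

lemma tendsto_mul_min_rpow_atTop {p q : ℝ} (hq : 1 < q) :
    Tendsto (fun r : ℝ => r * min (r ^ (-p)) (r ^ (-q))) atTop (𝓝 0) := by
  refine squeeze_zero' ?_ ?_ (tendsto_rpow_neg_atTop (sub_pos.2 hq))
  · filter_upwards [eventually_gt_atTop 0] with r hr
    positivity
  · filter_upwards [eventually_gt_atTop 0] with r hr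
    calc r * min (r ^ (-p)) (r ^ (-q)) ≤ r * r ^ (-q) :=
          mul_le_mul_of_nonneg_left (min_le_right _ _) hr.le
      _ = r ^ (-(q - 1)) := by
          rw [← Real.rpow_one_add' hr.le (by linarith)]; congr 1; ring

lemma tendsto_mul_min_rpow_nhdsGT {p q : ℝ} (hp : p < 1) :
    Tendsto (fun r : ℝ => r * min (r ^ (-p)) (r ^ (-q))) (𝓝[>] 0) (𝓝 0) := by
  have h0 : Tendsto (fun r : ℝ => r ^ (1 - p)) (𝓝[>] 0) (𝓝 0) := by
    have := (Real.continuousAt_rpow_const 0 (1 - p) (Or.inr (by linarith))).tendsto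
    rw [Real.zero_rpow (by linarith)] at this
    exact this.mono_left nhdsWithin_le_nhds
  refine squeeze_zero' ?_ ?_ h0
  · filter_upwards [self_mem_nhdsWithin] with r hr
    have : (0 : ℝ) < r := hr
    positivity
  · filter_upwards [self_mem_nhdsWithin] with r hr
    have hr : (0 : ℝ) < r := hr
    calc r * min (r ^ (-p)) (r ^ (-q)) ≤ r * r ^ (-p) :=
          mul_le_mul_of_nonneg_left (min_le_left _ _) hr.le
      _ = r ^ (1 - p) := by
          rw [← Real.rpow_one_add' hr.le (by linarith)]; rfl

/-- `F` is holomorphic on the closed right half-plane without the origin and decays like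
`‖z‖ ^ (-p)` and like `‖z‖ ^ (-q)` there. -/
structure HalfPlaneDecay (F : ℂ → ℂ) (p q : ℝ) : Prop where
  diff : ∀ z : ℂ, 0 ≤ z.re → z ≠ 0 → DifferentiableAt ℂ F z
  bound : ∃ C : ℝ, 0 ≤ C ∧ ∀ z : ℂ, 0 ≤ z.re → z ≠ 0 →
    ‖F z‖ ≤ C * ‖z‖ ^ (-p) ∧ ‖F z‖ ≤ C * ‖z‖ ^ (-q)

lemma HalfPlaneDecay.continuousOn_vert {F : ℂ → ℂ} {p q : ℝ} (h : HalfPlaneDecay F p q) {c : ℂ}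
    (hc : c.re = 0) (hc0 : c ≠ 0) : ContinuousOn (fun y : ℝ => F (y * c)) (Ioi 0) := by
  intro y hy
  have hy0 : (y : ℂ) ≠ 0 := Complex.ofReal_ne_zero.2 (ne_of_gt hy)
  refine ContinuousAt.continuousWithinAt ?_
  refine ContinuousAt.comp (f := fun y : ℝ => (y : ℂ) * c) (g := F) ?_ (by fun_prop)
  exact (h.diff _ (by simp [hc]) (mul_ne_zero hy0 hc0)).continuousAt

lemma HalfPlaneDecay.integrableOn_vert {F : ℂ → ℂ} {p q : ℝ} (h : HalfPlaneDecay F p q)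
    (hp : p < 1) (hq : 1 < q) {c : ℂ} (hc : c.re = 0) (hc0 : ‖c‖ = 1) :
    IntegrableOn (fun y : ℝ => F (y * c)) (Ioi 0) := by
  obtain ⟨C, hC, hb⟩ := h.bound
  have hc1 : c ≠ 0 := fun h => by simp [h] at hc0
  refine ((integrableOn_min_rpow hp hq).const_mul C).mono'
    ((h.continuousOn_vert hc hc1).aestronglyMeasurable measurableSet_Ioi) ?_
  refine (ae_restrict_iff' measurableSet_Ioi).2 (ae_of_all _ fun y hy => ?_)
  have hy0 : (y : ℂ) ≠ 0 := Complex.ofReal_ne_zero.2 (ne_of_gt hy)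
  have := hb (y * c) (by simp [hc]) (mul_ne_zero hy0 hc1)
  rw [norm_mul, hc0, mul_one, Complex.norm_real, Real.norm_of_nonneg (le_of_lt hy)] at this
  rw [mul_min_of_nonneg _ _ hC]
  exact le_min this.1 this.2

/-- Cauchy's theorem for the right half-plane. -/
lemma HalfPlaneDecay.integral_vert_eq_zero {F : ℂ → ℂ} {p q : ℝ} (h : HalfPlaneDecay F p q)
    (hp : p < 1) (hq : 1 < q) :
    ∫ y in Ioi (0 : ℝ), (F (y * Complex.I) + F (y * -Complex.I)) = 0 := by
  obtain ⟨C, hC, hb⟩ := h.bound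
  have hre : ∀ r v : ℝ, 0 < r → v ∈ Icc (-(Real.pi / 2)) (Real.pi / 2) →
      0 ≤ ((r : ℂ) * Complex.exp (v * Complex.I)).re ∧
      (r : ℂ) * Complex.exp (v * Complex.I) ≠ 0 ∧ ‖(r : ℂ) * Complex.exp (v * Complex.I)‖ = r := by
    intro r v hr hv
    refine ⟨?_, mul_ne_zero (Complex.ofReal_ne_zero.2 hr.ne') (Complex.exp_ne_zero _), ?_⟩
    · rw [Complex.re_ofReal_mul, Complex.exp_ofReal_mul_I_re]
      exact mul_nonneg hr.le (Real.cos_nonneg_of_mem_Icc hv)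
    · rw [norm_mul, Complex.norm_exp_ofReal_mul_I, mul_one, Complex.norm_real,
        Real.norm_of_nonneg hr.le]
  have key := integral_ray_eq_of_sector (G := F) (a := -(Real.pi / 2)) (b := Real.pi / 2)
    (B := fun r => C * min (r ^ (-p)) (r ^ (-q))) (by linarith [Real.pi_pos])
    (fun r v hr hv => h.diff _ (hre r v hr hv).1 (hre r v hr hv).2.1)
    (fun r v hr hv => by
      have := hb _ (hre r v hr hv).1 (hre r v hr hv).2.1
      rw [(hre r v hr hv).2.2] at this
      rw [mul_min_of_nonneg _ _ hC]
      exact le_min this.1 this.2)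
    ((integrableOn_min_rpow hp hq).const_mul C)
    (by simpa [mul_left_comm] using (tendsto_mul_min_rpow_atTop (p := p) hq).const_mul C)
    (by simpa [mul_left_comm] using (tendsto_mul_min_rpow_nhdsGT (q := q) hp).const_mul C)
  have e1 : Complex.exp (((Real.pi / 2 : ℝ) : ℂ) * Complex.I) = Complex.I := by
    push_cast; exact Complex.exp_pi_div_two_mul_I
  have e2 : Complex.exp (((-(Real.pi / 2) : ℝ) : ℂ) * Complex.I) = -Complex.I := by
    push_cast; rw [neg_mul, Complex.exp_neg, Complex.exp_pi_div_two_mul_I, Complex.inv_I]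
  rw [e1, e2] at key
  rw [integral_add (h.integrableOn_vert hp hq (by simp) (by simp))
    (h.integrableOn_vert hp hq (by simp) (by simp))]
  have : Complex.I * ((∫ y in Ioi (0 : ℝ), F (y * Complex.I)) +
      ∫ y in Ioi (0 : ℝ), F (y * -Complex.I)) = 0 := by
    linear_combination -key
  simpa using this

/-- Only the behaviour at `0` and at infinity matters, since the half-annulus in between is compact
and avoids `0`. As `p ≤ q`, the bound with `p` is the stronger one inside the unit disc and the
bound with `q` the stronger one outside, hence the cut-offs at 1. -/
lemma HalfPlaneDecay.of_bound_near {F : ℂ → ℂ} {p q δ R C : ℝ} (hpq : p ≤ q)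
    (hd : ∀ z : ℂ, 0 ≤ z.re → z ≠ 0 → DifferentiableAt ℂ F z) (hδ : 0 < δ)
    (h0 : ∀ z : ℂ, 0 ≤ z.re → z ≠ 0 → ‖z‖ ≤ δ → ‖F z‖ ≤ C * ‖z‖ ^ (-p))
    (h1 : ∀ z : ℂ, 0 ≤ z.re → R ≤ ‖z‖ → ‖F z‖ ≤ C * ‖z‖ ^ (-q)) : HalfPlaneDecay F p q := by
  refine ⟨hd, ?_⟩
  set d := min δ 1
  set r := max R 1
  have hdpos : 0 < d := lt_min hδ one_pos
  set S : Set ℂ := {z | 0 ≤ z.re} ∩ {z | d ≤ ‖z‖} ∩ Metric.closedBall 0 r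
  have hS : IsCompact S := by
    refine (isCompact_closedBall (0 : ℂ) r).inter_left ?_
    exact (isClosed_le continuous_const Complex.continuous_re).inter
      (isClosed_le continuous_const continuous_norm)
  have hS0 : ∀ z ∈ S, z ≠ 0 := fun z hz h => by
    have := hz.1.2
    simp only [mem_ofPred_eq, h, norm_zero] at this
    linarith
  have hc : ContinuousOn F S := fun z hz =>
    (hd z hz.1.1 (hS0 z hz)).continuousAt.continuousWithinAt
  have hcr : ∀ a : ℝ, ContinuousOn (fun z : ℂ => F z * ((‖z‖ ^ a : ℝ) : ℂ)) S := fun a => by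
    refine hc.mul (Complex.continuous_ofReal.comp_continuousOn ?_)
    exact continuous_norm.continuousOn.rpow_const fun z hz => Or.inl (norm_ne_zero_iff.2 (hS0 z hz))
  obtain ⟨M1, hM1⟩ := hS.exists_bound_of_continuousOn (hcr p)
  obtain ⟨M2, hM2⟩ := hS.exists_bound_of_continuousOn (hcr q)
  have conv : ∀ (a M : ℝ) (z : ℂ), z ≠ 0 → ‖F z * ((‖z‖ ^ a : ℝ) : ℂ)‖ ≤ M →
      ‖F z‖ ≤ M * ‖z‖ ^ (-a) := by
    intro a M z hz h
    have hz' : 0 < ‖z‖ := norm_pos_iff.2 hz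
    rw [norm_mul, Complex.norm_real, Real.norm_of_nonneg (by positivity)] at h
    rw [Real.rpow_neg hz'.le, ← div_eq_mul_inv, le_div_iff₀ (by positivity)]
    exact h
  refine ⟨max (max M1 M2) (max C 0), le_max_of_le_right (le_max_right _ _), fun z hz hz0 => ?_⟩
  have hz' : 0 < ‖z‖ := norm_pos_iff.2 hz0
  have up : ∀ {a M : ℝ}, ‖F z‖ ≤ M * ‖z‖ ^ (-a) → M ≤ max (max M1 M2) (max C 0) →
      ‖F z‖ ≤ max (max M1 M2) (max C 0) * ‖z‖ ^ (-a) := fun h hM =>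
    h.trans (mul_le_mul_of_nonneg_right hM (by positivity))
  have hCle : C ≤ max (max M1 M2) (max C 0) := le_max_of_le_right (le_max_left _ _)
  have hMpos : 0 ≤ max (max M1 M2) (max C 0) := le_max_of_le_right (le_max_right _ _)
  rcases le_or_gt ‖z‖ d with hzd | hzd
  · have h := up (h0 z hz hz0 (hzd.trans (min_le_left _ _))) hCle
    refine ⟨h, h.trans (mul_le_mul_of_nonneg_left ?_ hMpos)⟩
    exact Real.rpow_le_rpow_of_exponent_ge hz' (hzd.trans (min_le_right _ _)) (by linarith)
  rcases le_or_gt r ‖z‖ with hzr | hzr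
  · have h := up (h1 z hz ((le_max_left _ _).trans hzr)) hCle
    refine ⟨h.trans (mul_le_mul_of_nonneg_left ?_ hMpos), h⟩
    exact Real.rpow_le_rpow_of_exponent_le ((le_max_right _ _).trans hzr) (by linarith)
  · have hzS : z ∈ S := ⟨⟨hz, hzd.le⟩, by simpa using hzr.le⟩
    exact ⟨up (conv _ _ z hz0 (hM1 z hzS)) (le_max_of_le_left (le_max_left _ _)),
      up (conv _ _ z hz0 (hM2 z hzS)) (le_max_of_le_left (le_max_right _ _))⟩

lemma norm_le_norm_ofReal_add {s : ℝ} (hs : 0 < s) {z : ℂ} (hz : 0 ≤ z.re) :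
    ‖z‖ ≤ ‖(s : ℂ) + z‖ ∧ s ≤ ‖(s : ℂ) + z‖ := by
  constructor
  · rw [Complex.norm_eq_sqrt_sq_add_sq, Complex.norm_eq_sqrt_sq_add_sq]
    refine Real.sqrt_le_sqrt ?_
    simp only [Complex.add_re, Complex.ofReal_re, Complex.add_im, Complex.ofReal_im, zero_add]
    nlinarith
  · refine le_trans ?_ (Complex.re_le_norm _)
    simp [hz]

lemma ofReal_add_ne_zero {s : ℝ} (hs : 0 < s) {z : ℂ} (hz : 0 ≤ z.re) : (s : ℂ) + z ≠ 0 := by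
  intro h
  have := (norm_le_norm_ofReal_add hs hz).2
  rw [h, norm_zero] at this
  linarith

/-- The pole `-s` lies outside the closed half-plane. Division gains one order at infinity, enough
for Cauchy's theorem even if `F` itself is not integrable there. -/
lemma HalfPlaneDecay.div_add {F : ℂ → ℂ} {p q s : ℝ} (h : HalfPlaneDecay F p q) (hs : 0 < s) :
    HalfPlaneDecay (fun z => F z / (s + z)) p (q + 1) := by
  obtain ⟨C, hC, hb⟩ := h.bound
  refine ⟨fun z hz hz0 => (h.diff z hz hz0).div (by fun_prop) (ofReal_add_ne_zero hs hz),
    C * max s⁻¹ 1, by positivity, fun z hz hz0 => ?_⟩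
  have hz' : 0 < ‖z‖ := norm_pos_iff.2 hz0
  obtain ⟨h1, h2⟩ := norm_le_norm_ofReal_add hs hz
  obtain ⟨b1, b2⟩ := hb z hz hz0
  rw [norm_div]
  constructor
  · calc ‖F z‖ / ‖(s : ℂ) + z‖ ≤ C * ‖z‖ ^ (-p) / s := by gcongr
      _ = C * s⁻¹ * ‖z‖ ^ (-p) := by ring
      _ ≤ _ := by gcongr; exact le_max_left _ _
  · calc ‖F z‖ / ‖(s : ℂ) + z‖ ≤ C * ‖z‖ ^ (-q) / ‖z‖ := by gcongr
      _ = C * 1 * ‖z‖ ^ (-(q + 1)) := by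
          rw [neg_add, Real.rpow_add hz', Real.rpow_neg_one]; ring
      _ ≤ _ := by gcongr; exact le_max_right _ _

/-- The function `(F z - 2 s F s / (s + z)) / (z - s)`, with the singularity at `s` removed. -/
noncomputable def cauchyQuotient (F : ℂ → ℂ) (s : ℝ) : ℂ → ℂ :=
  dslope (fun z => F z - 2 * s * F s / (s + z)) s

lemma cauchyQuotient_of_ne (F : ℂ → ℂ) {s : ℝ} (hs : 0 < s) {z : ℂ} (hz : z ≠ s) :
    cauchyQuotient F s z = (F z - 2 * s * F s / (s + z)) / (z - s) := by
  have hs' : (s : ℂ) ≠ 0 := Complex.ofReal_ne_zero.2 hs.ne'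
  rw [cauchyQuotient, dslope_of_ne _ hz, slope_def_field]
  have : F s - 2 * s * F s / (s + s) = 0 := by field_simp; ring
  rw [this, sub_zero]

/-- The subtracted term equals `F s` at `z = s`, so the singularity is removable. Unlike the
constant `F s` it also decays like `1 / ‖z‖`, which is no worse than `‖z‖ ^ (-q)` for `q ≤ 1`;
division by `z - s` then gains one order. -/
lemma HalfPlaneDecay.cauchyQuotient {F : ℂ → ℂ} {p q s : ℝ} (h : HalfPlaneDecay F p q)
    (hp : 0 ≤ p) (hpq : p ≤ q) (hq : q ≤ 1) (hs : 0 < s) :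
    HalfPlaneDecay (cauchyQuotient F s) p (q + 1) := by
  obtain ⟨C, hC, hb⟩ := h.bound
  set D : ℝ := 2 * s * ‖F s‖
  have hD : 0 ≤ D := by positivity
  have hdH : ∀ z : ℂ, 0 ≤ z.re → z ≠ 0 →
      DifferentiableAt ℂ (fun z => F z - 2 * s * F s / (s + z)) z := fun z hz hz0 =>
    (h.diff z hz hz0).sub ((differentiableAt_const _).div (by fun_prop) (ofReal_add_ne_zero hs hz))
  have hnum : ∀ z : ℂ, 0 ≤ z.re →
      ‖F z - 2 * s * F s / (s + z)‖ ≤ ‖F z‖ + D / ‖(s : ℂ) + z‖ := fun z hz => by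
    refine (norm_sub_le _ _).trans_eq ?_
    rw [norm_div, norm_mul, norm_mul, Complex.norm_real, Real.norm_of_nonneg hs.le,
      Complex.norm_ofNat]
  -- Inside radius `s / 2` the point `s` is at distance at least `s / 2`; beyond `2 * s` one has `‖z
  -- - s‖ ≥ ‖z‖ / 2`. The bounds by 1 let the powers of `‖z‖` absorb the contribution of the
  -- subtracted term.
  refine HalfPlaneDecay.of_bound_near (δ := min (s / 2) 1) (R := max (2 * s) 1)
    (C := (C + D / s) * (2 / s) + (C + D) * 2) (by linarith) ?_ (by positivity) ?_ ?_
  · intro z hz hz0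
    rcases eq_or_ne z s with rfl | hzs
    · have hopen : {z : ℂ | 0 < z.re} ∈ 𝓝 (s : ℂ) :=
        (isOpen_lt continuous_const Complex.continuous_re).mem_nhds (by simpa using hs)
      refine ((Complex.differentiableOn_dslope hopen).2 fun z hz => ?_).differentiableAt hopen
      refine (hdH z (le_of_lt hz) fun h => ?_).differentiableWithinAt
      simp [h] at hz
    · exact (differentiableAt_dslope_of_ne hzs).2 (hdH z hz hz0)
  · intro z hz hz0 hzd
    have hz' : 0 < ‖z‖ := norm_pos_iff.2 hz0
    have hzs2 : ‖z‖ ≤ s / 2 := hzd.trans (min_le_left _ _)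
    have hsub : s / 2 ≤ ‖z - s‖ := by
      have := norm_sub_norm_le (s : ℂ) z
      rw [Complex.norm_real, Real.norm_of_nonneg hs.le, norm_sub_rev] at this
      linarith
    have hne : z ≠ s := fun h => by simp [h] at hsub; linarith
    have h1 : (1 : ℝ) ≤ ‖z‖ ^ (-p) :=
      Real.one_le_rpow_of_pos_of_le_one_of_nonpos hz' (hzd.trans (min_le_right _ _)) (by linarith)
    rw [cauchyQuotient_of_ne F hs hne, norm_div]
    calc ‖F z - 2 * s * F s / (s + z)‖ / ‖z - s‖
        ≤ (C * ‖z‖ ^ (-p) + D / s) / (s / 2) := by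
          gcongr
          refine (hnum z hz).trans ?_
          gcongr
          · exact (hb z hz hz0).1
          · exact (norm_le_norm_ofReal_add hs hz).2
      _ ≤ (C * ‖z‖ ^ (-p) + D / s * ‖z‖ ^ (-p)) / (s / 2) := by
          gcongr
          exact le_mul_of_one_le_right (by positivity) h1
      _ = (C + D / s) * (2 / s) * ‖z‖ ^ (-p) := by field_simp
      _ ≤ _ := by
          gcongr
          exact le_add_of_nonneg_right (by positivity)
  · intro z hz hzR
    have hz1 : 1 ≤ ‖z‖ := (le_max_right _ _).trans hzR
    have hz' : 0 < ‖z‖ := one_pos.trans_le hz1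
    have hz0 : z ≠ 0 := norm_pos_iff.1 hz'
    have hz2 : 2 * s ≤ ‖z‖ := (le_max_left _ _).trans hzR
    have hsub : ‖z‖ / 2 ≤ ‖z - s‖ := by
      have := norm_sub_norm_le z (s : ℂ)
      rw [Complex.norm_real, Real.norm_of_nonneg hs.le] at this
      linarith
    have hne : z ≠ s := fun h => by rw [h, sub_self, norm_zero, ← h] at hsub; linarith
    have h1 : 1 / ‖z‖ ≤ ‖z‖ ^ (-q) := by
      rw [one_div, ← Real.rpow_neg_one]
      exact Real.rpow_le_rpow_of_exponent_le hz1 (by linarith)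
    rw [cauchyQuotient_of_ne F hs hne, norm_div]
    calc ‖F z - 2 * s * F s / (s + z)‖ / ‖z - s‖
        ≤ (C * ‖z‖ ^ (-q) + D * (1 / ‖z‖)) / (‖z‖ / 2) := by
          gcongr
          refine (hnum z hz).trans ?_
          rw [mul_one_div]
          gcongr
          · exact (hb z hz hz0).2
          · exact (norm_le_norm_ofReal_add hs hz).1
      _ ≤ (C * ‖z‖ ^ (-q) + D * ‖z‖ ^ (-q)) / (‖z‖ / 2) := by gcongr
      _ = (C + D) * 2 * ‖z‖ ^ (-(q + 1)) := by
          rw [neg_add, Real.rpow_add hz', Real.rpow_neg_one]; field_simp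
      _ ≤ _ := by
          gcongr
          exact le_add_of_nonneg_left (by positivity)

lemma integral_Ioi_inv_sq_add_sq {s : ℝ} (hs : 0 < s) :
    IntegrableOn (fun y : ℝ => (s ^ 2 + y ^ 2)⁻¹) (Ioi 0) ∧
      ∫ y in Ioi (0 : ℝ), (s ^ 2 + y ^ 2)⁻¹ = Real.pi / (2 * s) := by
  have e : (fun y : ℝ => (s ^ 2 + y ^ 2)⁻¹) =
      fun y => (s ^ 2)⁻¹ * (fun x : ℝ => (1 + x ^ 2)⁻¹) (s⁻¹ * y) := by
    funext y
    have : s ^ 2 + y ^ 2 ≠ 0 := by positivity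
    have : 1 + (s⁻¹ * y) ^ 2 ≠ 0 := by positivity
    field_simp
  rw [e]
  constructor
  · refine Integrable.const_mul ?_ _
    exact (integrable_inv_one_add_sq.comp_mul_left' (inv_ne_zero hs.ne')).integrableOn
  · rw [integral_const_mul, integral_comp_mul_left_Ioi (fun x : ℝ => (1 + x ^ 2)⁻¹) _
      (inv_pos.2 hs), mul_zero,
      integral_Ioi_inv_one_add_sq]
    simp
    field_simp

/-- Cauchy's formula for the right half-plane, together with its conjugate companion. -/
lemma HalfPlaneDecay.cauchy_formula {F : ℂ → ℂ} {p q s : ℝ} (h : HalfPlaneDecay F p q)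
    (hp : 0 ≤ p) (hp1 : p < 1) (hq0 : 0 < q) (hpq : p ≤ q) (hq : q ≤ 1) (hs : 0 < s) :
    IntegrableOn (fun y : ℝ => F (y * Complex.I) / (s - y * Complex.I)) (Ioi 0) ∧
    IntegrableOn (fun y : ℝ => F (y * -Complex.I) / (s + y * Complex.I)) (Ioi 0) ∧
    IntegrableOn (fun y : ℝ => F (y * Complex.I) / (s + y * Complex.I)) (Ioi 0) ∧
    IntegrableOn (fun y : ℝ => F (y * -Complex.I) / (s - y * Complex.I)) (Ioi 0) ∧
    (∫ y in Ioi (0 : ℝ), (F (y * Complex.I) / (s - y * Complex.I) +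
      F (y * -Complex.I) / (s + y * Complex.I))) = 2 * Real.pi * F s ∧
    (∫ y in Ioi (0 : ℝ), (F (y * Complex.I) / (s + y * Complex.I) +
      F (y * -Complex.I) / (s - y * Complex.I))) = 0 := by
  have hA := h.div_add hs
  have hB := h.cauchyQuotient hp hpq hq hs
  have hI : ∀ {G : ℂ → ℂ}, HalfPlaneDecay G p (q + 1) →
      IntegrableOn (fun y : ℝ => G (y * Complex.I)) (Ioi 0) ∧
      IntegrableOn (fun y : ℝ => G (y * -Complex.I)) (Ioi 0) := fun hG =>
    ⟨hG.integrableOn_vert hp1 (by linarith) (by simp) (by simp),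
      hG.integrableOn_vert hp1 (by linarith) (by simp) (by simp)⟩
  have hpl : ∀ y : ℝ, (s : ℂ) + y * Complex.I ≠ 0 := fun y =>
    ofReal_add_ne_zero hs (by simp)
  have hmi : ∀ y : ℝ, (s : ℂ) - y * Complex.I ≠ 0 := fun y => by
    simpa [sub_eq_add_neg] using hpl (-y)
  have hprod : ∀ y : ℝ, ((s : ℂ) + y * Complex.I) * (s - y * Complex.I) =
      (((s ^ 2 + y ^ 2 : ℝ)) : ℂ) := fun y => by
    push_cast; ring_nf; rw [Complex.I_sq]; ring
  -- On the imaginary axis the Cauchy kernel splits into a Poisson kernel, whose integral is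
  -- explicit, and the quotient, whose vertical integral vanishes.
  have e1 : ∀ y : ℝ, F (y * Complex.I) / (s - y * Complex.I) =
      2 * s * F s * (((s ^ 2 + y ^ 2)⁻¹ : ℝ) : ℂ) - _root_.cauchyQuotient F s (y * Complex.I) := by
    intro y
    have hne : (y : ℂ) * Complex.I ≠ s := fun h => hmi y (by rw [h, sub_self])
    rw [cauchyQuotient_of_ne F hs hne, Complex.ofReal_inv, ← hprod]
    have h3 : (y : ℂ) * Complex.I - s ≠ 0 := sub_ne_zero.2 hne
    field_simp [hpl y, hmi y]
    ring
  have e2 : ∀ y : ℝ, F (y * -Complex.I) / (s + y * Complex.I) =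
      2 * s * F s * (((s ^ 2 + y ^ 2)⁻¹ : ℝ) : ℂ) - _root_.cauchyQuotient F s (y * -Complex.I) := by
    intro y
    have hne : (y : ℂ) * -Complex.I ≠ s := fun h => hpl y (by rw [← h]; ring)
    rw [cauchyQuotient_of_ne F hs hne, Complex.ofReal_inv, ← hprod]
    have h3 : (y : ℂ) * -Complex.I - s = -(s + y * Complex.I) := by ring
    have h4 : (s : ℂ) + y * -Complex.I = s - y * Complex.I := by ring
    rw [h3, h4]
    field_simp [hpl y, hmi y]
    ring
  have hq2 : IntegrableOn (fun y : ℝ => 2 * s * F s * (((s ^ 2 + y ^ 2)⁻¹ : ℝ) : ℂ)) (Ioi 0) :=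
    (integral_Ioi_inv_sq_add_sq hs).1.ofReal.const_mul _
  have i1 : IntegrableOn (fun y : ℝ => F (y * Complex.I) / (s - y * Complex.I)) (Ioi 0) := by
    simp only [e1]; exact hq2.sub (hI hB).1
  have i2 : IntegrableOn (fun y : ℝ => F (y * -Complex.I) / (s + y * Complex.I)) (Ioi 0) := by
    simp only [e2]; exact hq2.sub (hI hB).2
  refine ⟨i1, i2, (hI hA).1, by simpa [sub_eq_add_neg] using (hI hA).2, ?_, ?_⟩
  · have z := hB.integral_vert_eq_zero hp1 (by linarith)
    have : ∀ y : ℝ, F (y * Complex.I) / (s - y * Complex.I) +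
        F (y * -Complex.I) / (s + y * Complex.I) =
        2 * (2 * s * F s * (((s ^ 2 + y ^ 2)⁻¹ : ℝ) : ℂ)) -
        (_root_.cauchyQuotient F s (y * Complex.I) +
          _root_.cauchyQuotient F s (y * -Complex.I)) := fun y => by
      rw [e1, e2]; ring
    simp only [this]
    have i3 : IntegrableOn (fun y : ℝ => _root_.cauchyQuotient F s (y * Complex.I) +
        _root_.cauchyQuotient F s (y * -Complex.I)) (Ioi 0) := (hI hB).1.add (hI hB).2
    rw [integral_sub (hq2.const_mul 2) i3, z, sub_zero, integral_const_mul,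
      integral_const_mul, integral_complex_ofReal, (integral_Ioi_inv_sq_add_sq hs).2]
    have : (s : ℂ) ≠ 0 := Complex.ofReal_ne_zero.2 hs.ne'
    push_cast
    field_simp
  · simpa [sub_eq_add_neg] using hA.integral_vert_eq_zero hp1 (by linarith)

/-- The Poisson-type representation of `F` by the real parts of its boundary values. -/
lemma HalfPlaneDecay.stieltjes_formula {F : ℂ → ℂ} {p q s : ℝ} (h : HalfPlaneDecay F p q)
    (hp : 0 ≤ p) (hp1 : p < 1) (hq0 : 0 < q) (hpq : p ≤ q) (hq : q ≤ 1) (hs : 0 < s) :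
    IntegrableOn (fun y : ℝ => ((F (y * Complex.I)).re : ℂ) / (s - y * Complex.I)) (Ioi 0) ∧
    IntegrableOn (fun y : ℝ => ((F (y * -Complex.I)).re : ℂ) / (s + y * Complex.I)) (Ioi 0) ∧
    (∫ y in Ioi (0 : ℝ), (((F (y * Complex.I)).re : ℂ) / (s - y * Complex.I) +
      ((F (y * -Complex.I)).re : ℂ) / (s + y * Complex.I))) = Real.pi * F s := by
  obtain ⟨i1, i2, i3, i4, h1, h2⟩ := h.cauchy_formula hp hp1 hq0 hpq hq hs
  -- Writing the real part as half of `w` plus its conjugate, the first half gives Cauchy's formula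
  -- and the second the conjugate of its vanishing companion; hence `π F s` in place of `2 π F s`.
  have hre : ∀ w d : ℂ, ((w.re : ℝ) : ℂ) / d =
      (1 / 2 : ℂ) * (w / d + (starRingEnd ℂ) (w / (starRingEnd ℂ) d)) := fun w d => by
    rw [Complex.re_eq_add_conj, map_div₀, Complex.conj_conj]; ring
  have c1 : ∀ y : ℝ, (starRingEnd ℂ) ((s : ℂ) - y * Complex.I) = s + y * Complex.I := fun y => by
    simp
  have c2 : ∀ y : ℝ, (starRingEnd ℂ) ((s : ℂ) + y * Complex.I) = s - y * Complex.I := fun y => by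
    simp [sub_eq_add_neg]
  have conjI : ∀ {f : ℝ → ℂ}, IntegrableOn f (Ioi 0) →
      IntegrableOn (fun y => (starRingEnd ℂ) (f y)) (Ioi 0) := fun hf =>
    (Complex.conjCLE.toContinuousLinearMap.integrable_comp hf)
  simp only [hre, c1, c2]
  refine ⟨(i1.add (conjI i3)).const_mul _, (i2.add (conjI i4)).const_mul _, ?_⟩
  have : ∀ y : ℝ, (1 / 2 : ℂ) * (F (y * Complex.I) / (s - y * Complex.I) +
      (starRingEnd ℂ) (F (y * Complex.I) / (s + y * Complex.I))) +
      1 / 2 * (F (y * -Complex.I) / (s + y * Complex.I) +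
      (starRingEnd ℂ) (F (y * -Complex.I) / (s - y * Complex.I))) =
      1 / 2 * (F (y * Complex.I) / (s - y * Complex.I) + F (y * -Complex.I) / (s + y * Complex.I)) +
      1 / 2 * (starRingEnd ℂ) (F (y * Complex.I) / (s + y * Complex.I) +
        F (y * -Complex.I) / (s - y * Complex.I)) := fun y => by
    rw [map_add]; ring
  simp only [this]
  have i5 : IntegrableOn (fun y : ℝ => F (y * Complex.I) / (s - y * Complex.I) +
      F (y * -Complex.I) / (s + y * Complex.I)) (Ioi 0) := i1.add i2
  have i6 : IntegrableOn (fun y : ℝ => F (y * Complex.I) / (s + y * Complex.I) +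
      F (y * -Complex.I) / (s - y * Complex.I)) (Ioi 0) := i3.add i4
  rw [integral_add (i5.const_mul _) ((conjI i6).const_mul _), integral_const_mul,
    integral_const_mul, h1, integral_conj, h2]
  simp
  ring

/-! ### Positive moment sequences and the Laplace transform -/

/-- The linear functional `u ^ k ↦ a k` is nonnegative on the polynomials that are nonnegative on
the unit interval. -/
def MomentPos (a : ℕ → ℝ) : Prop :=
  ∀ (n : ℕ) (c : ℕ → ℝ), (∀ u ∈ Icc (0 : ℝ) 1, 0 ≤ ∑ k ∈ Finset.range n, c k * u ^ k) →
    0 ≤ ∑ k ∈ Finset.range n, c k * a k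

namespace MomentPos

lemma one : MomentPos (fun _ => 1) := fun n c h => by
  simpa using h 1 ⟨zero_le_one, le_rfl⟩

lemma add {a b : ℕ → ℝ} (ha : MomentPos a) (hb : MomentPos b) :
    MomentPos (fun k => a k + b k) := fun n c h => by
  simp only [mul_add, Finset.sum_add_distrib]
  exact add_nonneg (ha n c h) (hb n c h)

lemma const_mul {a : ℕ → ℝ} (ha : MomentPos a) {x : ℝ} (hx : 0 ≤ x) :
    MomentPos (fun k => x * a k) := fun n c h => by
  have : ∑ k ∈ Finset.range n, c k * (x * a k) = x * ∑ k ∈ Finset.range n, c k * a k := by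
    rw [Finset.mul_sum]
    exact Finset.sum_congr rfl fun k _ => by ring
  rw [this]
  exact mul_nonneg hx (ha n c h)

lemma of_tendsto {a : ℕ → ℕ → ℝ} {b : ℕ → ℝ} (ha : ∀ N, MomentPos (a N))
    (h : ∀ k, Tendsto (fun N => a N k) atTop (𝓝 (b k))) : MomentPos b := fun n c hc =>
  ge_of_tendsto' (tendsto_finsetSum _ fun k _ => (h k).const_mul (c k)) fun N => ha N n c hc

/-- Moments of a product of independent `[0,1]`-valued variables: if `P ≥ 0` on `[0,1]`, so is `v ↦
P (u v)` for every `u` in `[0,1]`. The functional of `b` is therefore nonnegative on it, and one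
integrates over `u`. -/
lemma mul_integral {α : Type*} [MeasurableSpace α] {μ : Measure α} {u w : α → ℝ} {b : ℕ → ℝ}
    (hb : MomentPos b) (hu : ∀ᵐ t ∂μ, u t ∈ Icc (0 : ℝ) 1 ∧ 0 ≤ w t)
    (hi : ∀ k : ℕ, Integrable (fun t => u t ^ k * w t) μ) :
    MomentPos (fun k => (∫ t, u t ^ k * w t ∂μ) * b k) := fun n c h => by
  have e : ∑ k ∈ Finset.range n, c k * ((∫ t, u t ^ k * w t ∂μ) * b k) =
      ∫ t, ∑ k ∈ Finset.range n, (c k * b k) * (u t ^ k * w t) ∂μ := by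
    rw [integral_finsetSum _ fun k _ => (hi k).const_mul _]
    refine Finset.sum_congr rfl fun k _ => ?_
    rw [integral_const_mul]
    ring
  rw [e]
  refine integral_nonneg_of_ae ?_
  filter_upwards [hu] with t ht
  have h1 := hb n (fun k => c k * u t ^ k) fun v hv => by
    have := h (u t * v) ⟨mul_nonneg ht.1.1 hv.1, mul_le_one₀ ht.1.2 hv.1 hv.2⟩
    simpa only [mul_pow, mul_assoc] using this
  have e2 : ∑ k ∈ Finset.range n, (c k * b k) * (u t ^ k * w t) =
      (∑ k ∈ Finset.range n, c k * u t ^ k * b k) * w t := by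
    rw [Finset.sum_mul]
    exact Finset.sum_congr rfl fun k _ => by ring
  simp only [Pi.zero_apply, e2]
  exact mul_nonneg h1 ht.2

/-- The exponential series has nonnegative coefficients, each power comes from iterating
`mul_integral`, and positivity passes to pointwise limits. No sign is needed for the exponents
separately. -/
lemma mul_exp_integral {α : Type*} [MeasurableSpace α] {μ : Measure α} {u w : α → ℝ} {b : ℕ → ℝ}
    (hb : MomentPos b) (hu : ∀ᵐ t ∂μ, u t ∈ Icc (0 : ℝ) 1 ∧ 0 ≤ w t)
    (hi : ∀ k : ℕ, Integrable (fun t => u t ^ k * w t) μ) {x : ℝ} (hx : 0 ≤ x) :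
    MomentPos (fun k => Real.exp (x * ∫ t, u t ^ k * w t ∂μ) * b k) := by
  set A : ℕ → ℝ := fun k => ∫ t, u t ^ k * w t ∂μ
  have hpow : ∀ m : ℕ, MomentPos (fun k => A k ^ m * b k) := fun m => by
    induction m with
    | zero => simpa using hb
    | succ m ih => simpa only [pow_succ', mul_assoc] using ih.mul_integral hu hi
  refine of_tendsto (a := fun N k => ∑ m ∈ Finset.range N, x ^ m / m.factorial * (A k ^ m * b k))
    (fun N => ?_) fun k => ?_
  · induction N with
    | zero => intro n c _; simp
    | succ N ih =>
      simp only [Finset.sum_range_succ]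
      exact ih.add ((hpow N).const_mul (by positivity))
  · have h := (NormedSpace.expSeries_div_hasSum_exp (x * A k)).mul_right (b k)
    rw [← Real.exp_eq_exp_ℝ] at h
    refine (h.tendsto_sum_nat).congr fun N => Finset.sum_congr rfl fun m _ => ?_
    rw [mul_pow]; ring

end MomentPos

lemma exp_neg_pow_mul (k : ℕ) (t : ℝ) :
    Real.exp (-t) ^ k * Real.exp (-t) = Real.exp (-(((k : ℝ) + 1) * t)) := by
  rw [← Real.exp_nat_mul, ← Real.exp_add]; congr 1; ring

/-- A continuous function on the half-line is nonnegative if its Laplace transform at the positive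
integers is a positive moment sequence. -/
lemma nonneg_of_momentPos_laplace {f : ℝ → ℝ} (hc : ContinuousOn f (Ioi 0))
    (hi : IntegrableOn (fun t => Real.exp (-t) * f t) (Ioi 0))
    (ha : MomentPos (fun k => ∫ t in Ioi (0 : ℝ), Real.exp (-(((k : ℝ) + 1) * t)) * f t))
    {t₀ : ℝ} (ht₀ : 0 < t₀) : 0 ≤ f t₀ := by
  -- With `u = exp (-t)`, the weight `exp (-t) * f t` has as its `k`-th moment in `u` the Laplace
  -- transform at `k + 1`. The shift by one supplies the integrability.
  have hik : ∀ φ : ℝ → ℝ, Continuous φ → IntegrableOn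
      (fun t => φ (Real.exp (-t)) * (Real.exp (-t) * f t)) (Ioi 0) := by
    intro φ hφ
    obtain ⟨M, hM⟩ := isCompact_Icc.exists_bound_of_continuousOn (hφ.continuousOn (s := Icc 0 1))
    refine Integrable.bdd_mul hi (c := M) (by fun_prop) ?_
    refine (ae_restrict_iff' measurableSet_Ioi).2 (ae_of_all _ fun t ht => hM _ ?_)
    exact ⟨(Real.exp_pos _).le, Real.exp_le_one_iff.2 (neg_nonpos.2 (le_of_lt ht))⟩
  have hpoly : ∀ P : Polynomial ℝ, (∀ u ∈ Icc (0 : ℝ) 1, 0 ≤ P.eval u) →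
      0 ≤ ∫ t in Ioi (0 : ℝ), P.eval (Real.exp (-t)) * (Real.exp (-t) * f t) := by
    intro P hP
    have h := ha (P.natDegree + 1) P.coeff fun u hu => by
      rw [← Polynomial.eval_eq_sum_range]; exact hP u hu
    refine h.trans_eq ?_
    simp only [Polynomial.eval_eq_sum_range, Finset.sum_mul]
    rw [integral_finsetSum]
    · refine Finset.sum_congr rfl fun k _ => ?_
      rw [← integral_const_mul]
      refine integral_congr_ae (ae_of_all _ fun t => ?_)
      simp only [← exp_neg_pow_mul]
      ring
    · intro k _
      exact hik (fun u => P.coeff k * u ^ k) (by fun_prop)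
  have hcont : ∀ φ : ℝ → ℝ, Continuous φ → (∀ u, 0 ≤ φ u) →
      0 ≤ ∫ t in Ioi (0 : ℝ), φ (Real.exp (-t)) * (Real.exp (-t) * f t) := by
    intro φ hφ h0
    set L := ∫ t in Ioi (0 : ℝ), ‖Real.exp (-t) * f t‖
    refine le_of_forall_pos_le_add fun ε hε => ?_
    have hL : 0 ≤ L := integral_nonneg fun _ => norm_nonneg _
    set δ := ε / (2 * (L + 1))
    have hδ : 0 < δ := by positivity
    obtain ⟨P, hP⟩ := exists_polynomial_near_of_continuousOn 0 1 φ hφ.continuousOn δ hδ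
    -- A polynomial within `δ` of `φ ≥ 0` becomes nonnegative after adding `δ`. The error is then
    -- below `2 * δ`, and `δ` was chosen so that `2 * δ * L ≤ ε`.
    have h1 := hpoly (P + Polynomial.C δ) fun u hu => by
      have := abs_lt.1 (hP u hu)
      simp only [Polynomial.eval_add, Polynomial.eval_C]
      linarith [h0 u]
    have i1 := hik (fun u => (P + Polynomial.C δ).eval u) (by fun_prop)
    have h2 : ∫ t in Ioi (0 : ℝ), (P + Polynomial.C δ).eval (Real.exp (-t)) *
        (Real.exp (-t) * f t) ≤
        ∫ t in Ioi (0 : ℝ), (φ (Real.exp (-t)) * (Real.exp (-t) * f t) +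
          2 * δ * ‖Real.exp (-t) * f t‖) := by
      refine setIntegral_mono_on i1 ((hik φ hφ).add (hi.norm.const_mul _)) measurableSet_Ioi
        fun t ht => ?_
      have hu : Real.exp (-t) ∈ Icc (0 : ℝ) 1 :=
        ⟨(Real.exp_pos _).le, Real.exp_le_one_iff.2 (neg_nonpos.2 (le_of_lt ht))⟩
      have h3 := abs_lt.1 (hP _ hu)
      rw [← sub_le_iff_le_add', ← sub_mul]
      refine (le_abs_self _).trans ?_
      rw [abs_mul, Real.norm_eq_abs]
      refine mul_le_mul_of_nonneg_right ?_ (abs_nonneg _)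
      simp only [Polynomial.eval_add, Polynomial.eval_C]
      rw [abs_le]
      constructor <;> linarith
    rw [integral_add (hik φ hφ) (hi.norm.const_mul _), integral_const_mul] at h2
    have h4 : 2 * δ * L ≤ ε := by
      have : 2 * δ * L = ε * (L / (L + 1)) := by simp only [δ]; field_simp
      rw [this]
      exact mul_le_of_le_one_right hε.le ((div_le_one (by positivity)).2 (by linarith))
    linarith
  by_contra! hneg
  obtain ⟨η, hη, hball⟩ : ∃ η > 0, ∀ u, |u - Real.exp (-t₀)| < η → 0 < u ∧ u < 1 ∧
      f (-Real.log u) < 0 := by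
    have hcu : ContinuousAt (fun u : ℝ => f (-Real.log u)) (Real.exp (-t₀)) := by
      refine ContinuousAt.comp (g := f) (f := fun u : ℝ => -Real.log u) ?_
        (Real.continuousAt_log (Real.exp_pos _).ne').neg
      simp only [Real.log_exp, neg_neg]
      exact hc.continuousAt (Ioi_mem_nhds ht₀)
    have h1 : ∀ᶠ u in 𝓝 (Real.exp (-t₀)), f (-Real.log u) < 0 :=
      hcu.eventually_lt_const (by simpa using hneg)
    have h2 : ∀ᶠ u in 𝓝 (Real.exp (-t₀)), 0 < u := lt_mem_nhds (Real.exp_pos _)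
    have h3 : ∀ᶠ u in 𝓝 (Real.exp (-t₀)), u < 1 :=
      gt_mem_nhds (Real.exp_lt_one_iff.2 (by linarith))
    obtain ⟨η, hη, h⟩ := Metric.eventually_nhds_iff.1 (h2.and (h3.and h1))
    exact ⟨η, hη, fun u hu => h (by rwa [Real.dist_eq])⟩
  -- A tent around `exp (-t₀)` inside the region where `f` is negative makes the integral strictly
  -- negative.
  set φ : ℝ → ℝ := fun u => max 0 (η - |u - Real.exp (-t₀)|)
  have hφ : Continuous φ := by fun_prop
  have h0 := hcont φ hφ fun u => le_max_left _ _
  have hle : ∀ t : ℝ, φ (Real.exp (-t)) * (Real.exp (-t) * f t) ≤ 0 := by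
    intro t
    rcases le_or_gt η |Real.exp (-t) - Real.exp (-t₀)| with h | h
    · have : φ (Real.exp (-t)) = 0 := max_eq_left (by linarith)
      simp [this]
    · have h1 := (hball _ h).2.2
      rw [Real.log_exp, neg_neg] at h1
      exact mul_nonpos_of_nonneg_of_nonpos (le_max_left _ _)
        (mul_nonpos_of_nonneg_of_nonpos (Real.exp_pos _).le h1.le)
  have hpos : 0 < ∫ t in Ioi (0 : ℝ), -(φ (Real.exp (-t)) * (Real.exp (-t) * f t)) := by
    have hi' : IntegrableOn (fun t => -(φ (Real.exp (-t)) * (Real.exp (-t) * f t))) (Ioi 0) :=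
      (hik φ hφ).neg
    rw [setIntegral_pos_iff_support_of_nonneg_ae (ae_of_all _ fun t => by
      simpa using hle t) hi']
    have hopen : IsOpen {t : ℝ | |Real.exp (-t) - Real.exp (-t₀)| < η} :=
      isOpen_lt (by fun_prop) continuous_const
    refine (hopen.measure_pos volume ⟨t₀, by simpa using hη⟩).trans_le (measure_mono fun t ht => ?_)
    have h1 := hball _ ht
    rw [Real.log_exp, neg_neg] at h1
    refine ⟨?_, by simpa using h1.2.1⟩
    have h2 : 0 < φ (Real.exp (-t)) := lt_max_of_lt_right (sub_pos.2 ht)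
    rw [Function.mem_support]
    exact neg_ne_zero.2 (mul_ne_zero h2.ne' (mul_ne_zero (Real.exp_pos _).ne' h1.2.2.ne))
  rw [integral_neg] at hpos
  linarith

/-- Uniqueness of the Laplace transform of continuous functions. -/
lemma eq_of_laplace_eq {f g : ℝ → ℂ} (hf : ContinuousOn f (Ioi 0)) (hg : ContinuousOn g (Ioi 0))
    (hfi : ∀ s : ℝ, 0 < s → IntegrableOn (fun t : ℝ => (Real.exp (-(s * t)) : ℂ) * f t) (Ioi 0))
    (hgi : ∀ s : ℝ, 0 < s → IntegrableOn (fun t : ℝ => (Real.exp (-(s * t)) : ℂ) * g t) (Ioi 0))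
    (h : ∀ s : ℝ, 0 < s → ∫ t in Ioi (0 : ℝ), (Real.exp (-(s * t)) : ℂ) * f t =
      ∫ t in Ioi (0 : ℝ), (Real.exp (-(s * t)) : ℂ) * g t) {t : ℝ} (ht : 0 < t) : f t = g t := by
  have key : ∀ L : ℂ →L[ℝ] ℝ, L (f t - g t) = 0 := by
    intro L
    have hc : ContinuousOn (fun t => L (f t - g t)) (Ioi 0) :=
      L.continuous.comp_continuousOn (hf.sub hg)
    have hmul : ∀ (s t : ℝ), Real.exp (-(s * t)) * L (f t - g t) =
        L ((Real.exp (-(s * t)) : ℂ) * f t - (Real.exp (-(s * t)) : ℂ) * g t) := fun s t => by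
      rw [← mul_sub, ← Complex.real_smul, map_smul, smul_eq_mul]
    have hi : ∀ s : ℝ, 0 < s →
        IntegrableOn (fun t => Real.exp (-(s * t)) * L (f t - g t)) (Ioi 0) := fun s hs => by
      simp only [hmul]
      exact L.integrable_comp ((hfi s hs).sub (hgi s hs))
    have hz : ∀ s : ℝ, 0 < s →
        ∫ t in Ioi (0 : ℝ), Real.exp (-(s * t)) * L (f t - g t) = 0 := fun s hs => by
      simp only [hmul]
      have hfg : IntegrableOn (fun t : ℝ => (Real.exp (-(s * t)) : ℂ) * f t -
        (Real.exp (-(s * t)) : ℂ) * g t) (Ioi 0) := (hfi s hs).sub (hgi s hs)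
      rw [L.integral_comp_comm hfg,
        integral_sub (hfi s hs) (hgi s hs), h s hs, sub_self, map_zero]
    -- The zero sequence is a positive moment sequence, so the criterion applies to the difference
    -- and to its negative.
    have h1 := nonneg_of_momentPos_laplace hc (by simpa using hi 1 one_pos)
      (fun n c _ => by simp only [hz _ (Nat.cast_add_one_pos _)]; simp) ht
    have h2 := nonneg_of_momentPos_laplace (f := fun t => -L (f t - g t)) hc.neg
      ((hi 1 one_pos).neg.congr (ae_of_all _ fun t => by simp only [Pi.neg_apply, one_mul]; ring))
      (fun n c _ => by
        simp only [mul_neg, integral_neg, hz _ (Nat.cast_add_one_pos _)]; simp) ht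
    linarith
  have e1 := key Complex.reCLM
  have e2 := key Complex.imCLM
  rw [← sub_eq_zero]
  exact Complex.ext (by simpa using e1) (by simpa using e2)

/-! ### The Bernstein function `s ^ ν` and complete monotonicity -/

lemma integrableOn_one_sub_exp_mul_rpow {ν s : ℝ} (hν : 0 < ν) (hν1 : ν < 1) (hs : 0 < s) :
    IntegrableOn (fun u : ℝ => (1 - Real.exp (-(s * u))) * u ^ (-1 - ν)) (Ioi 0) := by
  refine ((integrableOn_min_rpow hν1 (by linarith : 1 < 1 + ν)).const_mul (max s 1)).mono'
    (by fun_prop) ?_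
  refine (ae_restrict_iff' measurableSet_Ioi).2 (ae_of_all _ fun u hu => ?_)
  have hu : (0 : ℝ) < u := hu
  have h1 : Real.exp (-(s * u)) ≤ 1 := Real.exp_le_one_iff.2 (by nlinarith)
  have h2 : 1 - Real.exp (-(s * u)) ≤ s * u := by
    have := Real.add_one_le_exp (-(s * u)); linarith
  rw [Real.norm_of_nonneg (mul_nonneg (by linarith) (by positivity)),
    mul_min_of_nonneg _ _ (by positivity)]
  refine le_min ?_ ?_
  · calc (1 - Real.exp (-(s * u))) * u ^ (-1 - ν) ≤ s * u * u ^ (-1 - ν) := by gcongr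
      _ = s * u ^ (-ν) := by
          rw [mul_assoc, ← Real.rpow_one_add' hu.le (by linarith)]; congr 2; ring
      _ ≤ _ := by gcongr; exact le_max_left _ _
  · calc (1 - Real.exp (-(s * u))) * u ^ (-1 - ν) ≤ 1 * u ^ (-1 - ν) := by
          gcongr
          linarith [Real.exp_pos (-(s * u))]
      _ ≤ max s 1 * u ^ (-(1 + ν)) := by
          rw [neg_add']
          gcongr
          exact le_max_right _ _

/-- By scaling. Read backwards, this is the Lévy–Khintchine formula for `s ^ ν`; the constant need
not be evaluated, only shown positive for `0 < ν < 1`. -/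
lemma integral_one_sub_exp_mul_rpow {ν s : ℝ} (hs : 0 < s) :
    ∫ u in Ioi (0 : ℝ), (1 - Real.exp (-(s * u))) * u ^ (-1 - ν) =
      (∫ u in Ioi (0 : ℝ), (1 - Real.exp (-u)) * u ^ (-1 - ν)) * s ^ ν := by
  have h := integral_comp_mul_left_Ioi (fun u : ℝ => (1 - Real.exp (-u)) * u ^ (-1 - ν)) 0 hs
  rw [mul_zero, smul_eq_mul] at h
  have h2 : ∫ u in Ioi (0 : ℝ), (1 - Real.exp (-(s * u))) * (s * u) ^ (-1 - ν) =
      s ^ (-1 - ν) * ∫ u in Ioi (0 : ℝ), (1 - Real.exp (-(s * u))) * u ^ (-1 - ν) := by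
    rw [← integral_const_mul]
    refine setIntegral_congr_fun measurableSet_Ioi fun u hu => ?_
    simp only [Real.mul_rpow hs.le (le_of_lt hu)]
    ring
  rw [h2] at h
  have e : s ^ (-1 - ν) = s⁻¹ * (s ^ ν)⁻¹ := by
    rw [sub_eq_add_neg, Real.rpow_add hs, Real.rpow_neg_one, Real.rpow_neg hs.le]
  rw [e, mul_assoc] at h
  have h3 := mul_left_cancel₀ (inv_ne_zero hs.ne') h
  rw [← h3]
  have : s ^ ν ≠ 0 := (Real.rpow_pos_of_pos hs ν).ne'
  field_simp

lemma integral_one_sub_exp_mul_rpow_pos {ν : ℝ} (hν : 0 < ν) (hν1 : ν < 1) :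
    0 < ∫ u in Ioi (0 : ℝ), (1 - Real.exp (-u)) * u ^ (-1 - ν) := by
  have hi := integrableOn_one_sub_exp_mul_rpow hν hν1 one_pos
  simp only [one_mul] at hi
  have hpos : ∀ u : ℝ, 0 < u → 0 < (1 - Real.exp (-u)) * u ^ (-1 - ν) := fun u hu =>
    mul_pos (sub_pos.2 (Real.exp_lt_one_iff.2 (by linarith))) (Real.rpow_pos_of_pos hu _)
  rw [setIntegral_pos_iff_support_of_nonneg_ae ?_ hi]
  · refine (by simp : (0 : ENNReal) < volume (Ioi (0 : ℝ))).trans_le (measure_mono fun u hu => ?_)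
    exact ⟨(hpos u hu).ne', hu⟩
  · exact (ae_restrict_iff' measurableSet_Ioi).2 (ae_of_all _ fun u hu => (hpos u hu).le)

/-- The values of `s ^ (ν - 1) * exp (-x s ^ ν)` at the positive integers form a positive moment
sequence. -/
lemma momentPos_rpow_mul_exp {ν x : ℝ} (hν : 0 < ν) (hν1 : ν < 1) (hx : 0 ≤ x) :
    MomentPos (fun k => ((k : ℝ) + 1) ^ (ν - 1) * Real.exp (-(x * ((k : ℝ) + 1) ^ ν))) := by
  -- `s ^ (ν - 1)` is the Laplace transform of `t ^ (-ν) / Γ(1 - ν)`.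
  have h1 : MomentPos (fun k => ((k : ℝ) + 1) ^ (ν - 1)) := by
    have hk : ∀ k : ℕ, (0 : ℝ) < k + 1 := fun k => Nat.cast_add_one_pos k
    have e : ∀ (k : ℕ) (t : ℝ), Real.exp (-t) ^ k * (Real.exp (-t) * t ^ (-ν)) =
        t ^ ((1 - ν) - 1) * Real.exp (-(((k : ℝ) + 1) * t)) := fun k t => by
      rw [← mul_assoc, exp_neg_pow_mul, mul_comm]; congr 2; ring
    have h := MomentPos.one.mul_integral (μ := volume.restrict (Ioi (0 : ℝ)))
      (u := fun t => Real.exp (-t)) (w := fun t => Real.exp (-t) * t ^ (-ν)) ?_ ?_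
    · have h2 := h.const_mul (inv_nonneg.2 (Real.Gamma_pos_of_pos (by linarith : 0 < 1 - ν)).le)
      convert h2 using 2 with k
      simp only [e]
      rw [Real.integral_rpow_mul_exp_neg_mul_Ioi (by linarith) (hk k), one_div,
        Real.inv_rpow (hk k).le, ← Real.rpow_neg (hk k).le, neg_sub]
      have := (Real.Gamma_pos_of_pos (by linarith : 0 < 1 - ν)).ne'
      field_simp
    · refine (ae_restrict_iff' measurableSet_Ioi).2 (ae_of_all _ fun t ht => ?_)
      have ht : (0 : ℝ) < t := ht
      exact ⟨⟨(Real.exp_pos _).le, Real.exp_le_one_iff.2 (by linarith)⟩, by positivity⟩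
    · intro k
      simp only [e]
      have := integrableOn_rpow_mul_exp_neg_mul_rpow (p := 1) (s := (1 - ν) - 1) (b := (k : ℝ) + 1)
        (by linarith) one_pos (hk k)
      simpa only [Real.rpow_one, neg_mul, IntegrableOn] using this
  set c := ∫ u in Ioi (0 : ℝ), (1 - Real.exp (-u)) * u ^ (-1 - ν)
  have hc : 0 < c := integral_one_sub_exp_mul_rpow_pos hν hν1
  -- The Lévy measure `t ^ (-1 - ν) dt` has infinite mass near `0`. On `(ε N, ∞)` its mass `C N` is
  -- finite, and `exp (-(x / c) (C N - A N k))` is a positive constant times the exponential of a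
  -- multiple of a moment sequence. Monotone exhaustion restores `x * (k + 1) ^ ν`.
  set ε : ℕ → ℝ := fun N => 1 / ((N : ℝ) + 1)
  have hε : ∀ N, 0 < ε N := fun N => by positivity
  set A : ℕ → ℕ → ℝ := fun N k =>
    ∫ t in Ioi (ε N), Real.exp (-t) ^ k * (Real.exp (-t) * t ^ (-1 - ν))
  set C : ℕ → ℝ := fun N => ∫ t in Ioi (ε N), t ^ (-1 - ν)
  have hCi : ∀ N, IntegrableOn (fun t : ℝ => t ^ (-1 - ν)) (Ioi (ε N)) := fun N =>
    integrableOn_Ioi_rpow_of_lt (by linarith) (hε N)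
  have hAi : ∀ N k, IntegrableOn
      (fun t : ℝ => Real.exp (-t) ^ k * (Real.exp (-t) * t ^ (-1 - ν))) (Ioi (ε N)) := by
    intro N k
    refine (hCi N).mono' (by fun_prop) ?_
    refine (ae_restrict_iff' measurableSet_Ioi).2 (ae_of_all _ fun t ht => ?_)
    have ht : (0 : ℝ) < t := (hε N).trans ht
    rw [← mul_assoc, exp_neg_pow_mul, Real.norm_of_nonneg (by positivity)]
    refine mul_le_of_le_one_left (by positivity) (Real.exp_le_one_iff.2 ?_)
    have : (0 : ℝ) ≤ k := k.cast_nonneg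
    nlinarith
  refine MomentPos.of_tendsto (a := fun N k => Real.exp (-(x / c * C N)) *
    (Real.exp (x / c * A N k) * ((k : ℝ) + 1) ^ (ν - 1))) (fun N => ?_) fun k => ?_
  · refine (h1.mul_exp_integral ?_ (hAi N) (by positivity)).const_mul (Real.exp_pos _).le
    refine (ae_restrict_iff' measurableSet_Ioi).2 (ae_of_all _ fun t ht => ?_)
    have ht : (0 : ℝ) < t := (hε N).trans ht
    exact ⟨⟨(Real.exp_pos _).le, Real.exp_le_one_iff.2 (by linarith)⟩, by positivity⟩
  · have hk : (0 : ℝ) < k + 1 := Nat.cast_add_one_pos k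
    have hU : ⋃ N, Ioi (ε N) = Ioi 0 := by
      refine Subset.antisymm (iUnion_subset fun N => Ioi_subset_Ioi (hε N).le) fun t ht => ?_
      obtain ⟨N, hN⟩ := exists_nat_one_div_lt (show (0 : ℝ) < t from ht)
      exact mem_iUnion.2 ⟨N, hN⟩
    have hlim := tendsto_setIntegral_of_monotone (μ := volume) (s := fun N => Ioi (ε N))
      (f := fun u : ℝ => (1 - Real.exp (-(((k : ℝ) + 1) * u))) * u ^ (-1 - ν))
      (fun N => measurableSet_Ioi)
      (fun M N h => Ioi_subset_Ioi (by simp only [ε]; gcongr))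
      (by rw [hU]; exact integrableOn_one_sub_exp_mul_rpow hν hν1 hk)
    rw [hU, integral_one_sub_exp_mul_rpow hk] at hlim
    have hdiff : ∀ N, ∫ u in Ioi (ε N), (1 - Real.exp (-(((k : ℝ) + 1) * u))) * u ^ (-1 - ν) =
        C N - A N k := fun N => by
      rw [← integral_sub (hCi N) (hAi N k)]
      refine integral_congr_ae (ae_of_all _ fun t => ?_)
      simp only [← exp_neg_pow_mul]
      ring
    simp only [hdiff] at hlim
    have h3 := ((hlim.const_mul (-(x / c))).rexp).const_mul (((k : ℝ) + 1) ^ (ν - 1))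
    convert h3 using 2 with N
    · rw [← mul_assoc, ← Real.exp_add, mul_comm]; congr 2; ring
    · congr 2
      change _ = -(x / c) * (c * _)
      field_simp

/-! ### Powers along rays and Euler's integral -/

lemma ofReal_mul_exp_cpow {r v : ℝ} (hr : 0 < r) (hv : v ∈ Ioc (-Real.pi) Real.pi) (a : ℝ) :
    ((r : ℂ) * Complex.exp (v * Complex.I)) ^ (a : ℂ) =
      ((r ^ a : ℝ) : ℂ) * Complex.exp ((a * v : ℝ) * Complex.I) := by
  rw [Complex.cpow_def_of_ne_zero
    (mul_ne_zero (Complex.ofReal_ne_zero.2 hr.ne') (Complex.exp_ne_zero _)),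
    Complex.log_ofReal_mul hr (Complex.exp_ne_zero _), Complex.log_exp (by simpa using hv.1)
    (by simpa using hv.2), Real.rpow_def_of_pos hr, Complex.ofReal_exp, ← Complex.exp_add]
  congr 1
  push_cast
  ring

lemma ofReal_mul_exp_mem_slitPlane {r v : ℝ} (hr : 0 < r) (hv : v ∈ Ioo (-Real.pi) Real.pi) :
    (r : ℂ) * Complex.exp (v * Complex.I) ∈ Complex.slitPlane := by
  rw [Complex.mem_slitPlane_iff_arg]
  refine ⟨?_, mul_ne_zero (Complex.ofReal_ne_zero.2 hr.ne') (Complex.exp_ne_zero _)⟩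
  rw [Complex.exp_mul_I, Complex.arg_mul_cos_add_sin_mul_I hr ⟨hv.1, hv.2.le⟩]
  exact hv.2.ne

lemma mem_slitPlane_of_re_nonneg {z : ℂ} (hz : 0 ≤ z.re) (hz0 : z ≠ 0) :
    z ∈ Complex.slitPlane := by
  rw [Complex.mem_slitPlane_iff]
  rcases hz.lt_or_eq with h | h
  · exact Or.inl h
  · exact Or.inr fun hi => hz0 (Complex.ext h.symm hi)

lemma tendsto_mul_rpow_mul_exp_atTop {a b k : ℝ} (hb : 0 < b) (hk : 0 < k) :
    Tendsto (fun r : ℝ => r * (r ^ (a - 1) * Real.exp (-k * r ^ b))) atTop (𝓝 0) := by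
  have h := (tendsto_rpow_mul_exp_neg_mul_atTop_nhds_zero (a / b) k hk).comp
    (tendsto_rpow_atTop hb)
  refine h.congr' ?_
  filter_upwards [eventually_gt_atTop 0] with r hr
  simp only [Function.comp_apply]
  rw [← Real.rpow_mul hr.le, mul_div_cancel₀ _ hb.ne', ← mul_assoc, Real.rpow_sub_one hr.ne',
    mul_div_cancel₀ _ hr.ne']

lemma tendsto_mul_rpow_mul_exp_nhdsGT {a b k : ℝ} (ha : 0 < a) (hk : 0 < k) :
    Tendsto (fun r : ℝ => r * (r ^ (a - 1) * Real.exp (-k * r ^ b))) (𝓝[>] 0) (𝓝 0) := by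
  have h0 : Tendsto (fun r : ℝ => r ^ a) (𝓝[>] 0) (𝓝 0) := by
    have := (Real.continuousAt_rpow_const 0 a (Or.inr ha.le)).tendsto
    rw [Real.zero_rpow ha.ne'] at this
    exact this.mono_left nhdsWithin_le_nhds
  refine squeeze_zero' ?_ ?_ h0
  · filter_upwards [self_mem_nhdsWithin] with r hr
    have : (0 : ℝ) < r := hr
    positivity
  · filter_upwards [self_mem_nhdsWithin] with r hr
    have hr : (0 : ℝ) < r := hr
    rw [← mul_assoc, Real.rpow_sub_one hr.ne', mul_div_cancel₀ _ hr.ne']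
    refine mul_le_of_le_one_right (by positivity) (Real.exp_le_one_iff.2 ?_)
    have : 0 ≤ k * r ^ b := by positivity
    linarith

/-- Euler's integral for the Gamma function along a ray. -/
lemma Gamma_eq_integral_ray {a η : ℝ} (ha : 0 < a) (hη : η ∈ Ioc (-(Real.pi / 2)) 0) :
    Complex.exp ((a * η : ℝ) * Complex.I) * ∫ r in Ioi (0 : ℝ),
      ((r ^ (a - 1) : ℝ) : ℂ) * Complex.exp (-(r * Complex.exp (η * Complex.I))) =
      (Real.Gamma a : ℂ) := by
  have hπ := Real.pi_pos
  have hk : 0 < Real.cos η := Real.cos_pos_of_mem_Ioo ⟨hη.1, by linarith [hη.2]⟩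
  have hpol : ∀ r v : ℝ, 0 < r → v ∈ Icc η 0 →
      ((r : ℂ) * Complex.exp (v * Complex.I)) ^ ((a - 1 : ℝ) : ℂ) =
      ((r ^ (a - 1) : ℝ) : ℂ) * Complex.exp (((a - 1) * v : ℝ) * Complex.I) := fun r v hr hv =>
    ofReal_mul_exp_cpow hr ⟨by linarith [hη.1, hv.1], by linarith [hv.2]⟩ _
  have key := integral_ray_eq_of_sector
    (G := fun w => w ^ ((a - 1 : ℝ) : ℂ) * Complex.exp (-w)) (a := η) (b := 0) hη.2
    (B := fun r => r ^ (a - 1) * Real.exp (-Real.cos η * r ^ (1 : ℝ)))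
    (fun r v hr hv => by
      refine DifferentiableAt.mul ?_ (by fun_prop)
      exact differentiableAt_id.cpow_const
        (ofReal_mul_exp_mem_slitPlane hr ⟨by linarith [hη.1, hv.1], by linarith [hv.2]⟩))
    (fun r v hr hv => by
      rw [hpol r v hr hv, norm_mul, norm_mul, Complex.norm_exp_ofReal_mul_I, mul_one,
        Complex.norm_real, Real.norm_of_nonneg (by positivity), Complex.norm_exp, Real.rpow_one,
        Complex.neg_re, Complex.re_ofReal_mul, Complex.exp_ofReal_mul_I_re]
      gcongr
      have : Real.cos η ≤ Real.cos v := by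
        rw [← Real.cos_neg η, ← Real.cos_neg v]
        exact Real.cos_le_cos_of_nonneg_of_le_pi (by linarith [hv.2]) (by linarith [hη.1])
          (by linarith [hv.1])
      nlinarith)
    (integrableOn_rpow_mul_exp_neg_mul_rpow (by linarith) one_pos hk)
    (tendsto_mul_rpow_mul_exp_atTop one_pos hk) (tendsto_mul_rpow_mul_exp_nhdsGT ha hk)
  have e0 : ∫ r in Ioi (0 : ℝ), (((r : ℂ) * Complex.exp ((0 : ℝ) * Complex.I)) ^
      ((a - 1 : ℝ) : ℂ) * Complex.exp (-((r : ℂ) * Complex.exp ((0 : ℝ) * Complex.I)))) =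
      (Real.Gamma a : ℂ) := by
    rw [Real.Gamma_eq_integral ha, ← integral_complex_ofReal]
    refine setIntegral_congr_fun measurableSet_Ioi fun r hr => ?_
    rw [hpol r 0 hr ⟨hη.2, le_rfl⟩]
    simp [mul_comm]
  rw [e0] at key
  simp only [Complex.ofReal_zero, zero_mul, Complex.exp_zero, one_mul] at key
  rw [← key, ← integral_const_mul, ← integral_const_mul]
  refine setIntegral_congr_fun measurableSet_Ioi fun r hr => ?_
  simp only [hpol r η hr ⟨le_rfl, hη.2⟩]
  have : Complex.exp ((a * η : ℝ) * Complex.I) = Complex.exp (η * Complex.I) *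
      Complex.exp (((a - 1) * η : ℝ) * Complex.I) := by
    rw [← Complex.exp_add]; congr 1; push_cast; ring
  rw [this]
  ring

/-! ### The M-Wright function: contour integrals, Laplace transform, positivity -/

/-- `z ^ (ν - 1) * exp (-x z ^ ν)`, the Laplace transform in time of the M-Wright density at `x`. -/
noncomputable def wrightKernel (ν x : ℝ) (z : ℂ) : ℂ :=
  z ^ ((ν - 1 : ℝ) : ℂ) * Complex.exp (-(x * z ^ (ν : ℂ)))

lemma wrightKernel_polar {ν x r v : ℝ} (hr : 0 < r) (hv : v ∈ Ioc (-Real.pi) Real.pi) :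
    wrightKernel ν x (r * Complex.exp (v * Complex.I)) =
      ((r ^ (ν - 1) : ℝ) : ℂ) * Complex.exp (((ν - 1) * v : ℝ) * Complex.I) *
        Complex.exp (-(x * ((r ^ ν : ℝ) * Complex.exp ((ν * v : ℝ) * Complex.I)))) := by
  rw [wrightKernel, ofReal_mul_exp_cpow hr hv, ofReal_mul_exp_cpow hr hv]

lemma norm_wrightKernel_polar {ν x r v : ℝ} (hr : 0 < r) (hv : v ∈ Ioc (-Real.pi) Real.pi) :
    ‖wrightKernel ν x (r * Complex.exp (v * Complex.I))‖ =
      r ^ (ν - 1) * Real.exp (-(x * Real.cos (ν * v)) * r ^ ν) := by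
  rw [wrightKernel_polar hr hv, norm_mul, norm_mul, Complex.norm_exp_ofReal_mul_I, mul_one,
    Complex.norm_real, Real.norm_of_nonneg (by positivity), Complex.norm_exp, Complex.neg_re,
    Complex.re_ofReal_mul, Complex.re_ofReal_mul, Complex.exp_ofReal_mul_I_re]
  congr 2
  ring

lemma wrightKernel_ofReal {ν x s : ℝ} (hs : 0 < s) :
    wrightKernel ν x s = ((s ^ (ν - 1) * Real.exp (-(x * s ^ ν)) : ℝ) : ℂ) := by
  rw [wrightKernel, ← Complex.ofReal_cpow hs.le, ← Complex.ofReal_cpow hs.le]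
  push_cast
  rfl

lemma wrightKernel_conj {ν x : ℝ} {z : ℂ} (hz : z.arg ≠ Real.pi) :
    wrightKernel ν x ((starRingEnd ℂ) z) = (starRingEnd ℂ) (wrightKernel ν x z) := by
  have h : ∀ a : ℝ, ((starRingEnd ℂ) z) ^ (a : ℂ) = (starRingEnd ℂ) (z ^ (a : ℂ)) := fun a => by
    have := Complex.cpow_conj z a hz
    rw [Complex.conj_ofReal] at this
    rw [this, Complex.conj_conj]
  simp only [wrightKernel, h, map_mul, ← Complex.exp_conj, map_neg, Complex.conj_ofReal]

lemma wrightKernel_differentiableAt {ν x : ℝ} {z : ℂ} (hz : z ∈ Complex.slitPlane) :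
    DifferentiableAt ℂ (wrightKernel ν x) z := by
  have h : ∀ a : ℂ, DifferentiableAt ℂ (fun z : ℂ => z ^ a) z := fun a =>
    differentiableAt_id.cpow_const hz
  exact (h _).mul (((h _).const_mul _).neg.cexp)

/-- On the closed right half-plane `|arg (z ^ ν)| ≤ ν π / 2 < π / 2`, so the exponential factor has
modulus at most 1 and only the power remains. -/
lemma wrightKernel_decay {ν x : ℝ} (hν : 0 < ν) (hν1 : ν < 1) (hx : 0 ≤ x) :
    HalfPlaneDecay (wrightKernel ν x) (1 - ν) (1 - ν) := by
  refine ⟨fun z hz hz0 => wrightKernel_differentiableAt (mem_slitPlane_of_re_nonneg hz hz0), 1,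
    zero_le_one, fun z hz hz0 => (and_self_iff.2 ?_)⟩
  rw [wrightKernel, norm_mul, Complex.norm_cpow_real, one_mul, neg_sub, Complex.norm_exp]
  refine mul_le_of_le_one_right (by positivity) (Real.exp_le_one_iff.2 ?_)
  rw [Complex.neg_re, Complex.re_ofReal_mul, Complex.cpow_ofReal_re]
  have harg := abs_le.1 (Complex.abs_arg_le_pi_div_two_iff.2 hz)
  have hcos : 0 ≤ Real.cos (z.arg * ν) := by
    refine Real.cos_nonneg_of_mem_Icc ⟨?_, ?_⟩ <;> nlinarith [Real.pi_pos]
  have : 0 ≤ x * (‖z‖ ^ ν * Real.cos (z.arg * ν)) := by positivity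
  linarith

lemma exp_pi_div_two_ofReal : Complex.exp (((Real.pi / 2 : ℝ) : ℂ) * Complex.I) = Complex.I := by
  push_cast; exact Complex.exp_pi_div_two_mul_I

lemma cos_mul_pi_div_two_pos {ν : ℝ} (hν : 0 < ν) (hν1 : ν < 1) :
    0 < Real.cos (ν * (Real.pi / 2)) :=
  Real.cos_pos_of_mem_Ioo ⟨by nlinarith [Real.pi_pos], by nlinarith [Real.pi_pos]⟩

lemma norm_wrightKernel_vert {ν x r : ℝ} (hr : 0 < r) :
    ‖wrightKernel ν x (r * Complex.I)‖ =
      r ^ (ν - 1) * Real.exp (-(x * Real.cos (ν * (Real.pi / 2))) * r ^ ν) := by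
  have := norm_wrightKernel_polar (ν := ν) (x := x) (v := Real.pi / 2) hr
    ⟨by linarith [Real.pi_pos], by linarith [Real.pi_pos]⟩
  rwa [exp_pi_div_two_ofReal] at this

lemma continuousOn_wrightKernel_vert {ν x : ℝ} (hν : 0 < ν) (hν1 : ν < 1) (hx : 0 ≤ x) :
    ContinuousOn (fun r : ℝ => wrightKernel ν x (r * Complex.I)) (Ioi 0) :=
  (wrightKernel_decay hν hν1 hx).continuousOn_vert (by simp) (by simp)

lemma integrableOn_wrightKernel_vert {ν x : ℝ} (hν : 0 < ν) (hν1 : ν < 1) (hx : 0 < x) :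
    IntegrableOn (fun r : ℝ => wrightKernel ν x (r * Complex.I)) (Ioi 0) := by
  have hi := integrableOn_rpow_mul_exp_neg_mul_rpow (p := ν) (s := ν - 1)
    (b := x * Real.cos (ν * (Real.pi / 2))) (by linarith) hν
    (mul_pos hx (cos_mul_pi_div_two_pos hν hν1))
  refine hi.mono' ((continuousOn_wrightKernel_vert hν hν1 hx.le).aestronglyMeasurable
    measurableSet_Ioi) ?_
  exact (ae_restrict_iff' measurableSet_Ioi).2 (ae_of_all _ fun r hr =>
    (norm_wrightKernel_vert hr).le)

/-- The substitution `r ^ ν` makes the integral elementary. Its dependence on `x` is exactly `1 /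
x`, the source of all later uniform bounds. -/
lemma integral_norm_wrightKernel_vert {ν x : ℝ} (hν : 0 < ν) (hν1 : ν < 1) (hx : 0 < x) :
    ∫ r in Ioi (0 : ℝ), ‖wrightKernel ν x (r * Complex.I)‖ =
      (x * Real.cos (ν * (Real.pi / 2)) * ν)⁻¹ := by
  have hc := cos_mul_pi_div_two_pos hν hν1
  have := integral_rpow_mul_exp_neg_mul_rpow (p := ν) (q := ν - 1)
    (b := x * Real.cos (ν * (Real.pi / 2))) hν (by linarith) (mul_pos hx hc)
  rw [sub_add_cancel, div_self hν.ne', Real.Gamma_one, mul_one, neg_div, div_self hν.ne',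
    Real.rpow_neg_one] at this
  rw [mul_inv _ ν, ← one_div ν, ← this]
  exact setIntegral_congr_fun measurableSet_Ioi fun r hr => norm_wrightKernel_vert hr

/-- Dominates the termwise integration of the M-Wright series: since `ν < 1`, the linear exponent
wins. -/
lemma integrableOn_rpow_mul_exp_rpow {ν k Z : ℝ} (hν : 0 < ν) (hν1 : ν < 1) (hk : 0 < k)
    (hZ : 0 ≤ Z) :
    IntegrableOn (fun r : ℝ => r ^ (ν - 1) * Real.exp (-k * r) * Real.exp (Z * r ^ ν)) (Ioi 0) := by
  -- Beyond `T`, `Z * r ^ ν ≤ k / 2 * r`; below it `Z * r ^ ν` is bounded by its value at `T`. Half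
  -- of the decay rate survives in both cases.
  set T := (2 * Z / k) ^ (1 / (1 - ν))
  have hT : 0 ≤ T := by positivity
  have hi := (integrableOn_rpow_mul_exp_neg_mul_rpow (p := 1) (s := ν - 1) (b := k / 2)
    (by linarith) one_pos (by positivity)).mul_const (Real.exp (Z * T ^ ν))
  refine hi.mono' (by fun_prop) ?_
  refine (ae_restrict_iff' measurableSet_Ioi).2 (ae_of_all _ fun r hr => ?_)
  have hr : (0 : ℝ) < r := hr
  rw [Real.norm_of_nonneg (by positivity), mul_assoc, mul_assoc, ← Real.exp_add, ← Real.exp_add,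
    Real.rpow_one]
  refine mul_le_mul_of_nonneg_left (Real.exp_le_exp.2 ?_) (by positivity)
  rcases le_total r T with h | h
  · have : Z * r ^ ν ≤ Z * T ^ ν := by gcongr
    nlinarith
  · have h1 : 2 * Z / k ≤ r ^ (1 - ν) := by
      calc 2 * Z / k = T ^ (1 - ν) := by
            rw [← Real.rpow_mul (by positivity), one_div_mul_cancel (by linarith), Real.rpow_one]
        _ ≤ r ^ (1 - ν) := Real.rpow_le_rpow hT h (by linarith)
    have h2 : Z ≤ k / 2 * r ^ (1 - ν) := by
      rw [div_le_iff₀ hk] at h1; linarith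
    have h3 : Z * r ^ ν ≤ k / 2 * r := by
      calc Z * r ^ ν ≤ k / 2 * r ^ (1 - ν) * r ^ ν := by gcongr
        _ = k / 2 * r := by rw [mul_assoc, ← Real.rpow_add hr, sub_add_cancel, Real.rpow_one]
    have h4 : 0 ≤ Z * T ^ ν := by positivity
    linarith

/-- The reflection formula. It remains true at positive integers `a`: there `Real.Gamma (1 - a)` and
its inverse are `0` by convention, and the sine vanishes. -/
lemma inv_Gamma_one_sub {a : ℝ} (ha : 0 < a) :
    (Real.Gamma (1 - a))⁻¹ = Real.Gamma a * Real.sin (Real.pi * a) / Real.pi := by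
  have h := Real.Gamma_mul_Gamma_one_sub a
  have h1 := (Real.Gamma_pos_of_pos ha).ne'
  have h2 : Real.Gamma (1 - a) = Real.pi / Real.sin (Real.pi * a) / Real.Gamma a := by
    rw [← h]; field_simp
  rw [h2, inv_div, div_div_eq_mul_div]

/-- The M-Wright series as an integral along a ray in the left half-plane. -/
lemma mWright_eq_integral_ray {ν z γ : ℝ} (hν : 0 < ν) (hν1 : ν < 1)
    (hγ : γ ∈ Ioo (Real.pi / 2) Real.pi) :
    mWright ν z = 1 / Real.pi * (Complex.exp (γ * Complex.I) * ∫ r in Ioi (0 : ℝ),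
      wrightKernel ν z (r * Complex.exp (γ * Complex.I)) *
        Complex.exp (r * Complex.exp (γ * Complex.I))).im := by
  have hπ := Real.pi_pos
  set e : ℂ := Complex.exp (γ * Complex.I)
  have hk : 0 < -Real.cos γ := neg_pos.2 (Real.cos_neg_of_pi_div_two_lt_of_lt hγ.1 (by linarith [hγ.2]))
  have hγ' : γ ∈ Ioc (-Real.pi) Real.pi := ⟨by linarith [hγ.1], hγ.2.le⟩
  set E : ℂ := Complex.exp ((ν * γ : ℝ) * Complex.I)
  have hnexp : ∀ r : ℝ, ‖Complex.exp (r * e)‖ = Real.exp (-(-Real.cos γ) * r) := fun r => by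
    rw [Complex.norm_exp, Complex.re_ofReal_mul, Complex.exp_ofReal_mul_I_re, neg_neg, mul_comm]
  set f : ℕ → ℝ → ℂ := fun n r =>
    ((r ^ (ν - 1) : ℝ) : ℂ) * E * Complex.exp (r * e) * ((-(z * ((r ^ ν : ℝ) * E))) ^ n / n.factorial)
  have hterm : ∀ n : ℕ, ∫ r in Ioi (0 : ℝ), f n r =
      ((-z) ^ n / n.factorial : ℝ) * (Real.Gamma (ν * (n + 1)) : ℂ) *
        Complex.exp ((ν * (n + 1) * Real.pi : ℝ) * Complex.I) := by
    intro n
    have ha : 0 < ν * (n + 1) := by positivity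
    -- The ray at angle `γ` is the negative of the ray at angle `γ - π`, which lies in the right
    -- half-plane, where Euler's integral is available; the rotation by `π` produces the phase `exp
    -- (i π ν (n + 1))`.
    rw [← Gamma_eq_integral_ray ha (η := γ - Real.pi) ⟨by linarith [hγ.1], by linarith [hγ.2]⟩]
    rw [← integral_const_mul, ← integral_const_mul, ← integral_mul_const]
    refine setIntegral_congr_fun measurableSet_Ioi fun r hr => ?_
    have hr : (0 : ℝ) < r := hr
    have e1 : Complex.exp (((γ - Real.pi : ℝ) : ℂ) * Complex.I) = -e := by
      push_cast
      rw [sub_mul, Complex.exp_sub, Complex.exp_pi_mul_I, div_neg, div_one]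
    have e2 : Complex.exp ((ν * (n + 1) * (γ - Real.pi) : ℝ) * Complex.I) *
        Complex.exp ((ν * (n + 1) * Real.pi : ℝ) * Complex.I) = E * E ^ n := by
      rw [← pow_succ', ← Complex.exp_nat_mul, ← Complex.exp_add]
      congr 1
      push_cast
      ring
    have e3 : ((r ^ (ν * (n + 1) - 1) : ℝ) : ℂ) = ((r ^ (ν - 1) : ℝ) : ℂ) * ((r ^ ν : ℝ) : ℂ) ^ n := by
      rw [← Complex.ofReal_pow, ← Complex.ofReal_mul, ← Real.rpow_natCast, ← Real.rpow_mul hr.le,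
        ← Real.rpow_add hr]
      congr 2
      ring
    simp only [f, e1, e3]
    rw [show -((r : ℂ) * -e) = r * e by ring]
    push_cast at e2 ⊢
    linear_combination (-((-(z : ℂ)) ^ n / n.factorial * (((r ^ (ν - 1) : ℝ) : ℂ) *
      ((r ^ ν : ℝ) : ℂ) ^ n) * Complex.exp (r * e))) * e2
  have hsum : HasSum (fun n => ∫ r in Ioi (0 : ℝ), f n r) (∫ r in Ioi (0 : ℝ),
      e * (wrightKernel ν z (r * e) * Complex.exp (r * e))) := by
    have hexps : ∀ x : ℝ, HasSum (fun n : ℕ => x ^ n / n.factorial) (Real.exp x) := fun x => by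
      rw [Real.exp_eq_exp_ℝ]; exact NormedSpace.expSeries_div_hasSum_exp x
    have hbs : ∀ r : ℝ, HasSum (fun n : ℕ => r ^ (ν - 1) * Real.exp (-(-Real.cos γ) * r) *
        ((|z| * r ^ ν) ^ n / n.factorial))
        (r ^ (ν - 1) * Real.exp (-(-Real.cos γ) * r) * Real.exp (|z| * r ^ ν)) := fun r =>
      (hexps _).mul_left _
    refine hasSum_integral_of_dominated_convergence
      (fun n r => r ^ (ν - 1) * Real.exp (-(-Real.cos γ) * r) * ((|z| * r ^ ν) ^ n / n.factorial))
      (fun n => ?_) (fun n => ?_) ?_ ?_ ?_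
    · exact Measurable.aestronglyMeasurable (by fun_prop)
    · refine (ae_restrict_iff' measurableSet_Ioi).2 (ae_of_all _ fun r hr => ?_)
      have hr : (0 : ℝ) < r := hr
      simp only [f, norm_mul, norm_div, norm_pow, norm_neg, hnexp, E, Complex.norm_exp_ofReal_mul_I,
        Complex.norm_real, mul_one, Complex.norm_natCast, Real.norm_eq_abs,
        abs_of_nonneg (Real.rpow_nonneg hr.le _)]
      exact le_rfl
    · exact ae_of_all _ fun r => (hbs r).summable
    · simp only [(hbs _).tsum_eq]
      exact integrableOn_rpow_mul_exp_rpow hν hν1 hk (abs_nonneg z)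
    · refine (ae_restrict_iff' measurableSet_Ioi).2 (ae_of_all _ fun r hr => ?_)
      have h := (NormedSpace.expSeries_div_hasSum_exp (-((z : ℂ) * ((r ^ ν : ℝ) * E)))).mul_left
        (((r ^ (ν - 1) : ℝ) : ℂ) * E * Complex.exp (r * e))
      rw [← Complex.exp_eq_exp_ℂ] at h
      have : E = e * Complex.exp (((ν - 1) * γ : ℝ) * Complex.I) := by
        simp only [E, e]
        rw [← Complex.exp_add]
        congr 1
        push_cast
        ring
      refine (congrArg (HasSum fun n => f n r) ?_).mpr h
      rw [wrightKernel_polar hr hγ', show Complex.exp ((ν * γ : ℝ) * Complex.I) = E from rfl]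
      linear_combination (-((r ^ (ν - 1) : ℝ) : ℂ) * Complex.exp (r * e) *
        Complex.exp (-((z : ℂ) * ((r ^ ν : ℝ) * E)))) * this
  rw [integral_const_mul] at hsum
  have him := (Complex.hasSum_im hsum).mul_left (1 / Real.pi)
  rw [← him.tsum_eq, mWright]
  refine tsum_congr fun n => ?_
  -- The imaginary part of the phase is `sin (π ν (n + 1))`, and the reflection formula turns it
  -- with `Γ(ν (n + 1))` into `π / Γ(1 - ν (n + 1))`.
  rw [hterm, show -ν * (n : ℝ) + (1 - ν) = 1 - ν * (n + 1) by ring, div_mul_eq_div_div,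
    div_eq_mul_inv _ (Real.Gamma _), inv_Gamma_one_sub (by positivity), ← Complex.ofReal_mul,
    Complex.im_ofReal_mul, Complex.exp_ofReal_mul_I_im, mul_comm Real.pi (ν * _)]
  ring

/-- The M-Wright function as a Fourier integral. -/
lemma mWright_eq_integral_vert {ν z : ℝ} (hν : 0 < ν) (hν1 : ν < 1) (hz : 0 < z) :
    mWright ν z = 1 / Real.pi * (∫ r in Ioi (0 : ℝ),
      wrightKernel ν z (r * Complex.I) * Complex.exp (r * Complex.I)).re := by
  have hπ := Real.pi_pos
  -- The angle must exceed `π / 2` for the series to be integrated term by term, yet keep `ν γ < π /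
  -- 2` so that `exp (-z w ^ ν)` still decays throughout the sector swept back to the imaginary
  -- axis.
  obtain ⟨γ, hγ1, hγ2⟩ := exists_between (show Real.pi / 2 < min Real.pi (Real.pi / 2 / ν) by
    refine lt_min (by linarith) ?_
    rw [lt_div_iff₀ hν]
    nlinarith)
  have hγπ : γ < Real.pi := hγ2.trans_le (min_le_left _ _)
  have hγν : ν * γ < Real.pi / 2 := by
    have := hγ2.trans_le (min_le_right _ _)
    rw [lt_div_iff₀ hν] at this
    linarith
  have hk : 0 < z * Real.cos (ν * γ) :=
    mul_pos hz (Real.cos_pos_of_mem_Ioo ⟨by nlinarith, hγν⟩)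
  have key := integral_ray_eq_of_sector (G := fun w => wrightKernel ν z w * Complex.exp w)
    (a := Real.pi / 2) (b := γ) hγ1.le
    (B := fun r => r ^ (ν - 1) * Real.exp (-(z * Real.cos (ν * γ)) * r ^ ν))
    (fun r v hr hv => (wrightKernel_differentiableAt (ofReal_mul_exp_mem_slitPlane hr
      ⟨by linarith [hv.1], by linarith [hv.2]⟩)).mul (by fun_prop))
    (fun r v hr hv => by
      rw [norm_mul, norm_wrightKernel_polar hr ⟨by linarith [hv.1], by linarith [hv.2]⟩,
        Complex.norm_exp, Complex.re_ofReal_mul, Complex.exp_ofReal_mul_I_re]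
      have h1 : Real.exp (r * Real.cos v) ≤ 1 := Real.exp_le_one_iff.2
        (mul_nonpos_of_nonneg_of_nonpos hr.le
          (Real.cos_nonpos_of_pi_div_two_le_of_le hv.1 (by linarith [hv.2])))
      refine (mul_le_of_le_one_right (by positivity) h1).trans ?_
      have h2 : Real.cos (ν * γ) ≤ Real.cos (ν * v) := by
        refine Real.cos_le_cos_of_nonneg_of_le_pi (by nlinarith [hv.1]) (by linarith) ?_
        exact mul_le_mul_of_nonneg_left hv.2 hν.le
      have h3 : 0 ≤ r ^ ν := by positivity
      gcongr)
    (integrableOn_rpow_mul_exp_neg_mul_rpow (by linarith) hν hk)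
    (tendsto_mul_rpow_mul_exp_atTop hν hk) (tendsto_mul_rpow_mul_exp_nhdsGT hν hk)
  rw [mWright_eq_integral_ray hν hν1 ⟨hγ1, hγπ⟩, ← key, exp_pi_div_two_ofReal, Complex.I_mul_im]

lemma abs_mWright_le {ν z : ℝ} (hν : 0 < ν) (hν1 : ν < 1) (hz : 0 < z) :
    |mWright ν z| ≤ 1 / Real.pi * (z * Real.cos (ν * (Real.pi / 2)) * ν)⁻¹ := by
  have hπ := Real.pi_pos
  rw [mWright_eq_integral_vert hν hν1 hz, abs_mul, abs_of_pos (by positivity : 0 < 1 / Real.pi),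
    ← integral_norm_wrightKernel_vert hν hν1 hz]
  gcongr
  refine (Complex.abs_re_le_norm _).trans ((norm_integral_le_integral_norm _).trans_eq ?_)
  refine integral_congr_ae (ae_of_all _ fun r => ?_)
  simp only [norm_mul, Complex.norm_exp_ofReal_mul_I, mul_one]

lemma continuousOn_mWright {ν : ℝ} (hν : 0 < ν) (hν1 : ν < 1) :
    ContinuousOn (mWright ν) (Ioi 0) := by
  have h : ContinuousOn (fun z : ℝ => ∫ r in Ioi (0 : ℝ),
      wrightKernel ν z (r * Complex.I) * Complex.exp (r * Complex.I)) (Ioi 0) := by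
    intro z₀ hz₀
    have hz₀ : (0 : ℝ) < z₀ := hz₀
    refine ContinuousAt.continuousWithinAt ?_
    have hnear : ∀ᶠ z in 𝓝 z₀, z₀ / 2 < z := lt_mem_nhds (by linarith)
    refine continuousAt_of_dominated
      (bound := fun r => ‖wrightKernel ν (z₀ / 2) (r * Complex.I)‖) ?_ ?_ ?_ ?_
    · filter_upwards [hnear] with z hz
      refine ContinuousOn.aestronglyMeasurable ?_ measurableSet_Ioi
      exact (continuousOn_wrightKernel_vert hν hν1 (by linarith)).mul (by fun_prop)
    · filter_upwards [hnear] with z hz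
      refine (ae_restrict_iff' measurableSet_Ioi).2 (ae_of_all _ fun r hr => ?_)
      have hr : (0 : ℝ) < r := hr
      have hc := cos_mul_pi_div_two_pos hν hν1
      rw [norm_mul, Complex.norm_exp_ofReal_mul_I, mul_one, norm_wrightKernel_vert hr,
        norm_wrightKernel_vert hr]
      gcongr
    · exact (integrableOn_wrightKernel_vert hν hν1 (by linarith)).norm
    · refine ae_of_all _ fun r => ?_
      simp only [wrightKernel]
      fun_prop
  refine ((Complex.continuous_re.comp_continuousOn h).const_mul (1 / Real.pi)).congr fun z hz => ?_
  exact mWright_eq_integral_vert hν hν1 hz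

/-- Rescaling `r` by `t` moves the time dependence into the phase: as a function of `t` the density
is the inverse Laplace transform of `wrightKernel`, taken on the imaginary axis. -/
lemma mWrightAt_eq_integral_vert {ν x t : ℝ} (hν : 0 < ν) (hν1 : ν < 1) (hx : 0 < x) (ht : 0 < t) :
    mWrightAt ν x t = 1 / Real.pi * (∫ r in Ioi (0 : ℝ),
      wrightKernel ν x (r * Complex.I) * Complex.exp (t * r * Complex.I)).re := by
  have hπ := Real.pi_pos
  have h := integral_comp_mul_left_Ioi (fun r : ℝ => wrightKernel ν (x / t ^ ν) (r * Complex.I) *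
    Complex.exp (r * Complex.I)) 0 ht
  rw [mul_zero] at h
  have h2 : ∫ r in Ioi (0 : ℝ), wrightKernel ν (x / t ^ ν) ((t * r : ℝ) * Complex.I) *
      Complex.exp ((t * r : ℝ) * Complex.I) = ((t ^ (ν - 1) : ℝ) : ℂ) * ∫ r in Ioi (0 : ℝ),
        wrightKernel ν x (r * Complex.I) * Complex.exp (t * r * Complex.I) := by
    rw [← integral_const_mul]
    refine setIntegral_congr_fun measurableSet_Ioi fun r hr => ?_
    have hr : (0 : ℝ) < r := hr
    have hmem : Real.pi / 2 ∈ Ioc (-Real.pi) Real.pi := ⟨by linarith, by linarith⟩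
    rw [← exp_pi_div_two_ofReal, wrightKernel_polar (mul_pos ht hr) hmem,
      wrightKernel_polar hr hmem, Real.mul_rpow ht.le hr.le, Real.mul_rpow ht.le hr.le]
    have : (t : ℂ) ^ (ν : ℂ) ≠ 0 := by
      rw [← Complex.ofReal_cpow ht.le]
      exact Complex.ofReal_ne_zero.2 (Real.rpow_pos_of_pos ht _).ne'
    have e : ((x / t ^ ν : ℝ) : ℂ) * (((t ^ ν * r ^ ν : ℝ) : ℂ) *
        Complex.exp ((ν * (Real.pi / 2) : ℝ) * Complex.I)) =
        x * ((r ^ ν : ℝ) * Complex.exp ((ν * (Real.pi / 2) : ℝ) * Complex.I)) := by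
      have h3 : x / t ^ ν * (t ^ ν * r ^ ν) = x * r ^ ν := by
        have := (Real.rpow_pos_of_pos ht ν).ne'
        field_simp
      rw [← mul_assoc, ← Complex.ofReal_mul, h3]
      push_cast
      ring
    rw [e, Complex.ofReal_mul (t ^ (ν - 1)), Complex.ofReal_mul t r]
    ring
  rw [h2, Complex.real_smul] at h
  have e3 : ∀ w v : ℂ, ((t ^ (ν - 1) : ℝ) : ℂ) * w = ((t⁻¹ : ℝ) : ℂ) * v → v.re = t ^ ν * w.re := by
    intro w v hwv
    have h4 := congrArg Complex.re hwv
    rw [Complex.re_ofReal_mul, Complex.re_ofReal_mul, Real.rpow_sub_one ht.ne'] at h4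
    field_simp at h4
    exact h4.symm
  rw [mWrightAt, mWright_eq_integral_vert hν hν1 (by positivity), e3 _ _ h, Real.rpow_neg ht.le]
  rw [mul_left_comm, inv_mul_cancel_left₀ (Real.rpow_pos_of_pos ht ν).ne']

lemma continuousOn_mWrightAt_prod {ν : ℝ} (hν : 0 < ν) (hν1 : ν < 1) :
    ContinuousOn (fun p : ℝ × ℝ => mWrightAt ν p.1 p.2) (Ioi 0 ×ˢ Ioi 0) := by
  have hr : ∀ a : ℝ, ContinuousOn (fun p : ℝ × ℝ => p.2 ^ a) (Ioi 0 ×ˢ Ioi 0) := fun a =>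
    continuous_snd.continuousOn.rpow_const fun p hp => Or.inl (ne_of_gt hp.2)
  refine (hr _).mul ((continuousOn_mWright hν hν1).comp
    (continuous_fst.continuousOn.div (hr ν) fun p hp => (Real.rpow_pos_of_pos hp.2 ν).ne')
    fun p hp => ?_)
  exact div_pos hp.1 (Real.rpow_pos_of_pos hp.2 ν)

lemma continuousOn_mWrightAt_time {ν x : ℝ} (hν : 0 < ν) (hν1 : ν < 1) (hx : 0 < x) :
    ContinuousOn (fun t => mWrightAt ν x t) (Ioi 0) :=
  (continuousOn_mWrightAt_prod hν hν1).comp (by fun_prop : ContinuousOn (fun t : ℝ => (x, t)) (Ioi 0))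
    fun _ ht => ⟨hx, ht⟩

lemma continuousOn_mWrightAt_space {ν t : ℝ} (hν : 0 < ν) (hν1 : ν < 1) (ht : 0 < t) :
    ContinuousOn (fun x => mWrightAt ν x t) (Ioi 0) :=
  (continuousOn_mWrightAt_prod hν hν1).comp (by fun_prop : ContinuousOn (fun x : ℝ => (x, t)) (Ioi 0))
    fun _ hx => ⟨hx, ht⟩

/-- The prefactor `t ^ (-ν)` cancels against the `1 / z` bound, leaving an estimate uniform in time.
-/
lemma abs_mWrightAt_le {ν x t : ℝ} (hν : 0 < ν) (hν1 : ν < 1) (hx : 0 < x) (ht : 0 < t) :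
    |mWrightAt ν x t| ≤ 1 / Real.pi * (x * Real.cos (ν * (Real.pi / 2)) * ν)⁻¹ := by
  have h := abs_mWright_le hν hν1 (z := x / t ^ ν) (by positivity)
  have hp := Real.rpow_pos_of_pos ht ν
  rw [mWrightAt, abs_mul, abs_of_pos (Real.rpow_pos_of_pos ht _), Real.rpow_neg ht.le]
  calc (t ^ ν)⁻¹ * |mWright ν (x / t ^ ν)|
      ≤ (t ^ ν)⁻¹ * (1 / Real.pi * (x / t ^ ν * Real.cos (ν * (Real.pi / 2)) * ν)⁻¹) := by gcongr
    _ = _ := by field_simp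

lemma integrableOn_exp_mul_mWrightAt {ν x s : ℝ} (hν : 0 < ν) (hν1 : ν < 1) (hx : 0 < x)
    (hs : 0 < s) : IntegrableOn (fun t => Real.exp (-(s * t)) * mWrightAt ν x t) (Ioi 0) := by
  have he : IntegrableOn (fun t => Real.exp (-(s * t))) (Ioi 0) := by
    simpa only [neg_mul] using integrableOn_exp_mul_Ioi (neg_lt_zero.2 hs) 0
  refine (he.mul_const (1 / Real.pi * (x * Real.cos (ν * (Real.pi / 2)) * ν)⁻¹)).mono' ?_ ?_
  · refine ContinuousOn.aestronglyMeasurable ?_ measurableSet_Ioi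
    exact (by fun_prop : ContinuousOn (fun t => Real.exp (-(s * t))) (Ioi 0)).mul
      (continuousOn_mWrightAt_time hν hν1 hx)
  · refine (ae_restrict_iff' measurableSet_Ioi).2 (ae_of_all _ fun t ht => ?_)
    rw [norm_mul, Real.norm_of_nonneg (Real.exp_pos _).le]
    exact mul_le_mul_of_nonneg_left (abs_mWrightAt_le hν hν1 hx ht) (Real.exp_pos _).le

lemma integral_exp_neg_mul_exp_I {s y : ℝ} (hs : 0 < s) :
    ∫ t in Ioi (0 : ℝ), (Real.exp (-(s * t)) : ℂ) * Complex.exp (t * y * Complex.I) =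
      1 / (s - y * Complex.I) := by
  have h := integral_exp_mul_complex_Ioi (a := -(s : ℂ) + y * Complex.I) (by simpa using hs) 0
  have e : ∀ t : ℝ, (Real.exp (-(s * t)) : ℂ) * Complex.exp (t * y * Complex.I) =
      Complex.exp ((-(s : ℂ) + y * Complex.I) * t) := fun t => by
    rw [Complex.ofReal_exp, ← Complex.exp_add]; congr 1; push_cast; ring
  simp only [e, h, Complex.ofReal_zero, mul_zero, Complex.exp_zero]
  rw [neg_div, ← div_neg]
  congr 1
  ring

/-- The Laplace transform in time of the M-Wright density. -/
lemma laplace_mWrightAt {ν x s : ℝ} (hν : 0 < ν) (hν1 : ν < 1) (hx : 0 < x) (hs : 0 < s) :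
    ∫ t in Ioi (0 : ℝ), Real.exp (-(s * t)) * mWrightAt ν x t =
      s ^ (ν - 1) * Real.exp (-(x * s ^ ν)) := by
  have hπ := Real.pi_pos
  set F := wrightKernel ν x
  have hF := integrableOn_wrightKernel_vert hν hν1 hx
  have he : IntegrableOn (fun t : ℝ => (Real.exp (-(s * t)) : ℂ)) (Ioi 0) := by
    have : IntegrableOn (fun t => Real.exp (-(s * t))) (Ioi 0) := by
      simpa only [neg_mul] using integrableOn_exp_mul_Ioi (neg_lt_zero.2 hs) 0
    exact this.ofReal
  have hprod : Integrable (fun p : ℝ × ℝ => (Real.exp (-(s * p.1)) : ℂ) *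
      (F (p.2 * Complex.I) * Complex.exp (p.1 * p.2 * Complex.I)))
      ((volume.restrict (Ioi 0)).prod (volume.restrict (Ioi 0))) := by
    have h1 := he.mul_prod hF
    have h2 := h1.bdd_mul (c := 1) (f := fun p : ℝ × ℝ => Complex.exp (p.1 * p.2 * Complex.I))
      (by fun_prop) (ae_of_all _ fun p => by
        rw [← Complex.ofReal_mul, Complex.norm_exp_ofReal_mul_I])
    refine h2.congr (ae_of_all _ fun p => ?_)
    simp only [F]
    ring
  have e1 : ∀ t ∈ Ioi (0 : ℝ), Real.exp (-(s * t)) * mWrightAt ν x t = 1 / Real.pi *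
      (∫ r in Ioi (0 : ℝ), (Real.exp (-(s * t)) : ℂ) *
        (F (r * Complex.I) * Complex.exp (t * r * Complex.I))).re := fun t ht => by
    rw [mWrightAt_eq_integral_vert hν hν1 hx ht, integral_const_mul, Complex.re_ofReal_mul]
    ring
  rw [setIntegral_congr_fun measurableSet_Ioi e1, integral_const_mul]
  have e2 : ∫ t in Ioi (0 : ℝ), (∫ r in Ioi (0 : ℝ), (Real.exp (-(s * t)) : ℂ) *
        (F (r * Complex.I) * Complex.exp (t * r * Complex.I))).re =
      (∫ t in Ioi (0 : ℝ), ∫ r in Ioi (0 : ℝ), (Real.exp (-(s * t)) : ℂ) *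
        (F (r * Complex.I) * Complex.exp (t * r * Complex.I))).re :=
    Complex.reCLM.integral_comp_comm hprod.integral_prod_left
  rw [e2, integral_integral_swap hprod]
  have e3 : ∀ r : ℝ, ∫ t in Ioi (0 : ℝ), (Real.exp (-(s * t)) : ℂ) *
        (F (r * Complex.I) * Complex.exp (t * r * Complex.I)) =
      F (r * Complex.I) / (s - r * Complex.I) := fun r => by
    rw [div_eq_mul_one_div, ← integral_exp_neg_mul_exp_I hs, ← integral_const_mul]
    refine integral_congr_ae (ae_of_all _ fun t => ?_)
    ring
  simp only [e3]
  obtain ⟨i1, i2, -, -, h1, -⟩ := (wrightKernel_decay hν hν1 hx.le).cauchy_formula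
    (by linarith) (by linarith) (by linarith) le_rfl (by linarith) hs
  -- The kernel commutes with conjugation off the cut, so the two halves of Cauchy's formula are
  -- conjugate and their sum is twice the real part that occurs here.
  have hconj : ∫ r in Ioi (0 : ℝ), F (r * -Complex.I) / (s + r * Complex.I) =
      (starRingEnd ℂ) (∫ r in Ioi (0 : ℝ), F (r * Complex.I) / (s - r * Complex.I)) := by
    rw [← integral_conj]
    refine setIntegral_congr_fun measurableSet_Ioi fun r hr => ?_
    have hr : (0 : ℝ) < r := hr
    have harg : ((r : ℂ) * Complex.I).arg ≠ Real.pi := by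
      rw [Complex.arg_real_mul _ hr, Complex.arg_I]; linarith
    have h3 := wrightKernel_conj (ν := ν) (x := x) harg
    simp only [map_mul, Complex.conj_ofReal, Complex.conj_I] at h3
    simp only [map_div₀, map_sub, map_mul, Complex.conj_ofReal, Complex.conj_I, F, h3]
    congr 1
    ring
  rw [integral_add i1 i2, hconj, Complex.add_conj, wrightKernel_ofReal hs] at h1
  have h4 : 2 * (∫ r in Ioi (0 : ℝ), F (r * Complex.I) / (s - r * Complex.I)).re =
      2 * Real.pi * (s ^ (ν - 1) * Real.exp (-(x * s ^ ν))) := by exact_mod_cast h1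
  have h5 : (∫ r in Ioi (0 : ℝ), F (r * Complex.I) / (s - r * Complex.I)).re =
      Real.pi * (s ^ (ν - 1) * Real.exp (-(x * s ^ ν))) := by linarith
  rw [h5]
  field_simp

/-- Applied in the time variable for fixed `x`: the Laplace transform at the integers is the moment
sequence of `momentPos_rpow_mul_exp`. -/
lemma mWrightAt_nonneg {ν x t : ℝ} (hν : 0 < ν) (hν1 : ν < 1) (hx : 0 < x) (ht : 0 < t) :
    0 ≤ mWrightAt ν x t := by
  refine nonneg_of_momentPos_laplace (continuousOn_mWrightAt_time hν hν1 hx) ?_ ?_ ht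
  · simpa using integrableOn_exp_mul_mWrightAt hν hν1 hx one_pos
  · simp only [laplace_mWrightAt hν hν1 hx (Nat.cast_add_one_pos _)]
    exact momentPos_rpow_mul_exp hν hν1 hx.le

lemma mWrightAt_one (ν x : ℝ) : mWrightAt ν x 1 = mWright ν x := by
  simp [mWrightAt]

lemma mWright_nonneg {ν z : ℝ} (hν : 0 < ν) (hν1 : ν < 1) (hz : 0 < z) : 0 ≤ mWright ν z := by
  rw [← mWrightAt_one]; exact mWrightAt_nonneg hν hν1 hz one_pos

lemma aestronglyMeasurable_mWrightAt_prod {ν : ℝ} (hν : 0 < ν) (hν1 : ν < 1) :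
    AEStronglyMeasurable (fun p : ℝ × ℝ => mWrightAt ν p.1 p.2)
      ((volume.restrict (Ioi 0)).prod (volume.restrict (Ioi 0))) := by
  rw [Measure.prod_restrict]
  exact (continuousOn_mWrightAt_prod hν hν1).aestronglyMeasurable
    (measurableSet_Ioi.prod measurableSet_Ioi)

/-- The M-Wright density is jointly integrable in space and time against a Laplace weight. -/
lemma integrable_exp_mul_mWrightAt_prod {ν s : ℝ} (hν : 0 < ν) (hν1 : ν < 1) (hs : 0 < s) :
    Integrable (fun p : ℝ × ℝ => Real.exp (-(s * p.2)) * mWrightAt ν p.1 p.2)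
      ((volume.restrict (Ioi 0)).prod (volume.restrict (Ioi 0))) := by
  have hm : AEStronglyMeasurable (fun p : ℝ × ℝ => Real.exp (-(s * p.2)) * mWrightAt ν p.1 p.2)
      ((volume.restrict (Ioi 0)).prod (volume.restrict (Ioi 0))) :=
    (by fun_prop : AEStronglyMeasurable (fun p : ℝ × ℝ => Real.exp (-(s * p.2))) _).mul
      (aestronglyMeasurable_mWrightAt_prod hν hν1)
  rw [integrable_prod_iff hm]
  constructor
  · exact (ae_restrict_iff' measurableSet_Ioi).2 (ae_of_all _ fun x hx =>
      integrableOn_exp_mul_mWrightAt hν hν1 hx hs)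
  · have hi : IntegrableOn (fun x => s ^ (ν - 1) * Real.exp (-(x * s ^ ν))) (Ioi 0) := by
      have := (integrableOn_exp_mul_Ioi (neg_lt_zero.2 (Real.rpow_pos_of_pos hs ν)) 0).const_mul
        (s ^ (ν - 1))
      simpa only [neg_mul, mul_comm _ (s ^ ν), IntegrableOn] using this
    refine hi.congr ((ae_restrict_iff' measurableSet_Ioi).2 (ae_of_all _ fun x hx => ?_))
    refine (laplace_mWrightAt hν hν1 hx hs).symm.trans ?_
    refine setIntegral_congr_fun measurableSet_Ioi fun t ht => ?_
    exact (Real.norm_of_nonneg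
      (mul_nonneg (Real.exp_pos _).le (mWrightAt_nonneg hν hν1 hx ht))).symm

lemma setIntegral_comp_mWrightAt {E : Type*} [NormedAddCommGroup E] [NormedSpace ℝ E]
    (φ : ℝ → E) {ν t : ℝ} (ht : 0 < t) :
    ∫ x in Ioi (0 : ℝ), mWrightAt ν x t • φ x =
      ∫ z in Ioi (0 : ℝ), mWright ν z • φ (t ^ ν * z) := by
  have hp := Real.rpow_pos_of_pos ht ν
  have h := integral_comp_mul_left_Ioi (fun x => mWrightAt ν x t • φ x) 0 hp
  rw [mul_zero] at h
  have e : ∀ z : ℝ, mWrightAt ν (t ^ ν * z) t • φ (t ^ ν * z) =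
      (t ^ ν)⁻¹ • (mWright ν z • φ (t ^ ν * z)) := fun z => by
    rw [mWrightAt, mul_div_cancel_left₀ _ hp.ne', Real.rpow_neg ht.le, smul_smul]
  simp only [e] at h
  rw [integral_smul] at h
  exact (smul_right_injective E (inv_ne_zero hp.ne') h).symm

lemma integrableOn_comp_mWrightAt_iff {E : Type*} [NormedAddCommGroup E] [NormedSpace ℝ E]
    (φ : ℝ → E) {ν t : ℝ} (ht : 0 < t) :
    IntegrableOn (fun x => mWrightAt ν x t • φ x) (Ioi 0) ↔
      IntegrableOn (fun z => mWright ν z • φ (t ^ ν * z)) (Ioi 0) := by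
  have hp := Real.rpow_pos_of_pos ht ν
  have h := integrableOn_Ioi_comp_mul_left_iff (fun x => mWrightAt ν x t • φ x) 0 hp
  rw [mul_zero] at h
  have e : ∀ z : ℝ, mWrightAt ν (t ^ ν * z) t • φ (t ^ ν * z) =
      (t ^ ν)⁻¹ • (mWright ν z • φ (t ^ ν * z)) := fun z => by
    rw [mWrightAt, mul_div_cancel_left₀ _ hp.ne', Real.rpow_neg ht.le, smul_smul]
  simp only [e] at h
  rw [← h]
  exact (integrable_smul_iff (inv_ne_zero hp.ne') _)

/-- Fubini provides some positive time at which the spatial density is integrable, and scaling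
transfers this to time 1, so no estimate at `0` or at infinity is needed. -/
lemma integrableOn_mWright {ν : ℝ} (hν : 0 < ν) (hν1 : ν < 1) :
    IntegrableOn (mWright ν) (Ioi 0) := by
  have h := (integrable_exp_mul_mWrightAt_prod hν hν1 one_pos).prod_left_ae
  have : (ae (volume.restrict (Ioi (0 : ℝ)))).NeBot := ae_neBot.2 (by simp)
  obtain ⟨t, ht, ht0⟩ := (h.and (ae_restrict_mem measurableSet_Ioi)).exists
  have h1 : IntegrableOn (fun x => mWrightAt ν x t • (1 : ℝ)) (Ioi 0) := by
    refine (ht.const_mul (Real.exp (1 * t))).congr (ae_of_all _ fun x => ?_)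
    simp only [smul_eq_mul, mul_one]
    rw [← mul_assoc, ← Real.exp_add]
    simp
  rw [integrableOn_comp_mWrightAt_iff (fun _ => (1 : ℝ)) ht0] at h1
  simpa using h1

lemma integral_exp_neg_mul_Ioi {s : ℝ} (hs : 0 < s) :
    ∫ t in Ioi (0 : ℝ), Real.exp (-(s * t)) = s⁻¹ := by
  have := integral_exp_mul_Ioi (neg_lt_zero.2 hs) 0
  simp only [neg_mul, mul_zero, Real.exp_zero] at this
  rw [this]
  simp [neg_div]

/-- Integrate `exp (-t) M_ν(x; t)` in both orders: time first gives `∫ exp (-x) dx = 1`, space first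
gives the mass, which does not depend on `t`. -/
lemma integral_mWright {ν : ℝ} (hν : 0 < ν) (hν1 : ν < 1) :
    ∫ z in Ioi (0 : ℝ), mWright ν z = 1 := by
  have h := integral_integral_swap (f := fun x t => Real.exp (-(1 * t)) * mWrightAt ν x t)
    (integrable_exp_mul_mWrightAt_prod hν hν1 one_pos)
  have e1 : ∀ x ∈ Ioi (0 : ℝ), ∫ t in Ioi (0 : ℝ), Real.exp (-(1 * t)) * mWrightAt ν x t =
      Real.exp (-(1 * x)) := fun x hx => by
    rw [laplace_mWrightAt hν hν1 hx one_pos]; simp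
  have e2 : ∀ t ∈ Ioi (0 : ℝ), ∫ x in Ioi (0 : ℝ), Real.exp (-(1 * t)) * mWrightAt ν x t =
      Real.exp (-(1 * t)) * ∫ z in Ioi (0 : ℝ), mWright ν z := fun t ht => by
    rw [integral_const_mul]
    have := setIntegral_comp_mWrightAt (fun _ => (1 : ℝ)) (ν := ν) ht
    simp only [smul_eq_mul, mul_one] at this
    rw [this]
  rw [setIntegral_congr_fun measurableSet_Ioi e1, setIntegral_congr_fun measurableSet_Ioi e2,
    integral_mul_const, integral_exp_neg_mul_Ioi one_pos] at h
  simpa using h.symm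

/-! ### The neutral Stieltjes transform and its boundary representation -/

/-- `z ^ (α - 1) / (z ^ α + exp (i θ π / 2))`, the Stieltjes transform of the neutral law. -/
noncomputable def neutralStieltjes (α θ : ℝ) (z : ℂ) : ℂ :=
  z ^ ((α - 1 : ℝ) : ℂ) / (z ^ (α : ℂ) + Complex.exp ((θ * Real.pi / 2 : ℝ) * Complex.I))

/-- The threshold makes `‖z‖ ^ α ≤ 1 / 2` against an exponential of modulus 1, so the denominator is
at least `1 / 2`. The far bound uses `‖z‖ ^ α ≥ 2` likewise. -/
lemma neutralStieltjes_norm_near {α θ : ℝ} (hα : 0 < α) {z : ℂ} (hz0 : z ≠ 0)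
    (hz : ‖z‖ ≤ (1 / 2 : ℝ) ^ (1 / α)) : ‖neutralStieltjes α θ z‖ ≤ 2 * ‖z‖ ^ (α - 1) := by
  have h1 : ‖z‖ ^ α ≤ 1 / 2 := by
    calc ‖z‖ ^ α ≤ ((1 / 2 : ℝ) ^ (1 / α)) ^ α := by gcongr
      _ = 1 / 2 := by rw [← Real.rpow_mul (by norm_num), one_div_mul_cancel hα.ne', Real.rpow_one]
  have h2 := norm_sub_norm_le (Complex.exp ((θ * Real.pi / 2 : ℝ) * Complex.I)) (-(z ^ (α : ℂ)))
  rw [Complex.norm_exp_ofReal_mul_I, norm_neg, Complex.norm_cpow_real, sub_neg_eq_add,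
    add_comm] at h2
  rw [neutralStieltjes, norm_div, Complex.norm_cpow_real]
  calc ‖z‖ ^ (α - 1) / _ ≤ ‖z‖ ^ (α - 1) / (1 / 2) := by gcongr; linarith
    _ = _ := by ring

lemma neutralStieltjes_norm_far {α θ : ℝ} (hα : 0 < α) {z : ℂ}
    (hz : (2 : ℝ) ^ (1 / α) ≤ ‖z‖) : ‖neutralStieltjes α θ z‖ ≤ 2 * ‖z‖ ^ (-1 : ℝ) := by
  have hz' : 0 < ‖z‖ := lt_of_lt_of_le (by positivity) hz
  have h1 : 2 ≤ ‖z‖ ^ α := by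
    calc (2 : ℝ) = ((2 : ℝ) ^ (1 / α)) ^ α := by
          rw [← Real.rpow_mul (by norm_num), one_div_mul_cancel hα.ne', Real.rpow_one]
      _ ≤ ‖z‖ ^ α := by gcongr
  have h2 := norm_sub_norm_le (z ^ (α : ℂ)) (-Complex.exp ((θ * Real.pi / 2 : ℝ) * Complex.I))
  rw [norm_neg, Complex.norm_exp_ofReal_mul_I, Complex.norm_cpow_real, sub_neg_eq_add] at h2
  rw [neutralStieltjes, norm_div, Complex.norm_cpow_real]
  calc ‖z‖ ^ (α - 1) / _ ≤ ‖z‖ ^ (α - 1) / (‖z‖ ^ α / 2) := by gcongr; linarith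
    _ = _ := by
      rw [Real.rpow_sub_one hz'.ne', Real.rpow_neg_one]
      have := (Real.rpow_pos_of_pos hz' α).ne'
      field_simp

lemma cos_arg_eq_neg_one_of_denominator_eq_zero {α θ : ℝ} (hα : 0 < α) {z : ℂ}
    (hD : z ^ (α : ℂ) + Complex.exp ((θ * Real.pi / 2 : ℝ) * Complex.I) = 0) :
    ‖z‖ = 1 ∧ Real.cos (α * z.arg - θ * Real.pi / 2) = -1 := by
  have h1 : z ^ (α : ℂ) = -Complex.exp ((θ * Real.pi / 2 : ℝ) * Complex.I) :=
    eq_neg_of_add_eq_zero_left hD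
  have hn := congrArg norm h1
  rw [norm_neg, Complex.norm_exp_ofReal_mul_I, Complex.norm_cpow_real] at hn
  have hz : ‖z‖ = 1 := by
    have := congrArg (fun x : ℝ => x ^ (α⁻¹)) hn
    simpa [← Real.rpow_mul (norm_nonneg z), hα.ne'] using this
  refine ⟨hz, ?_⟩
  have hz0 : 0 < ‖z‖ := by rw [hz]; exact one_pos
  have hp := ofReal_mul_exp_cpow (r := ‖z‖) (v := z.arg) hz0 (Complex.arg_mem_Ioc z) α
  rw [Complex.norm_mul_exp_arg_mul_I, hn, Complex.ofReal_one, one_mul, h1] at hp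
  have h2 : Complex.exp ((α * z.arg - θ * Real.pi / 2 : ℝ) * Complex.I) = -1 := by
    have : ((α * z.arg - θ * Real.pi / 2 : ℝ) : ℂ) * Complex.I =
        (α * z.arg : ℝ) * Complex.I - (θ * Real.pi / 2 : ℝ) * Complex.I := by push_cast; ring
    rw [this, Complex.exp_sub, ← hp, neg_div, div_self (Complex.exp_ne_zero _)]
  have := congrArg Complex.re h2
  rwa [Complex.exp_ofReal_mul_I_re, Complex.neg_re, Complex.one_re] at this

/-- A zero requires `α arg z - θ π / 2` to be an odd multiple of `π`. For `|arg z| ≤ π / 2` its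
modulus is at most `(α + |θ|) π / 2 < π`. -/
lemma denominator_ne_zero {α θ : ℝ} (hα : 0 < α) (hθ : |θ| < 2 - α) {z : ℂ} (hz : 0 ≤ z.re) :
    z ^ (α : ℂ) + Complex.exp ((θ * Real.pi / 2 : ℝ) * Complex.I) ≠ 0 := by
  intro hD
  have hπ := Real.pi_pos
  obtain ⟨-, hcos⟩ := cos_arg_eq_neg_one_of_denominator_eq_zero hα hD
  have harg := abs_le.1 (Complex.abs_arg_le_pi_div_two_iff.2 hz)
  have hθ' := abs_lt.1 hθ
  have h1 : |α * z.arg - θ * Real.pi / 2| < Real.pi := by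
    rw [abs_lt]
    constructor <;> nlinarith
  have := Real.cos_lt_cos_of_nonneg_of_le_pi (abs_nonneg _) le_rfl h1
  rw [Real.cos_pi, Real.cos_abs] at this
  linarith

lemma neutralStieltjes_differentiableAt {α θ : ℝ} {z : ℂ} (hz : z ∈ Complex.slitPlane)
    (hD : z ^ (α : ℂ) + Complex.exp ((θ * Real.pi / 2 : ℝ) * Complex.I) ≠ 0) :
    DifferentiableAt ℂ (neutralStieltjes α θ) z :=
  (differentiableAt_id.cpow_const hz).div ((differentiableAt_id.cpow_const hz).add_const _) hD

/-- The size at `0` is `‖z‖ ^ (α - 1)`; for `α > 1` this is only used as boundedness, because the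
representation formula asks for a nonnegative exponent `p`. -/
lemma neutralStieltjes_decay {α θ : ℝ} (hα : 0 < α) (hθ : |θ| < 2 - α) :
    HalfPlaneDecay (neutralStieltjes α θ) (max 0 (1 - α)) 1 := by
  refine HalfPlaneDecay.of_bound_near (δ := (1 / 2 : ℝ) ^ (1 / α)) (R := (2 : ℝ) ^ (1 / α))
    (C := 2) (max_le zero_le_one (by linarith)) (fun z hz hz0 => ?_) (by positivity)
    (fun z hz hz0 hzδ => ?_) fun z hz hzR => neutralStieltjes_norm_far hα hzR
  · exact neutralStieltjes_differentiableAt (mem_slitPlane_of_re_nonneg hz hz0)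
      (denominator_ne_zero hα hθ hz)
  · refine (neutralStieltjes_norm_near hα hz0 hzδ).trans ?_
    have h1 : ‖z‖ ≤ 1 := hzδ.trans (Real.rpow_le_one (by norm_num) (by norm_num) (by positivity))
    refine mul_le_mul_of_nonneg_left ?_ zero_le_two
    exact Real.rpow_le_rpow_of_exponent_ge (norm_pos_iff.2 hz0) h1
      (by linarith [le_max_right 0 (1 - α)])

/-- Stieltjes inversion: this computation is where the formula for `N_α^θ` comes from. The factor `i
^ (α - 1)` turns the real part of the quotient into `sin (π (α - θ) / 2)`. -/
lemma neutralStieltjes_vert_re {α θ y : ℝ} (hy : 0 < y) :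
    (neutralStieltjes α θ (y * Complex.I)).re = Real.pi * neutralDensity α θ y := by
  have hπ := Real.pi_pos
  have hmem : Real.pi / 2 ∈ Ioc (-Real.pi) Real.pi := ⟨by linarith, by linarith⟩
  rw [← exp_pi_div_two_ofReal, neutralStieltjes, ofReal_mul_exp_cpow hy hmem,
    ofReal_mul_exp_cpow hy hmem, neutralDensity, Complex.div_re]
  set D : ℂ := ((y ^ α : ℝ) : ℂ) * Complex.exp ((α * (Real.pi / 2) : ℝ) * Complex.I) +
    Complex.exp ((θ * Real.pi / 2 : ℝ) * Complex.I)
  have hDre : D.re = y ^ α * Real.cos (α * (Real.pi / 2)) + Real.cos (θ * Real.pi / 2) := by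
    simp only [D]
    rw [Complex.add_re, Complex.re_ofReal_mul, Complex.exp_ofReal_mul_I_re,
      Complex.exp_ofReal_mul_I_re]
  have hDim : D.im = y ^ α * Real.sin (α * (Real.pi / 2)) + Real.sin (θ * Real.pi / 2) := by
    simp only [D]
    rw [Complex.add_im, Complex.im_ofReal_mul, Complex.exp_ofReal_mul_I_im,
      Complex.exp_ofReal_mul_I_im]
  have e1 : Real.pi / 2 * (α - θ) = α * (Real.pi / 2) - θ * Real.pi / 2 := by ring
  have e2 : (α - 1) * (Real.pi / 2) = α * (Real.pi / 2) - Real.pi / 2 := by ring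
  have e3 : y ^ (2 * α) = (y ^ α) ^ 2 := by
    rw [mul_comm, Real.rpow_mul hy.le, Real.rpow_two]
  have hnsq : Complex.normSq D = 1 + 2 * y ^ α * Real.cos (Real.pi / 2 * (α - θ)) + y ^ (2 * α) := by
    rw [Complex.normSq_apply, hDre, hDim, e1, Real.cos_sub, e3]
    linear_combination (y ^ α) ^ 2 * Real.sin_sq_add_cos_sq (α * (Real.pi / 2)) +
      Real.sin_sq_add_cos_sq (θ * Real.pi / 2)
  rw [hnsq, Complex.re_ofReal_mul, Complex.im_ofReal_mul, Complex.exp_ofReal_mul_I_re,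
    Complex.exp_ofReal_mul_I_im, hDre, hDim, e2, Real.cos_sub_pi_div_two, Real.sin_sub_pi_div_two,
    e1, Real.sin_sub]
  field_simp
  ring

lemma neutralStieltjes_conj {α θ : ℝ} {z : ℂ} (hz : z.arg ≠ Real.pi) :
    neutralStieltjes α (-θ) ((starRingEnd ℂ) z) = (starRingEnd ℂ) (neutralStieltjes α θ z) := by
  have h : ∀ a : ℝ, ((starRingEnd ℂ) z) ^ (a : ℂ) = (starRingEnd ℂ) (z ^ (a : ℂ)) := fun a => by
    have := Complex.cpow_conj z a hz
    rw [Complex.conj_ofReal] at this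
    rw [this, Complex.conj_conj]
  rw [neutralStieltjes, neutralStieltjes, map_div₀, map_add, h, h, ← Complex.exp_conj, map_mul,
    Complex.conj_ofReal, Complex.conj_I]
  congr 3
  push_cast
  ring

lemma neutralStieltjes_vert_neg_re {α θ y : ℝ} (hy : 0 < y) :
    (neutralStieltjes α θ (y * -Complex.I)).re = Real.pi * neutralDensity α (-θ) y := by
  have harg : ((y : ℂ) * Complex.I).arg ≠ Real.pi := by
    rw [Complex.arg_real_mul _ hy, Complex.arg_I]; linarith [Real.pi_pos]
  have h := neutralStieltjes_conj (α := α) (θ := -θ) harg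
  rw [neg_neg, map_mul, Complex.conj_ofReal, Complex.conj_I] at h
  rw [h, Complex.conj_re, neutralStieltjes_vert_re hy]

/-- The Stieltjes transform of the measure with densities `neutralDensity α (±θ)` on the two
half-lines and atoms of masses `a` and `b` at `1` and `-1` is `neutralStieltjes α θ`. -/
def NeutralRepresentation (α θ a b : ℝ) : Prop :=
  ∀ s : ℝ, 0 < s →
    IntegrableOn (fun y : ℝ => (neutralDensity α θ y : ℂ) / (s - y * Complex.I)) (Ioi 0) ∧
    IntegrableOn (fun y : ℝ => (neutralDensity α (-θ) y : ℂ) / (s + y * Complex.I)) (Ioi 0) ∧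
    (∫ y in Ioi (0 : ℝ), (neutralDensity α θ y : ℂ) / (s - y * Complex.I)) +
      (∫ y in Ioi (0 : ℝ), (neutralDensity α (-θ) y : ℂ) / (s + y * Complex.I)) +
      (a / (s - Complex.I) + b / (s + Complex.I)) = neutralStieltjes α θ s

lemma NeutralRepresentation.symm {α θ a b : ℝ} (h : NeutralRepresentation α θ a b) :
    NeutralRepresentation α (-θ) b a := by
  intro s hs
  obtain ⟨i1, i2, h3⟩ := h s hs
  have conjI : ∀ {f : ℝ → ℂ}, IntegrableOn f (Ioi 0) →
      IntegrableOn (fun y => (starRingEnd ℂ) (f y)) (Ioi 0) := fun hf =>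
    (Complex.conjCLE.toContinuousLinearMap.integrable_comp hf)
  have e1 : ∀ x y : ℝ, (starRingEnd ℂ) ((x : ℂ) / (s - y * Complex.I)) =
      x / (s + y * Complex.I) := fun x y => by simp
  have e2 : ∀ x y : ℝ, (starRingEnd ℂ) ((x : ℂ) / (s + y * Complex.I)) =
      x / (s - y * Complex.I) := fun x y => by simp [sub_eq_add_neg]
  have j1 := conjI i1
  have j2 := conjI i2
  simp only [e1, e2] at j1 j2
  refine ⟨j2, by simpa only [neg_neg] using j1, ?_⟩
  have h4 := congrArg (starRingEnd ℂ) h3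
  rw [map_add, map_add, map_add, ← integral_conj, ← integral_conj] at h4
  have e3 := e1 a 1
  have e4 := e2 b 1
  simp only [Complex.ofReal_one, one_mul] at e3 e4
  simp only [e1, e2, e3, e4] at h4
  have h5 := neutralStieltjes_conj (α := α) (θ := θ) (z := s) (by
    rw [Complex.arg_ofReal_of_nonneg hs.le]; exact Real.pi_pos.ne)
  rw [Complex.conj_ofReal] at h5
  rw [h5, ← h4, neg_neg]
  ring

/-- Subtracting the pole at `-i` costs nothing: `b / (z + i)` with real `b` is purely imaginary on
the imaginary axis, so the real boundary values are still `π` times the neutral densities. Only `y =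
1` on the lower half-axis is lost, a null set. -/
lemma NeutralRepresentation.of_halfPlaneDecay {α θ b p : ℝ} {F : ℂ → ℂ}
    (h : HalfPlaneDecay F p 1) (hp : 0 ≤ p) (hp1 : p < 1)
    (hF : ∀ z : ℂ, z ≠ -Complex.I → F z = neutralStieltjes α θ z - b / (z + Complex.I)) :
    NeutralRepresentation α θ 0 b := by
  intro s hs
  have hπ := Real.pi_pos
  obtain ⟨i1, i2, h3⟩ := h.stieltjes_formula hp hp1 one_pos hp1.le le_rfl hs
  have e1 : ∀ y ∈ Ioi (0 : ℝ), ((F (y * Complex.I)).re : ℂ) / (s - y * Complex.I) =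
      Real.pi * ((neutralDensity α θ y : ℂ) / (s - y * Complex.I)) := by
    intro y hy
    have hy : (0 : ℝ) < y := hy
    have hne : (y : ℂ) * Complex.I ≠ -Complex.I := fun h => by
      have := congrArg Complex.im h
      simp at this
      linarith
    have e : (b : ℂ) / (y * Complex.I + Complex.I) = ((-(b / (y + 1)) : ℝ) : ℂ) * Complex.I := by
      have h1 : (y : ℂ) + 1 ≠ 0 := by exact_mod_cast (by positivity : y + 1 ≠ 0)
      have h2 : (y : ℂ) * Complex.I + Complex.I ≠ 0 := by
        rw [← add_one_mul]; exact mul_ne_zero h1 Complex.I_ne_zero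
      push_cast
      rw [div_eq_iff h2]
      field_simp
      rw [Complex.I_sq]
      ring
    rw [hF _ hne, e, Complex.sub_re, Complex.re_ofReal_mul, Complex.I_re, mul_zero, sub_zero,
      neutralStieltjes_vert_re hy]
    push_cast
    ring
  have e2 : ∀ y ∈ Ioi (0 : ℝ) \ {1}, ((F (y * -Complex.I)).re : ℂ) / (s + y * Complex.I) =
      Real.pi * ((neutralDensity α (-θ) y : ℂ) / (s + y * Complex.I)) := by
    intro y hy
    have hy0 : (0 : ℝ) < y := hy.1
    have hy1 : y - 1 ≠ 0 := sub_ne_zero.2 hy.2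
    have hne : (y : ℂ) * -Complex.I ≠ -Complex.I := fun h => by
      have := congrArg Complex.im h
      simp at this
      exact hy.2 this
    have e : (b : ℂ) / (y * -Complex.I + Complex.I) = ((b / (y - 1) : ℝ) : ℂ) * Complex.I := by
      have h1 : (y : ℂ) - 1 ≠ 0 := by exact_mod_cast hy1
      have h2 : (y : ℂ) * -Complex.I + Complex.I = -((y - 1) * Complex.I) := by ring
      rw [h2]
      push_cast
      rw [div_eq_iff (neg_ne_zero.2 (mul_ne_zero h1 Complex.I_ne_zero))]
      field_simp
      rw [Complex.I_sq]
      ring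
    rw [hF _ hne, e, Complex.sub_re, Complex.re_ofReal_mul, Complex.I_re, mul_zero, sub_zero,
      neutralStieltjes_vert_neg_re hy0]
    push_cast
    ring
  have a1 : (fun y : ℝ => ((F (y * Complex.I)).re : ℂ) / (s - y * Complex.I)) =ᵐ[volume.restrict
      (Ioi 0)] fun y => Real.pi * ((neutralDensity α θ y : ℂ) / (s - y * Complex.I)) :=
    (ae_restrict_iff' measurableSet_Ioi).2 (ae_of_all _ e1)
  have a2 : (fun y : ℝ => ((F (y * -Complex.I)).re : ℂ) / (s + y * Complex.I)) =ᵐ[volume.restrict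
      (Ioi 0)] fun y => Real.pi * ((neutralDensity α (-θ) y : ℂ) / (s + y * Complex.I)) := by
    refine (ae_restrict_iff' measurableSet_Ioi).2 ?_
    filter_upwards [compl_mem_ae_iff.2 (measure_singleton (μ := volume) (1 : ℝ))] with y hy1 hy
    exact e2 y ⟨hy, hy1⟩
  have hπ' : (Real.pi : ℂ) ≠ 0 := Complex.ofReal_ne_zero.2 hπ.ne'
  have j1 := (i1.congr a1).const_mul (Real.pi : ℂ)⁻¹
  have j2 := (i2.congr a2).const_mul (Real.pi : ℂ)⁻¹
  simp only [inv_mul_cancel_left₀ hπ'] at j1 j2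
  refine ⟨j1, j2, ?_⟩
  rw [integral_add i1 i2, integral_congr_ae a1, integral_congr_ae a2, integral_const_mul,
    integral_const_mul, ← mul_add] at h3
  have hsne : (s : ℂ) ≠ -Complex.I := fun h => by
    have := congrArg Complex.re h
    simp at this
    linarith
  rw [mul_left_cancel₀ hπ' h3, hF _ hsne]
  simp

lemma neutralRepresentation_of_lt {α θ : ℝ} (hα : 0 < α) (hθ : |θ| < 2 - α) :
    NeutralRepresentation α θ 0 0 :=
  .of_halfPlaneDecay (neutralStieltjes_decay hα hθ) (le_max_left _ _)
    (max_lt one_pos (by linarith)) fun z _ => by simp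

/-- In the extremal case the phase `α arg z - (2 - α) π / 2` ranges over `[-π, (α - 1) π]`. It
reaches an odd multiple of `π` only at the left end, where `arg z = -π / 2`. -/
lemma denominator_eq_zero_extremal {α : ℝ} (hα : 1 ≤ α) (hα2 : α < 2) {z : ℂ} (hz : 0 ≤ z.re)
    (hD : z ^ (α : ℂ) + Complex.exp (((2 - α) * Real.pi / 2 : ℝ) * Complex.I) = 0) :
    z = -Complex.I := by
  have hπ := Real.pi_pos
  obtain ⟨hn, hcos⟩ := cos_arg_eq_neg_one_of_denominator_eq_zero (by linarith) hD
  have harg := abs_le.1 (Complex.abs_arg_le_pi_div_two_iff.2 hz)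
  have h1 : |α * z.arg - (2 - α) * Real.pi / 2| ≤ Real.pi := by
    rw [abs_le]
    constructor <;> nlinarith
  have h2 : |α * z.arg - (2 - α) * Real.pi / 2| = Real.pi :=
    Real.injOn_cos ⟨abs_nonneg _, h1⟩ ⟨hπ.le, le_rfl⟩ (by rw [Real.cos_abs, Real.cos_pi, hcos])
  have h3 : z.arg = -(Real.pi / 2) := by
    rcases (abs_eq hπ.le).1 h2 with h | h
    · nlinarith
    · have : α * (z.arg + Real.pi / 2) = 0 := by linarith
      rcases mul_eq_zero.1 this with h | h <;> linarith
  rw [← Complex.norm_mul_exp_arg_mul_I z, hn, h3]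
  push_cast
  rw [neg_mul, Complex.exp_neg, Complex.exp_pi_div_two_mul_I, Complex.inv_I]
  simp

lemma denominator_extremal_neg_I (α : ℝ) :
    (-Complex.I) ^ (α : ℂ) + Complex.exp (((2 - α) * Real.pi / 2 : ℝ) * Complex.I) = 0 := by
  have hπ := Real.pi_pos
  have h := ofReal_mul_exp_cpow (r := 1) (v := -(Real.pi / 2)) one_pos
    ⟨by linarith, by linarith⟩ α
  have e : Complex.exp (((-(Real.pi / 2) : ℝ) : ℂ) * Complex.I) = -Complex.I := by
    push_cast; rw [neg_mul, Complex.exp_neg, Complex.exp_pi_div_two_mul_I, Complex.inv_I]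
  rw [e, Complex.ofReal_one, one_mul, Real.one_rpow, Complex.ofReal_one, one_mul] at h
  have e2 : (((2 - α) * Real.pi / 2 : ℝ) : ℂ) * Complex.I =
      Real.pi * Complex.I + (α * -(Real.pi / 2) : ℝ) * Complex.I := by push_cast; ring
  rw [h, e2, Complex.exp_add, Complex.exp_pi_mul_I]
  ring

/-- The denominator has a simple zero at `-i` with derivative `α (-i) ^ (α - 1)`, so the pole has
residue `1 / α`. Its removal leaves a function with half-plane decay, and the pole itself accounts
for an atom at `-1`. -/
lemma neutralRepresentation_extremal {α : ℝ} (hα : 1 ≤ α) (hα2 : α < 2) :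
    NeutralRepresentation α (2 - α) 0 (1 / α) := by
  have hα0 : 0 < α := by linarith
  set D : ℂ → ℂ := fun z => z ^ (α : ℂ) + Complex.exp (((2 - α) * Real.pi / 2 : ℝ) * Complex.I)
  have hI : -Complex.I ∈ Complex.slitPlane := by simp [Complex.mem_slitPlane_iff]
  have hopen := Complex.isOpen_slitPlane
  have hDd : DifferentiableOn ℂ D Complex.slitPlane := fun z hz =>
    ((differentiableAt_id.cpow_const hz).add_const _).differentiableWithinAt
  set E := dslope D (-Complex.I)
  have hEd : DifferentiableOn ℂ E Complex.slitPlane :=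
    (Complex.differentiableOn_dslope (hopen.mem_nhds hI)).2 hDd
  have hEne : ∀ z, z ≠ -Complex.I → E z = D z / (z + Complex.I) := fun z hz => by
    simp only [E]
    rw [dslope_of_ne _ hz, slope_def_field, show D (-Complex.I) = 0 from denominator_extremal_neg_I α,
      sub_zero, sub_neg_eq_add]
  have hEI : E (-Complex.I) = α * (-Complex.I) ^ ((α - 1 : ℝ) : ℂ) := by
    simp only [E]
    rw [dslope_same]
    have : HasDerivAt D (α * (-Complex.I) ^ ((α : ℂ) - 1) * 1) (-Complex.I) :=
      ((hasDerivAt_id (-Complex.I)).cpow_const hI).add_const _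
    rw [this.deriv]
    push_cast
    ring
  have hpI : (-Complex.I) ^ ((α - 1 : ℝ) : ℂ) ≠ 0 := by
    rw [Complex.cpow_ne_zero_iff]; left; simp
  set U : Set ℂ := Complex.slitPlane ∩ E ⁻¹' {0}ᶜ
  have hU : IsOpen U := hEd.continuousOn.isOpen_inter_preimage hopen isOpen_compl_singleton
  -- `E` is the denominator with its zero divided out, so `Q` is `z + i` times the transform and
  -- takes the residue as its value at `-i`. The divided difference of `Q` at `-i` is then the
  -- transform minus its polar part.
  set Q : ℂ → ℂ := fun z => z ^ ((α - 1 : ℝ) : ℂ) / E z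
  have hαC : (α : ℂ) ≠ 0 := Complex.ofReal_ne_zero.2 hα0.ne'
  have hQI : Q (-Complex.I) = (1 / α : ℝ) := by
    simp only [Q, hEI]
    push_cast
    field_simp
  have hIU : -Complex.I ∈ U := ⟨hI, by
    simp only [mem_preimage, hEI]
    exact mul_ne_zero hαC hpI⟩
  have hQd : DifferentiableOn ℂ Q U := fun z hz =>
    ((differentiableAt_id.cpow_const hz.1).differentiableWithinAt).div
      ((hEd z hz.1).mono inter_subset_left) hz.2
  have hFd := (Complex.differentiableOn_dslope (hU.mem_nhds hIU)).2 hQd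
  have hFne : ∀ z : ℂ, z ≠ -Complex.I → dslope Q (-Complex.I) z =
      neutralStieltjes α (2 - α) z - (1 / α : ℝ) / (z + Complex.I) := fun z hz => by
    have hz' : z + Complex.I ≠ 0 := fun h => hz (eq_neg_of_add_eq_zero_left h)
    rw [dslope_of_ne _ hz, slope_def_field, hQI, sub_neg_eq_add, sub_div]
    congr 1
    simp only [Q, hEne z hz, neutralStieltjes]
    change _ / (D z / _) / _ = _ / D z
    rw [div_div_eq_mul_div, div_right_comm, mul_div_cancel_right₀ _ hz']
  refine NeutralRepresentation.of_halfPlaneDecay (p := 0) ?_ le_rfl one_pos hFne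
  -- The extra cut-offs `1 / 2` and `2` keep `z` away from `-i`, and the constant is `4 = 2 + 2`,
  -- one `2` for the transform and one for the polar part. The exponent `p = 0` is allowed because
  -- `α ≥ 1`.
  refine HalfPlaneDecay.of_bound_near (δ := min ((1 / 2 : ℝ) ^ (1 / α)) (1 / 2))
    (R := max ((2 : ℝ) ^ (1 / α)) 2) (C := 4) zero_le_one (fun z hz hz0 => ?_) (by positivity)
    (fun z hz hz0 hzδ => ?_) fun z hz hzR => ?_
  · refine (hFd z ⟨mem_slitPlane_of_re_nonneg hz hz0, ?_⟩).differentiableAt (hU.mem_nhds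
      ⟨mem_slitPlane_of_re_nonneg hz hz0, ?_⟩)
    all_goals
      rcases eq_or_ne z (-Complex.I) with rfl | hzI
      · exact hIU.2
      · have hz' : z + Complex.I ≠ 0 := fun h => hzI (eq_neg_of_add_eq_zero_left h)
        simp only [mem_preimage, hEne z hzI]
        exact div_ne_zero (fun h => hzI (denominator_eq_zero_extremal hα hα2 hz h)) hz'
  · have h2 : ‖z‖ ≤ 1 / 2 := hzδ.trans (min_le_right _ _)
    have h3 : 1 / 2 ≤ ‖z + Complex.I‖ := by
      have := norm_sub_norm_le Complex.I (-z)
      rw [Complex.norm_I, norm_neg, sub_neg_eq_add, add_comm] at this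
      linarith
    have hne : z ≠ -Complex.I := fun h => by rw [h, norm_neg, Complex.norm_I] at h2; linarith
    rw [hFne z hne, neg_zero, Real.rpow_zero, mul_one]
    refine (norm_sub_le _ _).trans ?_
    have h4 := neutralStieltjes_norm_near (θ := 2 - α) hα0 hz0 (hzδ.trans (min_le_left _ _))
    have h5 : ‖z‖ ^ (α - 1) ≤ 1 := Real.rpow_le_one (norm_nonneg _) (by linarith) (by linarith)
    have h6 : ‖((1 / α : ℝ) : ℂ) / (z + Complex.I)‖ ≤ 1 / (1 / 2) := by
      rw [norm_div, Complex.norm_real, Real.norm_of_nonneg (by positivity)]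
      gcongr
      exact (div_le_one hα0).2 hα
    linarith
  · have h2 : 2 ≤ ‖z‖ := (le_max_right _ _).trans hzR
    have h3 : ‖z‖ / 2 ≤ ‖z + Complex.I‖ := by
      have := norm_sub_norm_le z (-Complex.I)
      rw [norm_neg, Complex.norm_I, sub_neg_eq_add] at this
      linarith
    have hne : z ≠ -Complex.I := fun h => by rw [h, norm_neg, Complex.norm_I] at h2; linarith
    rw [hFne z hne]
    refine (norm_sub_le _ _).trans ?_
    have h4 := neutralStieltjes_norm_far (θ := 2 - α) hα0 ((le_max_left _ _).trans hzR)
    have h6 : ‖((1 / α : ℝ) : ℂ) / (z + Complex.I)‖ ≤ 1 / (‖z‖ / 2) := by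
      rw [norm_div, Complex.norm_real, Real.norm_of_nonneg (by positivity)]
      gcongr
      exact (div_le_one hα0).2 hα
    rw [Real.rpow_neg_one] at *
    have h7 : 1 / (‖z‖ / 2) = 2 * ‖z‖⁻¹ := by rw [one_div_div]; rfl
    linarith

lemma neutralRepresentation_two : NeutralRepresentation 2 0 (1 / 2) (1 / 2) := by
  intro s hs
  have hN : ∀ y, neutralDensity 2 0 y = 0 := fun y => by simp [neutralDensity]
  simp only [neg_zero, hN, Complex.ofReal_zero, zero_div, integral_zero, add_zero, zero_add]
  refine ⟨integrableOn_zero, integrableOn_zero, ?_⟩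
  have h1 : (s : ℂ) + Complex.I ≠ 0 := ofReal_add_ne_zero hs (by simp)
  have h2 : (s : ℂ) - Complex.I ≠ 0 := by
    rw [sub_eq_add_neg]; exact ofReal_add_ne_zero hs (by simp)
  have h3 : (s : ℂ) ^ 2 + 1 ≠ 0 := by
    have : (s : ℂ) ^ 2 + 1 = (s + Complex.I) * (s - Complex.I) := by
      ring_nf; rw [Complex.I_sq]; ring
    rw [this]; exact mul_ne_zero h1 h2
  have e : neutralStieltjes 2 0 s = s / (s ^ 2 + 1) := by
    have e1 : ((2 - 1 : ℝ) : ℂ) = 1 := by norm_num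
    have e2 : ((2 : ℝ) : ℂ) = (2 : ℕ) := by norm_num
    rw [neutralStieltjes, e1, e2, Complex.cpow_one, Complex.cpow_natCast]
    simp
  rw [e]
  push_cast
  field_simp
  ring_nf
  simp only [Complex.I_sq]
  ring

/-- Every admissible pair has a representation; there is no atom at `1` if `α - 2 < θ`. -/
lemma exists_neutralRepresentation {α θ : ℝ} (hα : 0 < α) (hα2 : α ≤ 2)
    (hθ : |θ| ≤ min α (2 - α)) :
    ∃ a b : ℝ, 0 ≤ a ∧ 0 ≤ b ∧ (α - 2 < θ → a = 0) ∧ NeutralRepresentation α θ a b := by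
  have h1 := hθ.trans (min_le_left _ _)
  have h2 := hθ.trans (min_le_right _ _)
  rcases h2.lt_or_eq with h | h
  · exact ⟨0, 0, le_rfl, le_rfl, fun _ => rfl, neutralRepresentation_of_lt hα h⟩
  have hα1 : 1 ≤ α := by linarith
  rcases hα2.lt_or_eq with hlt | rfl
  · rcases abs_choice θ with h3 | h3
    · have : θ = 2 - α := by linarith
      rw [this]
      exact ⟨0, 1 / α, le_rfl, by positivity, fun _ => rfl,
        neutralRepresentation_extremal hα1 hlt⟩
    · have : θ = -(2 - α) := by linarith
      rw [this]
      exact ⟨1 / α, 0, by positivity, le_rfl, fun h => by linarith,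
        (neutralRepresentation_extremal hα1 hlt).symm⟩
  · have : θ = 0 := by rw [← abs_eq_zero]; linarith
    rw [this]
    exact ⟨1 / 2, 1 / 2, by norm_num, by norm_num, fun h => by linarith, neutralRepresentation_two⟩

/-! ### Measures with half-line densities and existence of the neutral law -/

/-- The measure on the open half-line with density `n`. -/
noncomputable def halfLineMeasure (n : ℝ → ℝ) : Measure ℝ :=
  (volume.restrict (Ioi 0)).withDensity fun x => ENNReal.ofReal (n x)

lemma halfLineMeasure_singleton (n : ℝ → ℝ) (x : ℝ) : halfLineMeasure n {x} = 0 :=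
  withDensity_absolutelyContinuous _ _ (measure_singleton x)

lemma halfLineMeasure_Iic (n : ℝ → ℝ) : halfLineMeasure n (Iic 0) = 0 :=
  withDensity_absolutelyContinuous _ _ (by
    rw [Measure.restrict_apply measurableSet_Iic, Iic_inter_Ioi, Ioc_self, measure_empty])

lemma halfLineMeasure_restrict (n : ℝ → ℝ) :
    (halfLineMeasure n).restrict (Ioi 0) = halfLineMeasure n := by
  rw [halfLineMeasure, restrict_withDensity measurableSet_Ioi,
    Measure.restrict_restrict measurableSet_Ioi, inter_self]

lemma integrable_halfLineMeasure_iff {E : Type*} [NormedAddCommGroup E] [NormedSpace ℝ E]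
    {n : ℝ → ℝ} (hm : AEMeasurable n (volume.restrict (Ioi 0))) (h0 : ∀ x, 0 < x → 0 ≤ n x)
    {g : ℝ → E} : Integrable g (halfLineMeasure n) ↔ IntegrableOn (fun x => n x • g x) (Ioi 0) := by
  rw [halfLineMeasure, integrable_withDensity_iff_integrable_smul₀' hm.ennreal_ofReal
    (ae_of_all _ fun _ => ENNReal.ofReal_lt_top)]
  refine integrable_congr ((ae_restrict_iff' measurableSet_Ioi).2 (ae_of_all _ fun x hx => ?_))
  simp only [ENNReal.toReal_ofReal (h0 x hx)]

lemma integral_halfLineMeasure {E : Type*} [NormedAddCommGroup E] [NormedSpace ℝ E]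
    {n : ℝ → ℝ} (hm : AEMeasurable n (volume.restrict (Ioi 0))) (h0 : ∀ x, 0 < x → 0 ≤ n x)
    (g : ℝ → E) : ∫ x, g x ∂(halfLineMeasure n) = ∫ x in Ioi (0 : ℝ), n x • g x := by
  rw [halfLineMeasure, integral_withDensity_eq_integral_toReal_smul₀ hm.ennreal_ofReal
    (ae_of_all _ fun _ => ENNReal.ofReal_lt_top)]
  refine setIntegral_congr_fun measurableSet_Ioi fun x hx => ?_
  simp only [ENNReal.toReal_ofReal (h0 x hx)]

lemma measurable_neutralDensity (α θ : ℝ) : Measurable (neutralDensity α θ) := by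
  unfold neutralDensity
  fun_prop

/-- `|θ| ≤ α` and `|θ| ≤ 2 - α` place the angle in `[0, π]`, and the denominator is at least `(1 - y
^ α) ^ 2`. -/
lemma neutralDensity_nonneg {α θ y : ℝ} (hθ : |θ| ≤ min α (2 - α)) (hy : 0 < y) :
    0 ≤ neutralDensity α θ y := by
  have hπ := Real.pi_pos
  have h1 := abs_le.1 (hθ.trans (min_le_left _ _))
  have h2 := abs_le.1 (hθ.trans (min_le_right _ _))
  have hs : 0 ≤ Real.sin (Real.pi / 2 * (α - θ)) :=
    Real.sin_nonneg_of_nonneg_of_le_pi (by nlinarith) (by nlinarith)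
  have hc := Real.neg_one_le_cos (Real.pi / 2 * (α - θ))
  have hp : 0 < y ^ α := Real.rpow_pos_of_pos hy _
  have e3 : y ^ (2 * α) = (y ^ α) ^ 2 := by
    rw [mul_comm, Real.rpow_mul hy.le, Real.rpow_two]
  have hd : 0 ≤ 1 + 2 * y ^ α * Real.cos (Real.pi / 2 * (α - θ)) + y ^ (2 * α) := by
    rw [e3]
    nlinarith [sq_nonneg (1 - y ^ α)]
  unfold neutralDensity
  positivity

/-- `h` is the law at time `1` of the neutral diffusion with parameters `α`, `θ`. -/
structure IsNeutralLaw (α θ : ℝ) (h : Measure ℝ) : Prop where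
  prob : IsProbabilityMeasure h
  zero : h {0} = 0
  stieltjes : ∀ s : ℝ, 0 < s → ∫ y, 1 / ((s : ℂ) - y * Complex.I) ∂h = neutralStieltjes α θ s
  density : α - 2 < θ → h.restrict (Ioi 0) = halfLineMeasure (neutralDensity α θ)

lemma tendsto_mul_neutralStieltjes {α θ : ℝ} (hα : 0 < α) :
    Tendsto (fun s : ℝ => (s : ℂ) * neutralStieltjes α θ s) atTop (𝓝 1) := by
  set e := Complex.exp ((θ * Real.pi / 2 : ℝ) * Complex.I)
  have h : Tendsto (fun s : ℝ => (1 + e * ((s ^ (-α) : ℝ) : ℂ))⁻¹) atTop (𝓝 1) := by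
    have h1 : Tendsto (fun s : ℝ => ((s ^ (-α) : ℝ) : ℂ)) atTop (𝓝 ((0 : ℝ) : ℂ)) :=
      (Complex.continuous_ofReal.tendsto 0).comp (tendsto_rpow_neg_atTop hα)
    have h2 := ((h1.const_mul e).const_add 1).inv₀ (by simp)
    simpa using h2
  refine h.congr' ?_
  filter_upwards [eventually_gt_atTop 0] with s hs
  have hp : (s ^ α : ℝ) ≠ 0 := (Real.rpow_pos_of_pos hs _).ne'
  rw [neutralStieltjes, ← Complex.ofReal_cpow hs.le, ← Complex.ofReal_cpow hs.le,
    mul_div_assoc', ← Complex.ofReal_mul, Real.rpow_sub_one hs.ne', mul_div_cancel₀ _ hs.ne',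
    Real.rpow_neg hs.le, Complex.ofReal_inv]
  have hp' : ((s ^ α : ℝ) : ℂ) ≠ 0 := Complex.ofReal_ne_zero.2 hp
  have : 1 + e * ((s ^ α : ℝ) : ℂ)⁻¹ = (((s ^ α : ℝ) : ℂ) + e) / ((s ^ α : ℝ) : ℂ) := by
    field_simp
  rw [this, inv_div]

lemma re_one_div_sub_mul_I (s y : ℝ) :
    ((s : ℂ) * (1 / ((s : ℂ) - y * Complex.I))).re = s ^ 2 / (s ^ 2 + y ^ 2) := by
  rw [Complex.re_ofReal_mul, one_div, Complex.inv_re, Complex.normSq_apply]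
  simp
  ring

/-- The real part of `s / (s - i y)` increases to 1 as `s → ∞`, so by monotone convergence the mass
is the limit of `s` times the transform. Finiteness need not be known beforehand. -/
lemma measure_univ_of_stieltjes {α θ : ℝ} (hα : 0 < α) {h : Measure ℝ}
    (hi : ∀ s : ℝ, 0 < s → Integrable (fun y : ℝ => 1 / ((s : ℂ) - y * Complex.I)) h)
    (hs : ∀ s : ℝ, 0 < s → ∫ y, 1 / ((s : ℂ) - y * Complex.I) ∂h = neutralStieltjes α θ s) :
    h univ = 1 := by
  have hpos : ∀ N : ℕ, (0 : ℝ) < N + 1 := fun N => Nat.cast_add_one_pos N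
  set f : ℕ → ℝ → ℝ := fun N y => ((N : ℝ) + 1) ^ 2 / (((N : ℝ) + 1) ^ 2 + y ^ 2)
  have hint : ∀ N : ℕ, Integrable (fun y : ℝ =>
      (((N : ℝ) + 1 : ℝ) : ℂ) * (1 / ((((N : ℝ) + 1 : ℝ) : ℂ) - y * Complex.I))) h := fun N =>
    (hi _ (hpos N)).const_mul _
  have hval : ∀ N : ℕ, ∫⁻ y, ENNReal.ofReal (f N y) ∂h = ENNReal.ofReal
      ((((N : ℝ) + 1 : ℝ) : ℂ) * neutralStieltjes α θ ((N : ℝ) + 1 : ℝ)).re := fun N => by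
    rw [← hs _ (hpos N), ← integral_const_mul, ← ofReal_integral_eq_lintegral_ofReal]
    · congr 1
      rw [← RCLike.re_eq_complex_re, ← integral_re (hint N)]
      refine integral_congr_ae (ae_of_all _ fun y => ?_)
      exact (re_one_div_sub_mul_I _ y).symm
    · refine (hint N).re.congr (ae_of_all _ fun y => ?_)
      exact re_one_div_sub_mul_I _ y
    · exact ae_of_all _ fun y => by positivity
  have hmono : Tendsto (fun N => ∫⁻ y, ENNReal.ofReal (f N y) ∂h) atTop (𝓝 (∫⁻ _, 1 ∂h)) := by
    refine lintegral_tendsto_of_tendsto_of_monotone (fun N => by fun_prop)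
      (ae_of_all _ fun y M N hMN => ENNReal.ofReal_le_ofReal ?_) (ae_of_all _ fun y => ?_)
    · have hMN' : (M : ℝ) ≤ N := by exact_mod_cast hMN
      have hM := hpos M
      have hsq : ((M : ℝ) + 1) ^ 2 ≤ ((N : ℝ) + 1) ^ 2 := by gcongr
      rw [div_le_div_iff₀ (by positivity) (by positivity)]
      nlinarith [sq_nonneg y]
    · have h1 : Tendsto (fun N : ℕ => ((N : ℝ) + 1) ^ 2) atTop atTop :=
        (tendsto_pow_atTop two_ne_zero).comp
          (tendsto_atTop_add_const_right _ _ tendsto_natCast_atTop_atTop)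
      have h2 : Tendsto (fun N => f N y) atTop (𝓝 1) := by
        have h3 := (h1.inv_tendsto_atTop.const_mul (y ^ 2)).const_add 1
        have h4 := h3.inv₀ (by simp)
        simp only [mul_zero, add_zero, inv_one] at h4
        refine h4.congr fun N => ?_
        have := hpos N
        simp only [f, Pi.inv_apply]
        field_simp
      simpa [Function.comp_def] using (ENNReal.continuous_ofReal.tendsto 1).comp h2
  have hlim : Tendsto (fun N => ∫⁻ y, ENNReal.ofReal (f N y) ∂h) atTop (𝓝 1) := by
    simp only [hval]
    have h1 := (tendsto_mul_neutralStieltjes (θ := θ) hα).comp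
      (tendsto_atTop_add_const_right _ (1 : ℝ) tendsto_natCast_atTop_atTop)
    have h2 := (ENNReal.continuous_ofReal.tendsto _).comp ((Complex.continuous_re.tendsto _).comp h1)
    simpa [Function.comp_def] using h2
  rw [← tendsto_nhds_unique hmono hlim, lintegral_one]

lemma exists_isNeutralLaw {α θ : ℝ} (hα : 0 < α) (hα2 : α ≤ 2) (hθ : |θ| ≤ min α (2 - α)) :
    ∃ h : Measure ℝ, IsNeutralLaw α θ h := by
  obtain ⟨a, b, ha, hb, ha0, hrep⟩ := exists_neutralRepresentation hα hα2 hθ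
  have hθ' : |-θ| ≤ min α (2 - α) := by rwa [abs_neg]
  have hn := fun y hy => neutralDensity_nonneg (y := y) hθ hy
  have hn' := fun y hy => neutralDensity_nonneg (y := y) hθ' hy
  have hm : AEMeasurable (neutralDensity α θ) (volume.restrict (Ioi 0)) :=
    (measurable_neutralDensity α θ).aemeasurable
  have hm' : AEMeasurable (neutralDensity α (-θ)) (volume.restrict (Ioi 0)) :=
    (measurable_neutralDensity α (-θ)).aemeasurable
  set μ := halfLineMeasure (neutralDensity α θ)
  set ρ := (halfLineMeasure (neutralDensity α (-θ))).map (fun x : ℝ => -x)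
  set κ : Measure ℝ := ENNReal.ofReal a • Measure.dirac 1 + ENNReal.ofReal b • Measure.dirac (-1)
  have hint : ∀ s : ℝ, 0 < s →
      Integrable (fun y : ℝ => 1 / ((s : ℂ) - y * Complex.I)) (μ + ρ + κ) ∧
      ∫ y, 1 / ((s : ℂ) - y * Complex.I) ∂(μ + ρ + κ) = neutralStieltjes α θ s := by
    intro s hs
    obtain ⟨i1, i2, h3⟩ := hrep s hs
    have hcont : Continuous (fun y : ℝ => 1 / ((s : ℂ) - y * Complex.I)) := by
      refine continuous_const.div (by fun_prop) fun y => ?_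
      have := ofReal_add_ne_zero (z := ((-y : ℝ) : ℂ) * Complex.I) hs (by simp)
      simpa [sub_eq_add_neg] using this
    have j1 : Integrable (fun y : ℝ => 1 / ((s : ℂ) - y * Complex.I)) μ := by
      rw [integrable_halfLineMeasure_iff hm hn]
      simpa only [Complex.real_smul, mul_one_div] using i1
    have j2 : Integrable (fun y : ℝ => 1 / ((s : ℂ) - y * Complex.I)) ρ := by
      rw [integrable_map_measure hcont.aestronglyMeasurable (by fun_prop),
        integrable_halfLineMeasure_iff hm' hn']
      simpa [IntegrableOn, div_eq_mul_inv] using i2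
    have j3 : Integrable (fun y : ℝ => 1 / ((s : ℂ) - y * Complex.I)) κ := by
      refine Integrable.add_measure ?_ ?_ <;>
      exact (integrable_dirac (by simp)).smul_measure ENNReal.ofReal_ne_top
    refine ⟨(j1.add_measure j2).add_measure j3, ?_⟩
    have v1 : ∫ y, 1 / ((s : ℂ) - y * Complex.I) ∂μ =
        ∫ y in Ioi (0 : ℝ), (neutralDensity α θ y : ℂ) / (s - y * Complex.I) := by
      rw [integral_halfLineMeasure hm hn]
      simp only [Complex.real_smul, mul_one_div]
    have v2 : ∫ y, 1 / ((s : ℂ) - y * Complex.I) ∂ρ =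
        ∫ y in Ioi (0 : ℝ), (neutralDensity α (-θ) y : ℂ) / (s + y * Complex.I) := by
      rw [integral_map (by fun_prop) hcont.aestronglyMeasurable, integral_halfLineMeasure hm' hn']
      simp [div_eq_mul_inv]
    have v3 : ∫ y, 1 / ((s : ℂ) - y * Complex.I) ∂κ =
        a / (s - Complex.I) + b / (s + Complex.I) := by
      rw [integral_add_measure, integral_smul_measure, integral_smul_measure, integral_dirac,
        integral_dirac, ENNReal.toReal_ofReal ha, ENNReal.toReal_ofReal hb]
      · simp [div_eq_mul_inv]
      all_goals exact (integrable_dirac (by simp)).smul_measure ENNReal.ofReal_ne_top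
    rw [integral_add_measure (j1.add_measure j2) j3, integral_add_measure j1 j2, v1, v2, v3, h3]
  refine ⟨μ + ρ + κ, ⟨measure_univ_of_stieltjes hα (fun s hs => (hint s hs).1)
    fun s hs => (hint s hs).2⟩, ?_, fun s hs => (hint s hs).2, fun hlt => ?_⟩
  · have h1 : μ {0} = 0 := halfLineMeasure_singleton _ _
    have h2 : ρ {0} = 0 := by
      rw [Measure.map_apply (by fun_prop) (measurableSet_singleton _)]
      convert halfLineMeasure_singleton (neutralDensity α (-θ)) 0 using 2
      ext x
      simp
    have h3 : κ {0} = 0 := by simp [κ]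
    simp [h1, h2, h3]
  · have h1 : μ.restrict (Ioi 0) = μ := halfLineMeasure_restrict _
    have h2 : ρ.restrict (Ioi 0) = 0 := by
      rw [Measure.restrict_eq_zero, Measure.map_apply (by fun_prop) measurableSet_Ioi]
      refine measure_mono_null (fun x hx => ?_) (halfLineMeasure_Iic _)
      have : 0 < -x := hx
      exact (neg_pos.1 this).le
    have h3 : κ.restrict (Ioi 0) = 0 := by
      rw [Measure.restrict_eq_zero]
      simp [κ, ha0 hlt]
    rw [Measure.restrict_add, Measure.restrict_add, h1, h2, h3, add_zero, add_zero]

/-! ### The inverse stable law -/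

/-- `m` is the law at time `1` of the inverse `ν`-stable subordinator. -/
structure IsInverseStableLaw (ν : ℝ) (m : Measure ℝ) : Prop where
  prob : IsProbabilityMeasure m
  Iic_zero : m (Iic 0) = 0
  -- Subordination on the transform side: real time with variable `s` is exchanged for operational
  -- time `τ` with variable `s ^ ν`. Stated through the law at time 1, it also covers the
  -- deterministic case `ν = 1`.
  laplace : ∀ φ : ℝ → ℂ, Measurable φ → (∀ x, ‖φ x‖ ≤ 1) → ∀ s : ℝ, 0 < s →
    ∫ t in Ioi (0 : ℝ), (Real.exp (-(s * t)) : ℂ) * ∫ z, φ (t ^ ν * z) ∂m =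
      ((s ^ (ν - 1) : ℝ) : ℂ) * ∫ τ in Ioi (0 : ℝ), (Real.exp (-(s ^ ν * τ)) : ℂ) * φ τ

lemma isInverseStableLaw_dirac : IsInverseStableLaw 1 (Measure.dirac 1) := by
  refine ⟨inferInstance, by simp, fun φ hφ _ s hs => ?_⟩
  simp

lemma isInverseStableLaw_mWright {ν : ℝ} (hν : 0 < ν) (hν1 : ν < 1) :
    IsInverseStableLaw ν (halfLineMeasure (mWright ν)) := by
  have hm : AEMeasurable (mWright ν) (volume.restrict (Ioi 0)) :=
    (continuousOn_mWright hν hν1).aemeasurable measurableSet_Ioi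
  have h0 : ∀ z, 0 < z → 0 ≤ mWright ν z := fun z hz => mWright_nonneg hν hν1 hz
  refine ⟨⟨?_⟩, halfLineMeasure_Iic _, fun φ hφ hb s hs => ?_⟩
  · rw [halfLineMeasure, withDensity_apply _ MeasurableSet.univ, Measure.restrict_univ,
      ← ofReal_integral_eq_lintegral_ofReal (integrableOn_mWright hν hν1)
        ((ae_restrict_iff' measurableSet_Ioi).2 (ae_of_all _ h0)),
      integral_mWright hν hν1, ENNReal.ofReal_one]
  · have e1 : ∀ t ∈ Ioi (0 : ℝ), (Real.exp (-(s * t)) : ℂ) *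
        ∫ z, φ (t ^ ν * z) ∂(halfLineMeasure (mWright ν)) = ∫ x in Ioi (0 : ℝ),
          ((Real.exp (-(s * t)) * mWrightAt ν x t : ℝ) : ℂ) * φ x := fun t ht => by
      rw [integral_halfLineMeasure hm h0, ← setIntegral_comp_mWrightAt φ ht, ← integral_const_mul]
      refine integral_congr_ae (ae_of_all _ fun x => ?_)
      simp only [Complex.real_smul]
      push_cast
      ring
    have hint : Integrable (fun p : ℝ × ℝ =>
        ((Real.exp (-(s * p.2)) * mWrightAt ν p.1 p.2 : ℝ) : ℂ) * φ p.1)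
        ((volume.restrict (Ioi 0)).prod (volume.restrict (Ioi 0))) := by
      refine Integrable.mul_bdd (c := 1) ?_ (hφ.comp measurable_fst).aestronglyMeasurable
        (ae_of_all _ fun p => hb _)
      exact (integrable_exp_mul_mWrightAt_prod hν hν1 hs).ofReal
    rw [setIntegral_congr_fun measurableSet_Ioi e1, ← integral_integral_swap hint,
      ← integral_const_mul]
    refine setIntegral_congr_fun measurableSet_Ioi fun x hx => ?_
    rw [integral_mul_const, integral_complex_ofReal, laplace_mWrightAt hν hν1 hx hs]
    push_cast
    rw [mul_comm (x : ℂ)]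
    ring

lemma exists_isInverseStableLaw {ν : ℝ} (hν : 0 < ν) (hν1 : ν ≤ 1) :
    ∃ m : Measure ℝ, IsInverseStableLaw ν m := by
  rcases hν1.lt_or_eq with h | rfl
  · exact ⟨_, isInverseStableLaw_mWright hν h⟩
  · exact ⟨_, isInverseStableLaw_dirac⟩

/-! ### The Green function as a product law; uniqueness -/

lemma rieszFellerSymbol_neg (α θ κ : ℝ) :
    rieszFellerSymbol α θ (-κ) = (starRingEnd ℂ) (rieszFellerSymbol α θ κ) := by
  unfold rieszFellerSymbol
  rw [map_mul, Complex.conj_ofReal, ← Complex.exp_conj, map_mul, Complex.conj_I,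
    Complex.conj_ofReal, abs_neg, Left.sign_neg]
  congr 2
  push_cast
  ring

lemma rieszFellerSymbol_neg_skew (α θ κ : ℝ) :
    rieszFellerSymbol α (-θ) κ = rieszFellerSymbol α θ (-κ) := by
  unfold rieszFellerSymbol
  rw [abs_neg, Left.sign_neg]
  congr 4
  push_cast
  ring

/-- For `κ > 0` this is the Stieltjes transform at `s / κ`, the powers of `κ` forming the symbol; `κ
< 0` follows by conjugation, and `κ = 0` expresses that the mass is 1. -/
lemma IsNeutralLaw.integral_one_div {α θ : ℝ} {h : Measure ℝ} (hα : 0 < α)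
    (hh : IsNeutralLaw α θ h) (κ : ℝ) {s : ℝ} (hs : 0 < s) :
    ∫ y, 1 / ((s : ℂ) - κ * y * Complex.I) ∂h =
      ((s ^ (α - 1) : ℝ) : ℂ) / (((s ^ α : ℝ) : ℂ) + rieszFellerSymbol α θ κ) := by
  have := hh.prob
  have hposcase : ∀ κ : ℝ, 0 < κ → ∫ y, 1 / ((s : ℂ) - κ * y * Complex.I) ∂h =
      ((s ^ (α - 1) : ℝ) : ℂ) / (((s ^ α : ℝ) : ℂ) + rieszFellerSymbol α θ κ) := by
    intro κ hκ
    have hκC : (κ : ℂ) ≠ 0 := Complex.ofReal_ne_zero.2 hκ.ne'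
    have e : ∀ y : ℝ, 1 / ((s : ℂ) - κ * y * Complex.I) =
        (κ : ℂ)⁻¹ * (1 / (((s / κ : ℝ) : ℂ) - y * Complex.I)) := fun y => by
      rw [← one_div, one_div_mul_one_div]
      congr 1
      push_cast
      field_simp
    simp only [e]
    rw [integral_const_mul, hh.stieltjes _ (div_pos hs hκ), neutralStieltjes,
      ← Complex.ofReal_cpow (div_pos hs hκ).le, ← Complex.ofReal_cpow (div_pos hs hκ).le,
      Real.div_rpow hs.le hκ.le, Real.div_rpow hs.le hκ.le, Real.rpow_sub_one hκ.ne' α,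
      rieszFellerSymbol, abs_of_pos hκ, sign_pos hκ]
    have hp : ((κ ^ α : ℝ) : ℂ) ≠ 0 :=
      Complex.ofReal_ne_zero.2 (Real.rpow_pos_of_pos hκ _).ne'
    have e2 : Complex.exp (Complex.I * ((((SignType.pos : SignType) : ℝ) * θ * Real.pi / 2 : ℝ) : ℂ)) =
        Complex.exp ((θ * Real.pi / 2 : ℝ) * Complex.I) := by
      rw [mul_comm]; simp
    have e3 : SignType.pos = (1 : SignType) := rfl
    rw [e3] at e2
    rw [e2]
    set w := Complex.exp ((θ * Real.pi / 2 : ℝ) * Complex.I)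
    have e4 : ((s ^ α / κ ^ α : ℝ) : ℂ) + w = (((s ^ α : ℝ) : ℂ) + (κ ^ α : ℝ) * w) / (κ ^ α : ℝ) := by
      push_cast at hp ⊢
      field_simp
    rw [e4, div_div_eq_mul_div, ← mul_div_assoc]
    congr 1
    rw [← Complex.ofReal_inv, ← Complex.ofReal_mul, ← Complex.ofReal_mul]
    congr 1
    have := (Real.rpow_pos_of_pos hκ α).ne'
    field_simp
  rcases lt_trichotomy κ 0 with hκ | rfl | hκ
  · have h1 := congrArg (starRingEnd ℂ) (hposcase (-κ) (by linarith))
    rw [← integral_conj, rieszFellerSymbol_neg, map_div₀, map_add, Complex.conj_conj,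
      Complex.conj_ofReal, Complex.conj_ofReal] at h1
    rw [← h1]
    refine integral_congr_ae (ae_of_all _ fun y => ?_)
    simp [sub_eq_add_neg]
  · have hsC : (s : ℂ) ≠ 0 := Complex.ofReal_ne_zero.2 hs.ne'
    have hp : ((s ^ α : ℝ) : ℂ) ≠ 0 := Complex.ofReal_ne_zero.2 (Real.rpow_pos_of_pos hs _).ne'
    simp only [Complex.ofReal_zero, zero_mul, sub_zero, integral_const, probReal_univ, one_smul]
    rw [rieszFellerSymbol, abs_zero, Real.zero_rpow hα.ne', Complex.ofReal_zero, zero_mul, add_zero,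
      Real.rpow_sub_one hs.ne']
    push_cast at hp ⊢
    field_simp
  · exact hposcase κ hκ

/-- Fubini, and `exp (i τ κ y)` has Laplace transform `1 / (s - i κ y)` in `τ`. So the dilates of
`h` solve the case `β = α`. -/
lemma IsNeutralLaw.laplace_charFun {α θ : ℝ} {h : Measure ℝ} (hα : 0 < α)
    (hh : IsNeutralLaw α θ h) (κ : ℝ) {s : ℝ} (hs : 0 < s) :
    ∫ τ in Ioi (0 : ℝ), (Real.exp (-(s * τ)) : ℂ) * charFun h (τ * κ) =
      ((s ^ (α - 1) : ℝ) : ℂ) / (((s ^ α : ℝ) : ℂ) + rieszFellerSymbol α θ κ) := by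
  have := hh.prob
  rw [← hh.integral_one_div hα κ hs]
  have he : IntegrableOn (fun t : ℝ => (Real.exp (-(s * t)) : ℂ)) (Ioi 0) := by
    have : IntegrableOn (fun t => Real.exp (-(s * t))) (Ioi 0) := by
      simpa only [neg_mul] using integrableOn_exp_mul_Ioi (neg_lt_zero.2 hs) 0
    exact this.ofReal
  have hint : Integrable (fun p : ℝ × ℝ => (Real.exp (-(s * p.1)) : ℂ) *
      Complex.exp ((p.1 * κ : ℝ) * p.2 * Complex.I)) ((volume.restrict (Ioi 0)).prod h) := by
    refine Integrable.mul_bdd (c := 1) (he.comp_fst h) (by fun_prop) (ae_of_all _ fun p => ?_)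
    rw [← Complex.ofReal_mul, Complex.norm_exp_ofReal_mul_I]
  have e1 : ∀ τ : ℝ, (Real.exp (-(s * τ)) : ℂ) * charFun h (τ * κ) =
      ∫ y, (Real.exp (-(s * τ)) : ℂ) * Complex.exp ((τ * κ : ℝ) * y * Complex.I) ∂h := fun τ => by
    rw [charFun_apply_real, integral_const_mul]
  simp only [e1]
  rw [integral_integral_swap hint]
  refine integral_congr_ae (ae_of_all _ fun y => ?_)
  have h1 := integral_exp_neg_mul_exp_I (y := κ * y) hs
  simp only [Complex.ofReal_mul, ← mul_assoc] at h1 ⊢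
  exact h1

/-- The law at time `t` of the product of an inverse stable subordinator and a neutral variable. -/
noncomputable def greenMeasure (ν : ℝ) (m h : Measure ℝ) (t : ℝ) : Measure ℝ :=
  (m.prod h).map fun p => t ^ ν * (p.1 * p.2)

lemma greenMeasure_eq_map (ν : ℝ) (m h : Measure ℝ) (t : ℝ) :
    greenMeasure ν m h t = ((m.prod h).map fun p => p.1 * p.2).map fun x => t ^ ν * x := by
  rw [greenMeasure, Measure.map_map (by fun_prop) (by fun_prop)]
  rfl

lemma charFun_greenMeasure {ν : ℝ} {m h : Measure ℝ} [IsProbabilityMeasure m]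
    [IsProbabilityMeasure h] (t κ : ℝ) :
    charFun (greenMeasure ν m h t) κ = ∫ z, charFun h (t ^ ν * z * κ) ∂m := by
  rw [charFun_apply_real, greenMeasure, integral_map (by fun_prop) (by fun_prop), integral_prod]
  · refine integral_congr_ae (ae_of_all _ fun z => ?_)
    simp only [charFun_apply_real]
    refine integral_congr_ae (ae_of_all _ fun y => ?_)
    simp only
    congr 1
    push_cast
    ring
  · refine (integrable_const (1 : ℝ)).mono' (by fun_prop) (ae_of_all _ fun p => ?_)
    rw [← Complex.ofReal_mul, Complex.norm_exp_ofReal_mul_I]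

lemma integrableOn_exp_mul_of_norm_le_one {f : ℝ → ℂ} (hf : ContinuousOn f (Ioi 0))
    (hb : ∀ t, 0 < t → ‖f t‖ ≤ 1) {s : ℝ} (hs : 0 < s) :
    IntegrableOn (fun t : ℝ => (Real.exp (-(s * t)) : ℂ) * f t) (Ioi 0) := by
  have : IntegrableOn (fun t => Real.exp (-(s * t))) (Ioi 0) := by
    simpa only [neg_mul] using integrableOn_exp_mul_Ioi (neg_lt_zero.2 hs) 0
  refine Integrable.mul_bdd (c := 1) this.ofReal (hf.aestronglyMeasurable measurableSet_Ioi) ?_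
  exact (ae_restrict_iff' measurableSet_Ioi).2 (ae_of_all _ hb)

/-- Conditioning on the first factor, the two transform identities compose: `s ^ (ν - 1) (s ^ ν) ^
(α - 1) = s ^ (β - 1)` and `(s ^ ν) ^ α = s ^ β` when `ν = β / α`. Continuity in time holds because
the law at time `t` is a dilate of a fixed one. -/
lemma isGreenFunction_greenMeasure {α β θ : ℝ} {m h : Measure ℝ} (hα : 0 < α)
    (hm : IsInverseStableLaw (β / α) m) (hh : IsNeutralLaw α θ h) :
    IsGreenFunction α β θ (greenMeasure (β / α) m h) := by
  have := hm.prob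
  have := hh.prob
  have hprob : IsProbabilityMeasure ((m.prod h).map fun p => p.1 * p.2) :=
    Measure.isProbabilityMeasure_map (by fun_prop)
  have hprob' : ∀ t, IsProbabilityMeasure (greenMeasure (β / α) m h t) := fun t =>
    Measure.isProbabilityMeasure_map (by fun_prop)
  have hc : ∀ κ : ℝ, ContinuousOn (fun t : ℝ => charFun (greenMeasure (β / α) m h t) κ) (Ioi 0) := by
    intro κ
    simp only [greenMeasure_eq_map, charFun_map_mul]
    refine continuous_charFun.comp_continuousOn (ContinuousOn.mul ?_ continuousOn_const)
    exact continuousOn_id.rpow_const fun t ht => Or.inl (ne_of_gt ht)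
  refine ⟨fun t _ => inferInstance, hc, fun κ s hs => ?_, fun κ s hs => ?_⟩
  · exact integrableOn_exp_mul_of_norm_le_one (hc κ) (fun t _ => norm_charFun_le_one _) hs
  · have hsν : 0 < s ^ (β / α) := Real.rpow_pos_of_pos hs _
    have hαβ : β / α * α = β := div_mul_cancel₀ _ hα.ne'
    have hexp : β / α - 1 + β / α * (α - 1) = β - 1 := by rw [mul_sub, hαβ]; ring
    simp only [charFun_greenMeasure]
    rw [hm.laplace (fun x => charFun h (x * κ)) (by fun_prop) (fun x => norm_charFun_le_one _) s hs,
      hh.laplace_charFun hα κ hsν, ← mul_div_assoc, ← Complex.ofReal_mul, ← Real.rpow_mul hs.le,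
      ← Real.rpow_mul hs.le, hαβ, ← Real.rpow_add hs, hexp]

lemma IsGreenFunction.unique {α β θ : ℝ} {G G' : ℝ → Measure ℝ} (hG : IsGreenFunction α β θ G)
    (hG' : IsGreenFunction α β θ G') {t : ℝ} (ht : 0 < t) : G t = G' t := by
  have := hG.finite t ht
  have := hG'.finite t ht
  refine Measure.ext_of_charFun (funext fun κ => ?_)
  refine eq_of_laplace_eq (hG.continuousOn κ) (hG'.continuousOn κ)
    (fun s hs => hG.integrableOn κ s hs) (fun s hs => hG'.integrableOn κ s hs) (fun s hs => ?_) ht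
  rw [hG.fourier_laplace κ s hs, hG'.fourier_laplace κ s hs]

lemma IsGreenFunction.map_neg {α β θ : ℝ} {G : ℝ → Measure ℝ} (hG : IsGreenFunction α β θ G) :
    IsGreenFunction α β (-θ) fun t => (G t).map fun x => -x := by
  have e : ∀ t κ : ℝ, charFun ((G t).map fun x => -x) κ = charFun (G t) (-κ) := fun t κ => by
    have := charFun_map_mul (μ := G t) (-1) κ
    simpa using this
  refine ⟨fun t ht => ?_, fun κ => ?_, fun κ s hs => ?_, fun κ s hs => ?_⟩
  · have := hG.finite t ht
    infer_instance
  · simp only [e]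
    exact hG.continuousOn _
  · simp only [e]
    exact hG.integrableOn _ s hs
  · simp only [e]
    rw [hG.fourier_laplace _ s hs, rieszFellerSymbol_neg_skew]

lemma greenMeasure_zero {ν : ℝ} {m h : Measure ℝ} [SFinite m] [SFinite h] (hm : m {0} = 0)
    (hh : h {0} = 0) {t : ℝ} (ht : 0 < t) : greenMeasure ν m h t {0} = 0 := by
  rw [greenMeasure, Measure.map_apply (by fun_prop) (measurableSet_singleton _)]
  refine measure_mono_null (t := ({0} ×ˢ univ) ∪ (univ ×ˢ {0})) (fun p hp => ?_) ?_
  · have hp : t ^ ν * (p.1 * p.2) = 0 := hp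
    rcases mul_eq_zero.1 ((mul_eq_zero.1 hp).resolve_left (Real.rpow_pos_of_pos ht ν).ne') with h | h
    · exact Or.inl ⟨h, mem_univ _⟩
    · exact Or.inr ⟨mem_univ _, h⟩
  · refine measure_union_null ?_ ?_
    · rw [Measure.prod_prod, hm, zero_mul]
    · rw [Measure.prod_prod, hh, mul_zero]

lemma greenMeasure_apply {ν : ℝ} {m h : Measure ℝ} [SFinite m] [SFinite h] {t : ℝ} {B : Set ℝ}
    (hB : MeasurableSet B) :
    greenMeasure ν m h t B = ∫⁻ z, h ((fun y => t ^ ν * (z * y)) ⁻¹' B) ∂m := by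
  have hmeas : Measurable fun p : ℝ × ℝ => t ^ ν * (p.1 * p.2) := by fun_prop
  rw [greenMeasure, Measure.map_apply hmeas hB, Measure.prod_apply (hmeas hB)]
  rfl

/-! ### The case `α = 2`: symmetrised inverse stable laws -/

/-- The law of a fair sign. -/
noncomputable def signLaw : Measure ℝ :=
  (2 : ENNReal)⁻¹ • Measure.dirac 1 + (2 : ENNReal)⁻¹ • Measure.dirac (-1)

instance : IsProbabilityMeasure signLaw := ⟨by simp [signLaw, ENNReal.inv_two_add_inv_two]⟩

/-- For `α = 2` the neutral equation is the wave equation, which carries half of the mass to each of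
`±t`. The density clause is vacuous, since `θ = α - 2`. -/
lemma isNeutralLaw_signLaw : IsNeutralLaw 2 0 signLaw := by
  refine ⟨inferInstance, by simp [signLaw], fun s hs => ?_, fun h => absurd h (by norm_num)⟩
  obtain ⟨-, -, h3⟩ := neutralRepresentation_two s hs
  rw [← h3, signLaw, integral_add_measure, integral_smul_measure, integral_smul_measure,
    integral_dirac, integral_dirac]
  · have hN : ∀ y, neutralDensity 2 0 y = 0 := fun y => by simp [neutralDensity]
    simp [hN, div_eq_mul_inv]
  all_goals exact (integrable_dirac (by simp)).smul_measure (by simp)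

/-- The inverse stable variable is positive, so only the sign `+1`, of probability one half,
contributes; this is the factor 2 in the subordination law. -/
lemma greenMeasure_signLaw_restrict {ν : ℝ} {m : Measure ℝ} [SFinite m] (hm : m (Iic 0) = 0)
    {t : ℝ} (ht : 0 < t) :
    (greenMeasure ν m signLaw t).restrict (Ioi 0) =
      (2 : ENNReal)⁻¹ • m.map fun z => t ^ ν * z := by
  have hp := Real.rpow_pos_of_pos ht ν
  refine Measure.ext fun B hB => ?_
  rw [Measure.restrict_apply hB, greenMeasure_apply (hB.inter measurableSet_Ioi)]
  have hae : ∀ᵐ z ∂m, 0 < z := by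
    filter_upwards [compl_mem_ae_iff.2 hm] with z hz
    exact not_le.1 hz
  have e : ∀ᵐ z ∂m, signLaw ((fun y => t ^ ν * (z * y)) ⁻¹' (B ∩ Ioi 0)) =
      (2 : ENNReal)⁻¹ * ((fun z => t ^ ν * z) ⁻¹' B).indicator 1 z := by
    filter_upwards [hae] with z hz
    have hmeas : MeasurableSet ((fun y => t ^ ν * (z * y)) ⁻¹' (B ∩ Ioi 0)) :=
      (by fun_prop : Measurable fun y => t ^ ν * (z * y)) (hB.inter measurableSet_Ioi)
    have h1 : 0 < t ^ ν * z := mul_pos hp hz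
    have h2 : (-1 : ℝ) ∉ (fun y => t ^ ν * (z * y)) ⁻¹' (B ∩ Ioi 0) := fun h => by
      have : 0 < t ^ ν * (z * -1) := h.2
      linarith
    rw [signLaw, Measure.add_apply, Measure.smul_apply, Measure.smul_apply,
      Measure.dirac_apply' _ hmeas, Measure.dirac_apply' _ hmeas, indicator_of_notMem h2,
      smul_zero, add_zero, smul_eq_mul]
    congr 1
    by_cases hz' : t ^ ν * z ∈ B
    · rw [indicator_of_mem, indicator_of_mem]
      · rfl
      · exact hz'
      · change t ^ ν * (z * 1) ∈ B ∩ Ioi 0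
        rw [mul_one]
        exact ⟨hz', h1⟩
    · rw [indicator_of_notMem, indicator_of_notMem]
      · exact hz'
      · exact fun h => hz' (by simpa using h.1)
  have hmeas : Measurable fun z : ℝ => t ^ ν * z := by fun_prop
  rw [lintegral_congr_ae e, lintegral_const_mul _ (measurable_one.indicator (hmeas hB)),
    lintegral_indicator_one (hmeas hB), Measure.smul_apply, Measure.map_apply hmeas hB, smul_eq_mul]

/-! ### Continuous densities on the half-line, scaling and mixtures -/

lemma eq_of_halfLineMeasure_eq {f g : ℝ → ℝ} (hf : ContinuousOn f (Ioi 0))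
    (hg : ContinuousOn g (Ioi 0)) (hf0 : ∀ x, 0 < x → 0 ≤ f x) (hg0 : ∀ x, 0 < x → 0 ≤ g x)
    [IsFiniteMeasure (halfLineMeasure f)] (h : halfLineMeasure f = halfLineMeasure g) {x : ℝ}
    (hx : 0 < x) : f x = g x := by
  have hfin : ∫⁻ x in Ioi (0 : ℝ), ENNReal.ofReal (f x) ≠ ⊤ := by
    have := measure_ne_top (halfLineMeasure f) univ
    rwa [halfLineMeasure, withDensity_apply _ MeasurableSet.univ, Measure.restrict_univ] at this
  have hae := (withDensity_eq_iff (hf.aemeasurable measurableSet_Ioi).ennreal_ofReal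
    (hg.aemeasurable measurableSet_Ioi).ennreal_ofReal hfin).1 h
  refine Measure.eqOn_open_of_ae_eq (μ := volume) ?_ isOpen_Ioi hf hg hx
  filter_upwards [hae, ae_restrict_mem measurableSet_Ioi] with y hy hy0
  exact (ENNReal.ofReal_eq_ofReal_iff (hf0 y hy0) (hg0 y hy0)).1 hy

lemma map_mul_halfLineMeasure (n : ℝ → ℝ) {c : ℝ} (hc : 0 < c) :
    (halfLineMeasure n).map (fun x => c * x) = halfLineMeasure fun x => c⁻¹ * n (x / c) := by
  have hmeas : Measurable fun x : ℝ => c * x := by fun_prop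
  refine Measure.ext fun B hB => ?_
  rw [Measure.map_apply hmeas hB, halfLineMeasure, halfLineMeasure,
    withDensity_apply _ (hmeas hB), withDensity_apply _ hB, Measure.restrict_restrict (hmeas hB),
    Measure.restrict_restrict hB]
  have himg : (fun x : ℝ => c * x) '' ((fun x : ℝ => c * x) ⁻¹' B ∩ Ioi 0) = B ∩ Ioi 0 := by
    ext x
    constructor
    · rintro ⟨y, ⟨hy, hy0⟩, rfl⟩
      exact ⟨hy, mul_pos hc hy0⟩
    · rintro ⟨hx, hx0⟩
      refine ⟨x / c, ⟨?_, div_pos hx0 hc⟩, mul_div_cancel₀ _ hc.ne'⟩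
      simpa [mul_div_cancel₀ _ hc.ne'] using hx
  have hcv := lintegral_image_eq_lintegral_abs_deriv_mul (f := fun x : ℝ => c * x)
    (f' := fun _ => c) ((hmeas hB).inter (measurableSet_Ioi (a := (0 : ℝ))))
    (fun x _ => by simpa using ((hasDerivAt_id x).const_mul c).hasDerivWithinAt)
    (mul_right_injective₀ hc.ne').injOn fun x => ENNReal.ofReal (c⁻¹ * n (x / c))
  rw [himg] at hcv
  rw [hcv]
  refine lintegral_congr fun x => ?_
  rw [abs_of_pos hc, ← ENNReal.ofReal_mul hc.le, mul_div_cancel_left₀ _ hc.ne',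
    mul_inv_cancel_left₀ hc.ne']

lemma restrict_map_mul (μ : Measure ℝ) {c : ℝ} (hc : 0 < c) :
    (μ.map fun x => c * x).restrict (Ioi 0) = (μ.restrict (Ioi 0)).map fun x => c * x := by
  rw [Measure.restrict_map (by fun_prop) measurableSet_Ioi]
  congr 2
  ext x
  simp [hc]

lemma map_mul_halfLineMeasure_mWright (ν : ℝ) {t : ℝ} (ht : 0 < t) :
    ((halfLineMeasure (mWright ν)).map fun z => t ^ ν * z) =
      halfLineMeasure fun x => mWrightAt ν x t := by
  rw [map_mul_halfLineMeasure _ (Real.rpow_pos_of_pos ht ν)]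
  simp only [mWrightAt, Real.rpow_neg ht.le]

/-- The density on the half-line of the product of an M-Wright variable and a variable with law
`h`. -/
noncomputable def mixtureDensity (ν : ℝ) (h : Measure ℝ) (x t : ℝ) : ℝ :=
  ∫ y in Ioi (0 : ℝ), y⁻¹ * mWrightAt ν (x / y) t ∂h

/-- The Jacobian `y⁻¹` cancels against the bound `1 / (x / y)`, so the integrand is bounded
uniformly in `y`. Mixing over any finite law is thus legitimate, and dominated convergence gives
continuity in `x`. -/
lemma abs_inv_mul_mWrightAt_le {ν x y t : ℝ} (hν : 0 < ν) (hν1 : ν < 1) (hx : 0 < x) (hy : 0 < y)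
    (ht : 0 < t) : |y⁻¹ * mWrightAt ν (x / y) t| ≤
      1 / Real.pi * (x * Real.cos (ν * (Real.pi / 2)) * ν)⁻¹ := by
  rw [abs_mul, abs_of_pos (inv_pos.2 hy)]
  calc y⁻¹ * |mWrightAt ν (x / y) t|
      ≤ y⁻¹ * (1 / Real.pi * (x / y * Real.cos (ν * (Real.pi / 2)) * ν)⁻¹) := by
        gcongr
        exact abs_mWrightAt_le hν hν1 (div_pos hx hy) ht
    _ = _ := by field_simp

lemma continuousOn_inv_mul_mWrightAt {ν t : ℝ} (hν : 0 < ν) (hν1 : ν < 1) (ht : 0 < t) :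
    ContinuousOn (fun p : ℝ × ℝ => p.2⁻¹ * mWrightAt ν (p.1 / p.2) t) (Ioi 0 ×ˢ Ioi 0) := by
  have h2 : ∀ p ∈ (Ioi (0 : ℝ) ×ˢ Ioi (0 : ℝ)), p.2 ≠ 0 := fun p hp => ne_of_gt hp.2
  refine (continuous_snd.continuousOn.inv₀ h2).mul ?_
  exact (continuousOn_mWrightAt_space hν hν1 ht).comp
    (continuous_fst.continuousOn.div continuous_snd.continuousOn h2) fun p hp =>
      div_pos (show 0 < p.1 from hp.1) (show 0 < p.2 from hp.2)

lemma integrable_inv_mul_mWrightAt {ν x t : ℝ} {h : Measure ℝ} [IsFiniteMeasure h] (hν : 0 < ν)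
    (hν1 : ν < 1) (hx : 0 < x) (ht : 0 < t) :
    IntegrableOn (fun y => y⁻¹ * mWrightAt ν (x / y) t) (Ioi 0) h := by
  refine (integrable_const (1 / Real.pi * (x * Real.cos (ν * (Real.pi / 2)) * ν)⁻¹)).mono' ?_ ?_
  · refine ContinuousOn.aestronglyMeasurable ?_ measurableSet_Ioi
    exact (continuousOn_inv_mul_mWrightAt hν hν1 ht).comp
      (by fun_prop : ContinuousOn (fun y : ℝ => (x, y)) (Ioi 0)) fun y hy => ⟨hx, hy⟩
  · exact (ae_restrict_iff' measurableSet_Ioi).2 (ae_of_all _ fun y hy =>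
      abs_inv_mul_mWrightAt_le hν hν1 hx hy ht)

lemma continuousOn_mixtureDensity {ν t : ℝ} {h : Measure ℝ} [IsFiniteMeasure h] (hν : 0 < ν)
    (hν1 : ν < 1) (ht : 0 < t) : ContinuousOn (fun x => mixtureDensity ν h x t) (Ioi 0) := by
  intro x₀ hx₀
  have hx₀ : (0 : ℝ) < x₀ := hx₀
  have hc := cos_mul_pi_div_two_pos hν hν1
  have hnear : ∀ᶠ x in 𝓝 x₀, x₀ / 2 < x := lt_mem_nhds (by linarith)
  refine ContinuousAt.continuousWithinAt (continuousAt_of_dominated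
    (bound := fun _ => 1 / Real.pi * (x₀ / 2 * Real.cos (ν * (Real.pi / 2)) * ν)⁻¹) ?_ ?_
    (integrable_const _) ?_)
  · filter_upwards [hnear] with x hx
    exact (integrable_inv_mul_mWrightAt hν hν1 (by linarith) ht).aestronglyMeasurable
  · filter_upwards [hnear] with x hx
    refine (ae_restrict_iff' measurableSet_Ioi).2 (ae_of_all _ fun y hy => ?_)
    refine (abs_inv_mul_mWrightAt_le hν hν1 (by linarith) hy ht).trans ?_
    gcongr
  · refine (ae_restrict_iff' measurableSet_Ioi).2 (ae_of_all _ fun y hy => ?_)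
    have h1 := ((continuousOn_inv_mul_mWrightAt hν hν1 ht).comp
      (by fun_prop : ContinuousOn (fun x : ℝ => (x, y)) (Ioi 0)) fun x hx => ⟨hx, hy⟩)
    exact h1.continuousAt (Ioi_mem_nhds hx₀)

lemma inv_mul_mWrightAt_nonneg {ν x y t : ℝ} (hν : 0 < ν) (hν1 : ν < 1) (hx : 0 < x) (hy : 0 < y)
    (ht : 0 < t) : 0 ≤ y⁻¹ * mWrightAt ν (x / y) t :=
  mul_nonneg (inv_nonneg.2 hy.le) (mWrightAt_nonneg hν hν1 (div_pos hx hy) ht)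

lemma mixtureDensity_nonneg {ν x t : ℝ} (h : Measure ℝ) (hν : 0 < ν) (hν1 : ν < 1) (hx : 0 < x)
    (ht : 0 < t) : 0 ≤ mixtureDensity ν h x t :=
  setIntegral_nonneg measurableSet_Ioi fun _ hy => inv_mul_mWrightAt_nonneg hν hν1 hx hy ht

lemma greenMeasure_restrict_eq_mixture {ν t : ℝ} {h : Measure ℝ} [IsFiniteMeasure h] (hν : 0 < ν)
    (hν1 : ν < 1) (ht : 0 < t) :
    (greenMeasure ν (halfLineMeasure (mWright ν)) h t).restrict (Ioi 0) =
      halfLineMeasure fun x => mixtureDensity ν h x t := by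
  have hp := Real.rpow_pos_of_pos ht ν
  have := (isInverseStableLaw_mWright hν hν1).prob
  have hmeas : Measurable fun p : ℝ × ℝ => t ^ ν * (p.1 * p.2) := by fun_prop
  refine Measure.ext fun B hB => ?_
  have hB' := hB.inter (measurableSet_Ioi (a := (0 : ℝ)))
  rw [Measure.restrict_apply hB, greenMeasure, Measure.map_apply hmeas hB',
    Measure.prod_apply_symm (hmeas hB')]
  have e1 : ∀ y : ℝ, halfLineMeasure (mWright ν)
      ((fun z => (z, y)) ⁻¹' ((fun p : ℝ × ℝ => t ^ ν * (p.1 * p.2)) ⁻¹' (B ∩ Ioi 0))) =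
      (Ioi 0).indicator (fun y => ∫⁻ x in B ∩ Ioi 0,
        ENNReal.ofReal (y⁻¹ * mWrightAt ν (x / y) t)) y := by
    intro y
    rcases lt_or_ge 0 y with hy | hy
    -- Given `y > 0` the product is a dilated M-Wright variable, with density `y⁻¹ * mWrightAt ν (x
    -- / y) t`; given `y ≤ 0` it never enters the positive half-line.
    · rw [indicator_of_mem (show y ∈ Ioi (0 : ℝ) from hy)]
      have hm := map_mul_halfLineMeasure (mWright ν) (mul_pos hp hy)
      have h2 := congrArg (fun μ => μ (B ∩ Ioi 0)) hm
      beta_reduce at h2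
      rw [Measure.map_apply (by fun_prop) hB', halfLineMeasure, halfLineMeasure,
        withDensity_apply _ hB', Measure.restrict_restrict hB', inter_assoc, inter_self] at h2
      rw [halfLineMeasure]
      convert h2 using 1
      · congr 1
        ext z
        simp only [mem_preimage]
        rw [mul_comm z y, mul_assoc]
      · refine lintegral_congr fun x => ?_
        rw [mWrightAt, Real.rpow_neg ht.le, ← mul_assoc, mul_inv, mul_comm y⁻¹, div_div,
          mul_comm y]
    · rw [indicator_of_notMem (show y ∉ Ioi (0 : ℝ) from not_lt.2 hy)]
      refine measure_mono_null (fun z hz => ?_) (halfLineMeasure_Iic _)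
      by_contra hz0
      have hz0 : 0 < z := not_le.1 hz0
      have h3 : 0 < t ^ ν * (z * y) := hz.2
      have : z * y ≤ 0 := mul_nonpos_of_nonneg_of_nonpos hz0.le hy
      nlinarith
  simp only [e1]
  rw [lintegral_indicator measurableSet_Ioi, halfLineMeasure, withDensity_apply _ hB,
    Measure.restrict_restrict hB, lintegral_lintegral_swap]
  · refine setLIntegral_congr_fun hB' fun x hx => ?_
    exact (ofReal_integral_eq_lintegral_ofReal (integrable_inv_mul_mWrightAt hν hν1 hx.2 ht)
      ((ae_restrict_iff' measurableSet_Ioi).2 (ae_of_all _ fun y hy =>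
        inv_mul_mWrightAt_nonneg hν hν1 hx.2 hy ht))).symm
  · have h3 : AEMeasurable (fun p : ℝ × ℝ => p.2⁻¹ * mWrightAt ν (p.1 / p.2) t)
        ((volume.restrict (B ∩ Ioi 0)).prod (h.restrict (Ioi 0))) := by
      rw [Measure.prod_restrict]
      exact ((continuousOn_inv_mul_mWrightAt hν hν1 ht).mono
        (prod_mono inter_subset_right subset_rfl)).aemeasurable (hB'.prod measurableSet_Ioi)
    exact h3.prod_swap.ennreal_ofReal

/-! ### Pointwise Green functions: uniqueness, self-similarity, examples -/

lemma greenMeasure_eq_map_one (ν : ℝ) (m h : Measure ℝ) (t : ℝ) :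
    greenMeasure ν m h t = (greenMeasure ν m h 1).map fun x => t ^ ν * x := by
  rw [greenMeasure_eq_map ν m h t, greenMeasure_eq_map ν m h 1]
  simp

lemma greenMeasure_dirac {h : Measure ℝ} [SFinite h] {ν τ : ℝ} (hν : ν = 1) :
    greenMeasure ν (Measure.dirac 1) h τ = h.map fun y => τ * y := by
  refine Measure.ext fun B hB => ?_
  rw [greenMeasure_apply hB, lintegral_dirac, Measure.map_apply (by fun_prop) hB]
  simp [hν]

lemma IsGreenDensity.restrict_eq {α β θ : ℝ} {g : ℝ → ℝ → ℝ} (hg : IsGreenDensity α β θ g)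
    {G : ℝ → Measure ℝ} (hG : IsGreenFunction α β θ G) {t : ℝ} (ht : 0 < t) :
    (G t).restrict (Ioi 0) = halfLineMeasure fun x => g x t := by
  obtain ⟨G', hG', h⟩ := hg
  rw [hG.unique hG' ht]
  exact (h t ht).2.2

lemma IsGreenDensity.unique {α β θ : ℝ} {f g : ℝ → ℝ → ℝ} (hf : IsGreenDensity α β θ f)
    (hg : IsGreenDensity α β θ g) {x t : ℝ} (hx : 0 < x) (ht : 0 < t) : f x t = g x t := by
  obtain ⟨G, hG, h⟩ := hf
  have h1 : (G t).restrict (Ioi 0) = halfLineMeasure fun x => f x t := (h t ht).2.2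
  have h2 := hg.restrict_eq hG ht
  obtain ⟨G', hG', h'⟩ := hg
  have := hG.finite t ht
  have : IsFiniteMeasure (halfLineMeasure fun x => f x t) := by rw [← h1]; infer_instance
  exact eq_of_halfLineMeasure_eq (h t ht).1 (h' t ht).1 (h t ht).2.1 (h' t ht).2.1
    (h1.symm.trans h2) hx

/-- The Green measure at time `t` is the dilate by `t ^ (β / α)` of the one at time 1; continuity
upgrades equality of measures to equality of densities at every point. -/
lemma IsGreenDensity.selfSimilar {α β θ : ℝ} (hα : 0 < α) (hα2 : α ≤ 2) (hθ : |θ| ≤ min α (2 - α))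
    (hβ : 0 < β) (hβα : β / α ≤ 1) {g : ℝ → ℝ → ℝ} (hg : IsGreenDensity α β θ g) {x t : ℝ}
    (hx : 0 < x) (ht : 0 < t) : g x t = t ^ (-(β / α)) * g (x / t ^ (β / α)) 1 := by
  obtain ⟨m, hm⟩ := exists_isInverseStableLaw (div_pos hβ hα) hβα
  obtain ⟨h, hh⟩ := exists_isNeutralLaw hα hα2 hθ
  have hG := isGreenFunction_greenMeasure hα hm hh
  have h1 := hg.restrict_eq hG one_pos
  have hct : ∀ t, 0 < t → ContinuousOn (fun x => g x t) (Ioi 0) := by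
    obtain ⟨_, _, h⟩ := hg; exact fun t ht => (h t ht).1
  have h0 : ∀ t, 0 < t → ∀ x, 0 < x → 0 ≤ g x t := by
    obtain ⟨_, _, h⟩ := hg; exact fun t ht => (h t ht).2.1
  have hp := Real.rpow_pos_of_pos ht (β / α)
  have h2 := hg.restrict_eq hG ht
  rw [greenMeasure_eq_map_one, restrict_map_mul _ hp, h1, map_mul_halfLineMeasure _ hp] at h2
  have hfin : IsFiniteMeasure (halfLineMeasure fun x => g x 1) := by
    have := hG.finite 1 one_pos
    rw [← h1]; infer_instance
  have : IsFiniteMeasure (halfLineMeasure fun x => (t ^ (β / α))⁻¹ * g (x / t ^ (β / α)) 1) := by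
    rw [← map_mul_halfLineMeasure (fun x => g x 1) hp]; infer_instance
  rw [Real.rpow_neg ht.le]
  refine (eq_of_halfLineMeasure_eq
    (f := fun x => (t ^ (β / α))⁻¹ * g (x / t ^ (β / α)) 1) (g := fun x => g x t) ?_ (hct t ht)
    (fun y hy => ?_) (h0 t ht) h2 hx).symm
  · exact continuousOn_const.mul ((hct 1 one_pos).comp (by fun_prop) fun y hy => div_pos hy hp)
  · exact mul_nonneg (inv_nonneg.2 hp.le) (h0 1 one_pos _ (div_pos hy hp))

lemma isGreenDensity_mixtureDensity {α β θ : ℝ} (hα : 0 < α) (hβ : 0 < β) (hβα : β < α)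
    {h : Measure ℝ} (hh : IsNeutralLaw α θ h) :
    IsGreenDensity α β θ (mixtureDensity (β / α) h) := by
  have hν : 0 < β / α := div_pos hβ hα
  have hν1 : β / α < 1 := (div_lt_one hα).2 hβα
  have := hh.prob
  exact ⟨_, isGreenFunction_greenMeasure hα (isInverseStableLaw_mWright hν hν1) hh,
    fun t ht => ⟨continuousOn_mixtureDensity hν hν1 ht,
      fun x hx => mixtureDensity_nonneg h hν hν1 hx ht,
      greenMeasure_restrict_eq_mixture hν hν1 ht⟩⟩

lemma isGreenFunction_inverse {ν : ℝ} {m : Measure ℝ} (hm : IsInverseStableLaw ν m) :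
    IsGreenFunction 2 (2 * ν) 0 (greenMeasure ν m signLaw) := by
  have e : 2 * ν / 2 = ν := by ring
  have := isGreenFunction_greenMeasure (α := 2) (β := 2 * ν) (θ := 0) two_pos (m := m)
    (by rwa [e]) isNeutralLaw_signLaw
  rwa [e] at this

lemma isGreenDensity_mWright {ν : ℝ} (hν : 0 < ν) (hν1 : ν < 1) :
    IsGreenDensity 2 (2 * ν) 0 fun x t => mWrightAt ν x t / 2 := by
  have hm := isInverseStableLaw_mWright hν hν1
  have := hm.prob
  refine ⟨_, isGreenFunction_inverse hm, fun t ht => ⟨?_, fun x hx => ?_, ?_⟩⟩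
  · exact (continuousOn_mWrightAt_space hν hν1 ht).div_const 2
  · exact div_nonneg (mWrightAt_nonneg hν hν1 hx ht) zero_le_two
  · rw [greenMeasure_signLaw_restrict hm.Iic_zero ht, map_mul_halfLineMeasure_mWright ν ht,
      halfLineMeasure, ← withDensity_smul' _ _ (by simp)]
    congr 1
    funext x
    beta_reduce
    rw [Pi.smul_apply, smul_eq_mul, div_eq_inv_mul, ENNReal.ofReal_mul (by norm_num),
      ENNReal.ofReal_inv_of_pos two_pos, ENNReal.ofReal_ofNat]

/-- For `β = α` the operational time is deterministic, so only the dilated neutral factor remains.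
-/
lemma isGreenFunction_neutral {α θ : ℝ} (hα : 0 < α) {h : Measure ℝ} (hh : IsNeutralLaw α θ h) :
    IsGreenFunction α α θ fun τ => h.map fun y => τ * y := by
  have := hh.prob
  have e : α / α = 1 := div_self hα.ne'
  have := isGreenFunction_greenMeasure (β := α) hα (m := Measure.dirac 1)
    (by rw [e]; exact isInverseStableLaw_dirac) hh
  have e2 : greenMeasure (α / α) (Measure.dirac 1) h = fun τ => h.map fun y => τ * y :=
    funext fun τ => greenMeasure_dirac e
  rwa [e2] at this

/-- The strict inequality keeps the angle below `π`, so the denominator does not vanish at `y = 1`.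
-/
lemma continuousOn_neutralDensity {α θ : ℝ} (hθ : |θ| ≤ min α (2 - α)) (hlt : α - 2 < θ) :
    ContinuousOn (neutralDensity α θ) (Ioi 0) := by
  have hπ := Real.pi_pos
  have h1 := abs_le.1 (hθ.trans (min_le_left _ _))
  have hc : -1 < Real.cos (Real.pi / 2 * (α - θ)) := by
    rw [← Real.cos_pi]
    exact Real.cos_lt_cos_of_nonneg_of_le_pi (by nlinarith) le_rfl (by nlinarith)
  have hr : ∀ a : ℝ, ContinuousOn (fun y : ℝ => y ^ a) (Ioi 0) := fun a =>
    continuousOn_id.rpow_const fun y hy => Or.inl (ne_of_gt hy)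
  refine continuousOn_const.mul (((hr _).mul continuousOn_const).div
    ((continuousOn_const.add ((continuousOn_const.mul (hr _)).mul continuousOn_const)).add (hr _))
    fun y hy => ?_)
  have hy : (0 : ℝ) < y := hy
  have hp : 0 < y ^ α := Real.rpow_pos_of_pos hy _
  have e3 : y ^ (2 * α) = (y ^ α) ^ 2 := by
    rw [mul_comm, Real.rpow_mul hy.le, Real.rpow_two]
  rw [e3]
  have : 0 < 2 * y ^ α * (Real.cos (Real.pi / 2 * (α - θ)) + 1) := by
    have : 0 < Real.cos (Real.pi / 2 * (α - θ)) + 1 := by linarith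
    positivity
  nlinarith [sq_nonneg (1 - y ^ α)]

lemma isGreenDensity_neutral {α θ : ℝ} (hα : 0 < α) (hα2 : α ≤ 2) (hθ : |θ| ≤ min α (2 - α))
    (hlt : α - 2 < θ) : IsGreenDensity α α θ (neutralDensityAt α θ) := by
  obtain ⟨h, hh⟩ := exists_isNeutralLaw hα hα2 hθ
  refine ⟨_, isGreenFunction_neutral hα hh, fun t ht => ⟨?_, fun x hx => ?_, ?_⟩⟩
  · exact continuousOn_const.mul ((continuousOn_neutralDensity hθ hlt).comp (by fun_prop)
      fun y hy => div_pos hy ht)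
  · exact mul_nonneg (inv_nonneg.2 ht.le) (neutralDensity_nonneg hθ (div_pos hx ht))
  · rw [restrict_map_mul _ ht, hh.density hlt, map_mul_halfLineMeasure _ ht]
    rfl

/-- Change of variables `y = x / τ` on the half-line. -/
lemma integral_comp_const_div {f : ℝ → ℝ} {x : ℝ} (hx : 0 < x) :
    (IntegrableOn f (Ioi 0) ↔ IntegrableOn (fun τ => x / τ ^ 2 * f (x / τ)) (Ioi 0)) ∧
      ∫ y in Ioi (0 : ℝ), f y = ∫ τ in Ioi (0 : ℝ), x / τ ^ 2 * f (x / τ) := by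
  have hd : ∀ τ ∈ Ioi (0 : ℝ), HasDerivWithinAt (fun τ => x / τ) (-(x / τ ^ 2)) (Ioi 0) τ := by
    intro τ hτ
    have := ((hasDerivAt_inv (ne_of_gt hτ)).const_mul x).hasDerivWithinAt (s := Ioi 0)
    simpa [div_eq_mul_inv] using this
  have hinj : InjOn (fun τ => x / τ) (Ioi 0) := fun a ha b hb hab => by
    have ha' : a ≠ 0 := ne_of_gt ha
    have hb' : b ≠ 0 := ne_of_gt hb
    simp only at hab
    field_simp at hab
    exact hab.symm
  have himg : (fun τ => x / τ) '' Ioi 0 = Ioi 0 := by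
    ext y
    constructor
    · rintro ⟨τ, hτ, rfl⟩
      exact div_pos hx hτ
    · intro hy
      have hy' : y ≠ 0 := ne_of_gt hy
      exact ⟨x / y, div_pos hx hy, by field_simp⟩
  have habs : ∀ τ : ℝ, |-(x / τ ^ 2)| = x / τ ^ 2 := fun τ => by
    rw [abs_neg, abs_of_nonneg (by positivity)]
  have h1 := integrableOn_image_iff_integrableOn_abs_deriv_smul measurableSet_Ioi hd hinj f
  have h2 := integral_image_eq_integral_abs_deriv_smul measurableSet_Ioi hd hinj f
  simp only [himg, habs, smul_eq_mul] at h1 h2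
  exact ⟨h1, h2⟩

/-- The mixture density as an integral over the operational time. -/
lemma mixtureDensity_eq_integral {ν x t : ℝ} {h : Measure ℝ} [IsFiniteMeasure h] (hν : 0 < ν)
    (hν1 : ν < 1) {n : ℝ → ℝ} (hn : ContinuousOn n (Ioi 0)) (hn0 : ∀ y, 0 < y → 0 ≤ n y)
    (hd : h.restrict (Ioi 0) = halfLineMeasure n) (hx : 0 < x) (ht : 0 < t) :
    IntegrableOn (fun τ => τ⁻¹ * n (x / τ) * mWrightAt ν τ t) (Ioi 0) ∧
      mixtureDensity ν h x t = ∫ τ in Ioi (0 : ℝ), τ⁻¹ * n (x / τ) * mWrightAt ν τ t := by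
  have hm := hn.aemeasurable measurableSet_Ioi (μ := volume)
  have hi := integrable_inv_mul_mWrightAt (h := h) hν hν1 hx ht
  rw [IntegrableOn, hd, integrable_halfLineMeasure_iff hm hn0] at hi
  obtain ⟨c1, c2⟩ := integral_comp_const_div
    (f := fun y => n y • (y⁻¹ * mWrightAt ν (x / y) t)) hx
  have e : ∀ τ ∈ Ioi (0 : ℝ), x / τ ^ 2 * (n (x / τ) • ((x / τ)⁻¹ * mWrightAt ν (x / (x / τ)) t)) =
      τ⁻¹ * n (x / τ) * mWrightAt ν τ t := fun τ hτ => by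
    have hτ' : τ ≠ 0 := ne_of_gt hτ
    rw [div_div_cancel₀ hx.ne', smul_eq_mul]
    field_simp
  refine ⟨(c1.1 hi).congr_fun e measurableSet_Ioi, ?_⟩
  rw [mixtureDensity, hd, integral_halfLineMeasure hm hn0, c2]
  exact setIntegral_congr_fun measurableSet_Ioi e

/-! ### The subordination laws and the main theorem -/

theorem green_subordination {α β θ : ℝ} (hα : 0 < α) (hα2 : α ≤ 2) (hθ : |θ| ≤ min α (2 - α))
    (hβ : 0 < β) (hβα : β / α ≤ 1) {G H J : ℝ → Measure ℝ} (hG : IsGreenFunction α β θ G)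
    (hH : IsGreenFunction α α θ H) (hJ : IsGreenFunction 2 (2 * (β / α)) 0 J) {t : ℝ} (ht : 0 < t)
    {B : Set ℝ} (hB : MeasurableSet B) :
    G t B = 2 * ∫⁻ τ in Ioi (0 : ℝ), H τ B ∂(J t) := by
  obtain ⟨m, hm⟩ := exists_isInverseStableLaw (div_pos hβ hα) hβα
  obtain ⟨h, hh⟩ := exists_isNeutralLaw hα hα2 hθ
  have := hm.prob
  have := hh.prob
  have hmeas : Measurable fun τ : ℝ => h ((fun y => τ * y) ⁻¹' B) :=
    measurable_measure_prodMk_left ((by fun_prop : Measurable fun p : ℝ × ℝ => p.1 * p.2) hB)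
  have e : ∫⁻ τ in Ioi (0 : ℝ), H τ B ∂(J t) =
      ∫⁻ τ in Ioi (0 : ℝ), h ((fun y => τ * y) ⁻¹' B) ∂(J t) := by
    refine setLIntegral_congr_fun measurableSet_Ioi fun τ hτ => ?_
    rw [hH.unique (isGreenFunction_neutral hα hh) hτ, Measure.map_apply (by fun_prop) hB]
  -- The half-mass of `J` on the positive axis cancels the factor 2, and what remains is the product
  -- law conditioned on its first factor.
  rw [e, hJ.unique (isGreenFunction_inverse hm) ht, greenMeasure_signLaw_restrict hm.Iic_zero ht,
    lintegral_smul_measure, lintegral_map hmeas (by fun_prop), smul_eq_mul, ← mul_assoc,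
    ENNReal.mul_inv_cancel two_ne_zero (by simp), one_mul,
    hG.unique (isGreenFunction_greenMeasure hα hm hh) ht, greenMeasure_apply hB]
  simp only [mul_assoc]

theorem mainTheorem4 (α β θ : ℝ) (hα : 0 < α) (hα2 : α ≤ 2) (hθ : |θ| ≤ min α (2 - α))
    (hβ : 0 < β) (hβα : β / α ≤ 1) :
    -- the Green function exists and is unique, has no mass at the origin, and is symmetric
    (∃ G : ℝ → Measure ℝ, IsGreenFunction α β θ G) ∧
    (∀ G G' : ℝ → Measure ℝ, IsGreenFunction α β θ G → IsGreenFunction α β θ G' →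
      ∀ t : ℝ, 0 < t → G t = G' t) ∧
    (∀ G : ℝ → Measure ℝ, IsGreenFunction α β θ G →
      (∀ t : ℝ, 0 < t → G t {0} = 0) ∧
      IsGreenFunction α β (-θ) (fun t => (G t).map (fun x => -x))) ∧
    -- the law `G_{α,β}^θ = 2 ∫ G_{α,α}^θ(·; τ) G_{2,2β/α}^0(τ; t) dτ` for measures
    (∀ G H J : ℝ → Measure ℝ, IsGreenFunction α β θ G → IsGreenFunction α α θ H →
      IsGreenFunction 2 (2 * (β / α)) 0 J →
      ∀ t : ℝ, 0 < t → ∀ B : Set ℝ, MeasurableSet B →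
        G t B = 2 * ∫⁻ τ in Ioi (0 : ℝ), H τ B ∂(J t)) ∧
    -- `M_{β/α} = 2 G_{2,2β/α}^0`, with `M_1(x; t) = δ(x - t)`
    (β < α → IsGreenDensity 2 (2 * (β / α)) 0 (fun x t => mWrightAt (β / α) x t / 2)) ∧
    (β = α → ∀ J : ℝ → Measure ℝ, IsGreenFunction 2 (2 * (β / α)) 0 J →
      ∀ t : ℝ, 0 < t → (2 : ENNReal) • (J t).restrict (Ioi 0) = Measure.dirac t) ∧
    -- `N_α^θ = G_{α,α}^θ`
    (α - 2 < θ → IsGreenDensity α α θ (neutralDensityAt α θ)) ∧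
    -- existence and self-similarity of the pointwise Green function
    (β < α ∨ α - 2 < θ → ∃ g : ℝ → ℝ → ℝ, IsGreenDensity α β θ g) ∧
    (∀ g : ℝ → ℝ → ℝ, IsGreenDensity α β θ g → ∀ x t : ℝ, 0 < x → 0 < t →
      g x t = t ^ (-(β / α)) * g (x / t ^ (β / α)) 1) ∧
    -- the law `K_{α,β}^θ(x; t) = ∫ N_α^θ(x; τ) M_{β/α}(τ; t) dτ`
    (α - 2 < θ → ∀ K : ℝ → ℝ → ℝ, IsGreenDensity α β θ K → ∀ x t : ℝ, 0 < x → 0 < t →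
      (β < α →
        IntegrableOn (fun τ : ℝ => neutralDensityAt α θ x τ * mWrightAt (β / α) τ t) (Ioi 0) ∧
        K x t = ∫ τ in Ioi (0 : ℝ), neutralDensityAt α θ x τ * mWrightAt (β / α) τ t) ∧
      (β = α → K x t = neutralDensityAt α θ x t)) ∧
    -- the law for measures, in pointwise form
    (β < α → ∀ g h j : ℝ → ℝ → ℝ, IsGreenDensity α β θ g → IsGreenDensity α α θ h →
      IsGreenDensity 2 (2 * (β / α)) 0 j → ∀ x t : ℝ, 0 < x → 0 < t →
        IntegrableOn (fun τ : ℝ => h x τ * j τ t) (Ioi 0) ∧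
        g x t = 2 * ∫ τ in Ioi (0 : ℝ), h x τ * j τ t) := by
  have hν : 0 < β / α := div_pos hβ hα
  obtain ⟨m, hm⟩ := exists_isInverseStableLaw hν hβα
  obtain ⟨h, hh⟩ := exists_isNeutralLaw hα hα2 hθ
  have := hm.prob
  have := hh.prob
  have hG := isGreenFunction_greenMeasure hα hm hh
  have hlt : β < α → β / α < 1 := fun h => (div_lt_one hα).2 h
  refine ⟨⟨_, hG⟩, fun G G' h1 h2 t ht => h1.unique h2 ht, fun G h1 => ⟨fun t ht => ?_, h1.map_neg⟩,
    fun G H J h1 h2 h3 t ht B hB => green_subordination hα hα2 hθ hβ hβα h1 h2 h3 ht hB,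
    fun hb => isGreenDensity_mWright hν (hlt hb), fun hb J hJ t ht => ?_,
    fun hl => isGreenDensity_neutral hα hα2 hθ hl, fun hor => ?_,
    fun g hg x t hx ht => hg.selfSimilar hα hα2 hθ hβ hβα hx ht,
    fun hl K hK x t hx ht => ⟨fun hb => ?_, fun hb => ?_⟩,
    fun hb g h' j hg hh' hj x t hx ht => ?_⟩
  · rw [h1.unique hG ht]
    exact greenMeasure_zero (measure_mono_null (by simp) hm.Iic_zero) hh.zero ht
  · have e : β / α = 1 := by rw [hb, div_self hα.ne']
    rw [e] at hJ
    rw [hJ.unique (isGreenFunction_inverse isInverseStableLaw_dirac) ht,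
      greenMeasure_signLaw_restrict isInverseStableLaw_dirac.Iic_zero ht, smul_smul,
      ENNReal.mul_inv_cancel two_ne_zero (by simp), one_smul, Measure.map_dirac' (by fun_prop)]
    simp
  · rcases lt_or_eq_of_le ((div_le_one hα).1 hβα) with hb | rfl
    · exact ⟨_, isGreenDensity_mixtureDensity hα hβ hb hh⟩
    · exact ⟨_, isGreenDensity_neutral hα hα2 hθ (hor.resolve_left (lt_irrefl _))⟩
  · have hmix := mixtureDensity_eq_integral hν (hlt hb) (continuousOn_neutralDensity hθ hl)
      (fun y hy => neutralDensity_nonneg hθ hy) (hh.density hl) hx ht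
    exact ⟨hmix.1, (hK.unique (isGreenDensity_mixtureDensity hα hβ hb hh) hx ht).trans hmix.2⟩
  · subst hb
    exact hK.unique (isGreenDensity_neutral hα hα2 hθ hl) hx ht
  -- At time 1 the neutral Green function is `h` itself, so `h' · 1` is its half-line density and
  -- can replace `N_α^θ`. Self-similarity then recovers `h' x τ`, without any condition on `θ`.
  · have hd := hh'.restrict_eq (isGreenFunction_neutral hα hh) one_pos
    simp only [one_mul, Measure.map_id'] at hd
    have hprop : ContinuousOn (fun x => h' x 1) (Ioi 0) ∧ ∀ y, 0 < y → 0 ≤ h' y 1 := by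
      obtain ⟨_, _, hp⟩ := hh'
      exact ⟨(hp 1 one_pos).1, (hp 1 one_pos).2.1⟩
    have hmix := mixtureDensity_eq_integral hν (hlt hb) hprop.1 hprop.2 hd hx ht
    have e : ∀ τ ∈ Ioi (0 : ℝ), τ⁻¹ * h' (x / τ) 1 * mWrightAt (β / α) τ t =
        2 * (h' x τ * j τ t) := fun τ hτ => by
      have hαα : α / α = 1 := div_self hα.ne'
      have h1 := hh'.selfSimilar hα hα2 hθ hα hαα.le hx hτ
      rw [hαα, Real.rpow_one, Real.rpow_neg_one] at h1
      rw [hj.unique (isGreenDensity_mWright hν (hlt hb)) hτ ht, h1]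
      ring
    constructor
    · have := (hmix.1.congr_fun e measurableSet_Ioi).const_mul (2 : ℝ)⁻¹
      simpa [IntegrableOn] using this
    · rw [hg.unique (isGreenDensity_mixtureDensity hα hβ hb hh) hx ht, hmix.2,
        setIntegral_congr_fun measurableSet_Ioi e, integral_const_mul]
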